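/- Let $n=m+r$ and let $A_1,\dots,A_d,Q$ be real $n\times n$ matrices, with $A_1$ invertible and with $n^+$ positive eigenvalues (eigenvalues are always counted with algebraic multiplicity). Let $B$ be a real $n^+\times n$ matrix of full rank. Consider $U_t+\sum_{j=1}^d A_jU_{x_j}=QU/\epsilon$ in $x_1>0$, $\hat x=(x_2,\dots,x_d)\in\mathbb R^{d-1}$, with the boundary condition $BU=b$ at $x_1=0$. A right-stable matrix of a square complex matrix $X$ with $s$ stable eigenvalues (eigenvalues of negative real part) is a matrix $R$ with $s$ columns and of full column rank such that $XR=RY$ for an $s\times s$ matrix $Y$ all of whose eigenvalues are stable. Below, $*$ is the conjugate transpose (the transpose for real matrices). Assume: 1. (Structural stability.) There are an invertible real $n\times n$ matrix $P$, an invertible real $r\times r$ matrix $S$ and a symmetric positive definite matrix $A_0$ such that $PQ=\operatorname{diag}(0,S)P$, every $A_0A_j$ is symmetric, and $A_0Q+Q^*A_0\le -P^*\operatorname{diag}(0,I_r)P$. 2. (Symmetry.) $A_0Q=Q^*A_0$. 3. (Generalized Kreiss Condition.) With $M(\xi,\omega,\eta)=A_1^{-1}\bigl(\eta Q-\xi I_n-i\sum_{j=2}^d\omega_jA_j\bigr)$,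 there is a constant $c>0$ such that $|\det(BR)|\ge c\sqrt{\det(R^*R)}$ for all $\eta\ge 0$, $\omega=(\omega_2,\dots,\omega_d)\in\mathbb R^{d-1}$, all $\xi\in\mathbb C$ with $\operatorname{Re}\xi>0$, and every right-stable matrix $R$ of $M(\xi,\omega,\eta)$ with $n^+$ columns. 4. (Characteristic equilibrium boundary.) The upper left $m\times m$ block of $PA_1P^{-1}$ is singular. Then there is an invertible real matrix $T$ with $T^*T=A_0$ and $TQT^{-1}=\operatorname{diag}(0,S')$, where $S'$ is an $r\times r$ symmetric negative definite matrix; that is, the unknown $TU=(u,v)$ satisfies a system in normal form. For every such $T$ let $A_{j11}$ be the upper left $m\times m$ block of $TA_jT^{-1}$, put $A_{11}=A_{111}$, and write $BT^{-1}=(B_u,B_v)$. The equilibrium system is $\bar u_t+\sum_{j=1}^d A_{j11}\bar u_{x_j}=0$. Let $n_1^+$ be the number of positive eigenvalues of $A_{11}$, and let $(P_1,P_0)$ be any real orthogonal $m\times m$ matrix with $(P_1,P_0)^*A_{11}(P_1,P_0)=\operatorname{diag}(\Lambda_1,0)$, $\Lambda_1$ diagonal and invertible. Put $C_{kl}(\omega)=P_k^*\bigl(i\sum_{j=2}^d\omega_jA_{j11}\bigr)P_l$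 for $k,l\in\{0,1\}$ and $$M_1(\xi,\omega)=-\Lambda_1^{-1}\Bigl(\bigl[\xi I+C_{11}(\omega)\bigr]-C_{10}(\omega)\bigl[\xi I+C_{00}(\omega)\bigr]^{-1}C_{01}(\omega)\Bigr).$$ Then $M_1(\xi,\omega)$ has exactly $n_1^+$ stable eigenvalues whenever $\operatorname{Re}\xi>0$ and $\omega\in\mathbb R^{d-1}$, and there is a real $n_1^+\times n^+$ matrix $B_o$ of full rank, independent of $\xi$ and $\omega$, such that the reduced boundary condition $B_oB_u\bar u(t,0,\hat x)=B_ob(t,\hat x)$ for the equilibrium system satisfies $$B_oB_uP_0=0$$ and the Uniform Kreiss Condition for characteristic problems: there is a constant $c>0$ such that $$|\det(B_oB_uP_1R_{11}^S)|\ge c\sqrt{\det(R_{11}^{S*}R_{11}^S)}$$ for all $\omega\in\mathbb R^{d-1}$, all $\xi\in\mathbb C$ with $\operatorname{Re}\xi>0$, and every right-stable matrix $R_{11}^S$ of $M_1(\xi,\omega)$. -/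

import Mathlib

open Matrix

noncomputable section

namespace RelaxationIBVP

/-- A real matrix regarded as a complex one. -/
def toC {α β : Type*} (X : Matrix α β ℝ) : Matrix α β ℂ := X.map Complex.ofReal

/-- Number of positive real eigenvalues, with algebraic multiplicity. -/
def posEigCount {ν : Type*} [Fintype ν] [DecidableEq ν] (X : Matrix ν ν ℝ) : ℕ :=
  X.charpoly.roots.countP (fun x => 0 < x)

/-- Number of stable eigenvalues (negative real part), with algebraic multiplicity. -/
def stableCount {ν : Type*} [Fintype ν] [DecidableEq ν] (X : Matrix ν ν ℂ) : ℕ :=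
  X.charpoly.roots.countP (fun z => z.re < 0)

/-- `R` is a right-stable matrix of `X`: it has one column for each stable eigenvalue of `X`, has
full column rank, and `X R = R Y` with `Y` a stable matrix. -/
def IsRightStable {ν κ : Type*} [Fintype ν] [DecidableEq ν] [Fintype κ] [DecidableEq κ]
    (X : Matrix ν ν ℂ) (R : Matrix ν κ ℂ) : Prop :=
  stableCount X = Fintype.card κ ∧ R.rank = Fintype.card κ ∧
    ∃ Y : Matrix κ κ ℂ, X * R = R * Y ∧ ∀ z ∈ spectrum ℂ Y, z.re < 0

/-- The quantity `√ det (R* R)`, with `R*` the conjugate transpose. -/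
def gramRoot {ν κ : Type*} [Fintype ν] [Fintype κ] [DecidableEq κ] (R : Matrix ν κ ℂ) : ℝ :=
  Real.sqrt (Rᴴ * R).det.re

/-- The structural stability condition for `U_t + ∑ A_j U_{x_j} = Q U / ε`. Here `A 0` is the
coefficient of `∂/∂x₁`; the unknowns are indexed by `Fin m ⊕ Fin r`, so `n = m + r`. -/
structure StructuralStability {k m r : ℕ}
    (A : Fin (k + 1) → Matrix (Fin m ⊕ Fin r) (Fin m ⊕ Fin r) ℝ)
    (Q P : Matrix (Fin m ⊕ Fin r) (Fin m ⊕ Fin r) ℝ) (S : Matrix (Fin r) (Fin r) ℝ)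
    (A₀ : Matrix (Fin m ⊕ Fin r) (Fin m ⊕ Fin r) ℝ) : Prop where
  isUnit_P : IsUnit P.det
  isUnit_S : IsUnit S.det
  source : P * Q = fromBlocks 0 0 0 S * P
  posDef : A₀.PosDef
  symm : ∀ j, (A₀ * A j).IsSymm
  /-- `A₀ Q + Q* A₀ ≤ - P* diag(0, I_r) P`. -/
  coupling : (-(Pᵀ * fromBlocks 0 0 0 1 * P) - (A₀ * Q + Qᵀ * A₀)).PosSemidef

/-- `i ∑_{j ≥ 2} ω_j A_j`. -/
def tangentialSymbol {ν : Type*} {k : ℕ} (A : Fin (k + 1) → Matrix ν ν ℝ) (ω : Fin k → ℝ) :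
    Matrix ν ν ℂ :=
  Complex.I • ∑ j : Fin k, (ω j : ℂ) • toC (A j.succ)

/-- `M(ξ, ω, η) = A_1⁻¹ (η Q - ξ I - i ∑_{j ≥ 2} ω_j A_j)`. -/
def kreissMatrix {ν : Type*} [Fintype ν] [DecidableEq ν] {k : ℕ}
    (A : Fin (k + 1) → Matrix ν ν ℝ) (Q : Matrix ν ν ℝ) (ξ : ℂ) (ω : Fin k → ℝ) (η : ℝ) :
    Matrix ν ν ℂ :=
  (toC (A 0))⁻¹ * ((η : ℂ) • toC Q - ξ • (1 : Matrix ν ν ℂ) - tangentialSymbol A ω)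

/-- The Generalized Kreiss Condition for the boundary matrix `B`. -/
def GeneralizedKreissCondition {ν : Type*} [Fintype ν] [DecidableEq ν] {k s : ℕ}
    (A : Fin (k + 1) → Matrix ν ν ℝ) (Q : Matrix ν ν ℝ) (B : Matrix (Fin s) ν ℝ) : Prop :=
  ∃ c : ℝ, 0 < c ∧ ∀ (η : ℝ) (ω : Fin k → ℝ) (ξ : ℂ), 0 ≤ η → 0 < ξ.re →
    ∀ R : Matrix ν (Fin s) ℂ, IsRightStable (kreissMatrix A Q ξ ω η) R →
      c * gramRoot R ≤ ‖(toC B * R).det‖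

/-- The change of unknowns `T U` brings the system to normal form: the symmetrizer becomes the
identity (`T* T = A₀`), and the source matrix becomes `diag(0, S)` with `S` symmetric negative
definite. The coefficients become `T A_j T⁻¹` and the boundary matrix `B T⁻¹`. -/
def IsNormalizing {m r : ℕ} (Q A₀ T : Matrix (Fin m ⊕ Fin r) (Fin m ⊕ Fin r) ℝ) : Prop :=
  IsUnit T.det ∧ Tᵀ * T = A₀ ∧
    ∃ S : Matrix (Fin r) (Fin r) ℝ, (-S).PosDef ∧ T * Q * T⁻¹ = fromBlocks 0 0 0 S

/-- The coefficient of the equilibrium system in the coordinates `T U = (u, v)`: the upper left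
`m × m` block of `T X T⁻¹`. -/
def equilibriumBlock {m r : ℕ} (T X : Matrix (Fin m ⊕ Fin r) (Fin m ⊕ Fin r) ℝ) :
    Matrix (Fin m) (Fin m) ℝ :=
  (T * X * T⁻¹).toBlocks₁₁

/-- The columns `B_u` of `B T⁻¹ = (B_u, B_v)`. -/
def equilibriumBoundary {m r s : ℕ} (T : Matrix (Fin m ⊕ Fin r) (Fin m ⊕ Fin r) ℝ)
    (B : Matrix (Fin s) (Fin m ⊕ Fin r) ℝ) : Matrix (Fin s) (Fin m) ℝ :=
  (B * T⁻¹).toCols₁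

/-- `(P₁, P₀)` is orthogonal and `(P₁, P₀)* E (P₁, P₀) = diag(Λ₁, 0)` with `Λ₁ = diagonal lam`
invertible. -/
structure IsSpectralFrame {m p q : ℕ} (E : Matrix (Fin m) (Fin m) ℝ)
    (P₁ : Matrix (Fin m) (Fin p) ℝ) (P₀ : Matrix (Fin m) (Fin q) ℝ) (lam : Fin p → ℝ) : Prop where
  orth_left : (fromCols P₁ P₀)ᵀ * fromCols P₁ P₀ = 1
  orth_right : fromCols P₁ P₀ * (fromCols P₁ P₀)ᵀ = 1
  diag : (fromCols P₁ P₀)ᵀ * E * fromCols P₁ P₀ = fromBlocks (diagonal lam) 0 0 0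
  ne_zero : ∀ i, lam i ≠ 0

/-- `M₁(ξ, ω) = -Λ₁⁻¹ ([ξ I + C₁₁] - C₁₀ [ξ I + C₀₀]⁻¹ C₀₁)`, where
`C_kl = P_k* (i ∑_{j ≥ 2} ω_j E_j) P_l` and the `E_j` are the coefficients of the equilibrium
system. -/
def reducedMatrix {k m p q : ℕ} (E : Fin (k + 1) → Matrix (Fin m) (Fin m) ℝ)
    (P₁ : Matrix (Fin m) (Fin p) ℝ) (P₀ : Matrix (Fin m) (Fin q) ℝ) (lam : Fin p → ℝ)
    (ξ : ℂ) (ω : Fin k → ℝ) : Matrix (Fin p) (Fin p) ℂ :=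
  -((toC (diagonal lam))⁻¹ *
    ((ξ • (1 : Matrix (Fin p) (Fin p) ℂ) + (toC P₁)ᴴ * tangentialSymbol E ω * toC P₁) -
      ((toC P₁)ᴴ * tangentialSymbol E ω * toC P₀) *
        (ξ • (1 : Matrix (Fin q) (Fin q) ℂ) + (toC P₀)ᴴ * tangentialSymbol E ω * toC P₀)⁻¹ *
        ((toC P₀)ᴴ * tangentialSymbol E ω * toC P₁)))

/-- The Uniform Kreiss Condition for the characteristic problem of the equilibrium system with
boundary matrix `Bt`. The constant does not depend on `ξ`, `ω` or on the choice of the right-stable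
matrix. -/
def UniformKreissCondition {k m p q s : ℕ} (E : Fin (k + 1) → Matrix (Fin m) (Fin m) ℝ)
    (P₁ : Matrix (Fin m) (Fin p) ℝ) (P₀ : Matrix (Fin m) (Fin q) ℝ) (lam : Fin p → ℝ)
    (Bt : Matrix (Fin s) (Fin m) ℝ) : Prop :=
  ∃ c : ℝ, 0 < c ∧ ∀ (ω : Fin k → ℝ) (ξ : ℂ), 0 < ξ.re →
    ∀ R : Matrix (Fin p) (Fin s) ℂ, IsRightStable (reducedMatrix E P₁ P₀ lam ξ ω) R →
      c * gramRoot R ≤ ‖(toC Bt * toC P₁ * R).det‖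

end RelaxationIBVP

end

/-!
In normal form the coefficients `A_j` are symmetric and `Q = diag(0, S)` with `S < 0`. The energy
identity `Re x* A_1 M(ξ, ω, η) x = η x* Q x - Re ξ |x|² < 0` makes `M(ξ, ω, η)` dissipative for the
form of `A_1`. By the theorems of Lyapunov and Ostrowski-Schneider (`hForm_pos_of_stable`,
`IsOrthDiag.stableCount_eq`), `A_1` is positive on the stable subspace of `M(ξ, ω, η)`, whose
dimension is `n⁺`; since `M₁(ξ, ω)` is dissipative for `Λ₁` in the same way, it has `n₁⁺` stable
eigenvalues.

Fix `ξ` and `ω` and let `η → ∞`. By compactness the stable subspaces accumulate at a subspace `W` of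
dimension `n⁺`, on which the Kreiss determinant is still at least `c`. No explicit asymptotic
expansion is needed: `W` is nonnegative for `A_1`, and it is invariant under the limits of `M / η`
and of `M⁻¹` (`IsNormalForm.exists_limit_frame`). Under the first of them, `A_1⁻¹ Q`, the kernel in
`W` consists of equilibrium states and the image of `W` consists of boundary layers, that is, of
sums of eigenvectors of `A_1⁻¹ Q` for negative eigenvalues. Nonnegativity bounds the dimension of
the former by `n₁⁺ + dim ker A_11`. Conversely, a maximal nonnegative subspace for `A_11` and the
space of all boundary layers are independent and span a nonnegative subspace for `A_1`, so that
their dimensions add up to at most `n⁺`. Hence these bounds are equalities, and `W` is the direct sum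
of the boundary layers, the kernel of `A_11` and, by the second invariance, the stable subspace of
`M₁` carried by `P₁` (`IsFastFrame.mem_limit`, `IsSpectralFrame.mulVec_P₁_mem`).

The first two summands do not depend on `ξ` and `ω`, and `B` is injective on them because its
determinant on `W` does not vanish. Let `B_o` consist of `n₁⁺` independent rows annihilating their
image under `B`. Completing `B_o` to an invertible matrix by rows dual to that image makes `B` block
triangular on `W`, so that `det (B_o B_u P₁ R)` is a fixed multiple of the determinant of `B` in a
basis of `W`, whose Gram determinant is bounded below by that of `R`
(`IsNormalForm.exists_reduced_boundary`). The Generalized Kreiss Condition is invariant under the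
change of unknowns `T` (`GeneralizedKreissCondition.conj`), and `T` itself is found by diagonalizing
`L Q L⁻¹` where `A₀ = L* L` (`StructuralStability.exists_isNormalizing`).
-/

open Matrix

noncomputable section

namespace RelaxationIBVP

/-! ### Complexification of real matrices -/

section ToC

variable {α β γ δ : Type*}

theorem toC_mul [Fintype β] (X : Matrix α β ℝ) (Y : Matrix β γ ℝ) :
    toC (X * Y) = toC X * toC Y :=
  Matrix.map_mul (f := Complex.ofRealHom)

theorem toC_one [DecidableEq α] : toC (1 : Matrix α α ℝ) = 1 :=
  Matrix.map_one _ Complex.ofReal_zero Complex.ofReal_one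

theorem toC_zero : toC (0 : Matrix α β ℝ) = 0 :=
  Matrix.map_zero _ Complex.ofReal_zero

theorem toC_neg (X : Matrix α β ℝ) : toC (-X) = -toC X := by
  ext i j; simp [toC]

theorem toC_transpose (X : Matrix α β ℝ) : toC Xᵀ = (toC X)ᴴ := by
  ext i j; simp [toC]

theorem isHermitian_toC {X : Matrix α α ℝ} (hX : X.IsSymm) : (toC X).IsHermitian := by
  rw [Matrix.IsHermitian, ← toC_transpose, hX.eq]

theorem toC_det [Fintype α] [DecidableEq α] (X : Matrix α α ℝ) :
    (toC X).det = (X.det : ℂ) :=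
  (RingHom.map_det Complex.ofRealHom X).symm

theorem isUnit_det_toC [Fintype α] [DecidableEq α] {X : Matrix α α ℝ} (hX : IsUnit X.det) :
    IsUnit (toC X).det := by
  rw [toC_det, isUnit_iff_ne_zero, Complex.ofReal_ne_zero]
  exact hX.ne_zero

theorem toC_inv [Fintype α] [DecidableEq α] {X : Matrix α α ℝ} (hX : IsUnit X.det) :
    toC X⁻¹ = (toC X)⁻¹ := by
  refine (Matrix.inv_eq_right_inv ?_).symm
  rw [← toC_mul, Matrix.mul_nonsing_inv _ hX, toC_one]

theorem toC_fromBlocks (X : Matrix α β ℝ) (Y : Matrix α γ ℝ) (Z : Matrix δ β ℝ)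
    (W : Matrix δ γ ℝ) :
    toC (fromBlocks X Y Z W) = fromBlocks (toC X) (toC Y) (toC Z) (toC W) :=
  Matrix.fromBlocks_map _ _ _ _ _

theorem toC_toBlocks₁₁ (X : Matrix (α ⊕ β) (γ ⊕ δ) ℝ) : toC X.toBlocks₁₁ = (toC X).toBlocks₁₁ :=
  rfl

theorem toC_fromCols (X : Matrix α β ℝ) (Y : Matrix α γ ℝ) :
    toC (fromCols X Y) = fromCols (toC X) (toC Y) := by
  ext i (j | j) <;> rfl

theorem toC_diagonal [DecidableEq α] (d : α → ℝ) :
    toC (diagonal d) = diagonal (fun i => (d i : ℂ)) :=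
  Matrix.diagonal_map Complex.ofReal_zero

end ToC

/-! ### Frames and their Gram determinants -/

theorem mulVec_injective_of_rank {ν κ : Type*} [Fintype κ] {R : Matrix ν κ ℂ}
    (hR : R.rank = Fintype.card κ) : Function.Injective R.mulVec := by
  have h : LinearMap.ker R.mulVecLin = ⊥ := by
    have := LinearMap.finrank_range_add_finrank_ker R.mulVecLin
    rw [← Submodule.finrank_eq_zero (R := ℂ)]
    rw [Matrix.rank] at hR
    rw [hR, Module.finrank_fintype_fun_eq_card] at this
    omega
  exact LinearMap.ker_eq_bot.1 h

theorem rank_of_mulVec_injective {ν κ : Type*} [Fintype κ] {R : Matrix ν κ ℂ}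
    (hR : Function.Injective R.mulVec) : R.rank = Fintype.card κ := by
  rw [Matrix.rank, LinearMap.finrank_range_of_inj (f := R.mulVecLin) hR,
    Module.finrank_fintype_fun_eq_card]

theorem isCompact_entrywise_bounded {ν κ : Type*} (b : ℝ) :
    IsCompact {X : Matrix ν κ ℂ | ∀ i j, ‖X i j‖ ≤ b} := by
  have : {X : Matrix ν κ ℂ | ∀ i j, ‖X i j‖ ≤ b} =
      Set.pi Set.univ fun _ : ν => Set.pi Set.univ fun _ : κ => Metric.closedBall (0 : ℂ) b := by
    ext X
    exact ⟨fun h i _ j _ => mem_closedBall_zero_iff.2 (h i j),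
      fun h i j => mem_closedBall_zero_iff.1 (h i trivial j trivial)⟩
  rw [this]
  exact isCompact_univ_pi fun _ => isCompact_univ_pi fun _ => isCompact_closedBall _ _

section Gram

open scoped ComplexOrder

variable {ν μ κ : Type*} [Fintype ν] [Fintype μ] [Fintype κ] [DecidableEq κ]

theorem gramRoot_nonneg (R : Matrix ν κ ℂ) : 0 ≤ gramRoot R := Real.sqrt_nonneg _

theorem gramRoot_mul (R : Matrix ν κ ℂ) (Z : Matrix κ κ ℂ) :
    gramRoot (R * Z) = gramRoot R * ‖Z.det‖ := by
  have h : (R * Z)ᴴ * (R * Z) = Zᴴ * (Rᴴ * R) * Z := by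
    simp only [Matrix.conjTranspose_mul, Matrix.mul_assoc]
  have h2 : ((R * Z)ᴴ * (R * Z)).det = ((‖Z.det‖ ^ 2 : ℝ) : ℂ) * (Rᴴ * R).det := by
    rw [h, Matrix.det_mul, Matrix.det_mul, Matrix.det_conjTranspose]
    have := Complex.conj_mul' Z.det
    push_cast
    rw [← this, Complex.star_def]
    ring
  rw [gramRoot, h2, Complex.re_ofReal_mul, mul_comm,
    Real.sqrt_mul' _ (sq_nonneg _), Real.sqrt_sq (norm_nonneg _), gramRoot]

theorem gramRoot_of_orthonormal {R : Matrix ν κ ℂ} (hR : Rᴴ * R = 1) : gramRoot R = 1 := by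
  simp [gramRoot, hR]

theorem gramRoot_submatrix_equiv {κ' : Type*} [Fintype κ'] [DecidableEq κ'] (R : Matrix ν κ ℂ)
    (e : κ' ≃ κ) : gramRoot (R.submatrix id e) = gramRoot R := by
  have : (R.submatrix id e)ᴴ * R.submatrix id e = (Rᴴ * R).submatrix e e := by
    ext i j; simp [Matrix.mul_apply]
  rw [gramRoot, this, Matrix.det_submatrix_equiv_self, gramRoot]

/-- A basis of a subspace, written as the columns of `R`, can be orthonormalized. -/
theorem exists_orthonormalize {R : Matrix ν κ ℂ} (hR : Function.Injective R.mulVec) :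
    ∃ Z : Matrix κ κ ℂ, IsUnit Z.det ∧ (R * Z)ᴴ * (R * Z) = 1 := by
  have hpd : (Rᴴ * R).PosDef := Matrix.PosDef.conjTranspose_mul_self R hR
  have hH := hpd.isHermitian
  set U : Matrix κ κ ℂ := (hH.eigenvectorUnitary : Matrix κ κ ℂ)
  have hUU : Uᴴ * U = 1 := by
    have := (Matrix.mem_unitaryGroup_iff').1 hH.eigenvectorUnitary.2
    simpa [Matrix.star_eq_conjTranspose] using this
  set d := hH.eigenvalues
  have hd : ∀ i, 0 < d i := hpd.eigenvalues_pos
  have hsp : Uᴴ * (Rᴴ * R) * U = diagonal (fun i => (d i : ℂ)) := by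
    have := hH.conjStarAlgAut_star_eigenvectorUnitary
    simp only [Unitary.conjStarAlgAut_apply, Matrix.star_eq_conjTranspose, Unitary.coe_star,
      Matrix.conjTranspose_conjTranspose] at this
    exact this
  set E : Matrix κ κ ℂ := diagonal (fun i => (((Real.sqrt (d i))⁻¹ : ℝ) : ℂ))
  have hE : Eᴴ = E := by
    simp only [E, Matrix.diagonal_conjTranspose]
    congr 1; ext i; simp
  have h1 : (R * (U * E))ᴴ * (R * (U * E)) = 1 := by
    have : (R * (U * E))ᴴ * (R * (U * E)) = Eᴴ * (Uᴴ * (Rᴴ * R) * U) * E := by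
      simp only [Matrix.conjTranspose_mul, Matrix.mul_assoc]
    rw [this, hsp, hE, Matrix.diagonal_mul_diagonal, Matrix.diagonal_mul_diagonal,
      ← Matrix.diagonal_one]
    congr 1; ext i
    have hs := Real.sqrt_pos.2 (hd i)
    have : (Real.sqrt (d i))⁻¹ * d i * (Real.sqrt (d i))⁻¹ = 1 := by
      nth_rewrite 2 [← Real.mul_self_sqrt (hd i).le]
      field_simp
    exact_mod_cast this
  refine ⟨U * E, ?_, h1⟩
  rw [isUnit_iff_ne_zero, Matrix.det_mul, mul_ne_zero_iff]
  constructor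
  · intro h0
    have := congrArg Matrix.det hUU
    rw [Matrix.det_mul, h0, mul_zero, Matrix.det_one] at this
    exact zero_ne_one this
  · simp only [E, Matrix.det_diagonal]
    refine Finset.prod_ne_zero_iff.2 fun i _ => ?_
    exact_mod_cast (inv_pos.2 (Real.sqrt_pos.2 (hd i))).ne'

theorem norm_entry_le_one_of_orthonormal {κ : Type*} [DecidableEq κ] {R : Matrix ν κ ℂ}
    (hR : Rᴴ * R = 1) (i : ν) (j : κ) : ‖R i j‖ ≤ 1 := by
  have h := congrFun (congrFun hR j) j
  rw [Matrix.mul_apply, Matrix.one_apply_eq] at h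
  have h2 : ∑ k, ‖R k j‖ ^ 2 = (1 : ℝ) := by
    have : ((∑ k, ‖R k j‖ ^ 2 : ℝ) : ℂ) = 1 := by
      rw [← h]; push_cast
      refine Finset.sum_congr rfl fun k _ => ?_
      rw [Matrix.conjTranspose_apply, Complex.star_def, Complex.conj_mul']
    exact_mod_cast this
  have h3 : ‖R i j‖ ^ 2 ≤ 1 := h2 ▸ Finset.single_le_sum (f := fun k => ‖R k j‖ ^ 2)
    (fun k _ => sq_nonneg _) (Finset.mem_univ i)
  nlinarith [norm_nonneg (R i j)]

theorem isCompact_orthonormal {κ : Type*} [DecidableEq κ] :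
    IsCompact {R : Matrix ν κ ℂ | Rᴴ * R = 1} := by
  refine (isCompact_entrywise_bounded 1).of_isClosed_subset ?_
    fun R hR i j => norm_entry_le_one_of_orthonormal hR i j
  exact isClosed_eq (by fun_prop) continuous_const

theorem mulVec_injective_of_gram {R : Matrix ν κ ℂ}
    (h : IsUnit (Rᴴ * R).det) : Function.Injective R.mulVec := by
  have h1 : Function.Injective (Rᴴ * R).mulVec :=
    Matrix.mulVec_injective_of_isUnit ((Matrix.isUnit_iff_isUnit_det _).2 h)
  intro x y hxy
  apply h1
  rw [← Matrix.mulVec_mulVec, ← Matrix.mulVec_mulVec]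
  exact congrArg _ hxy

theorem gramRoot_pos {R : Matrix ν κ ℂ} (hR : Function.Injective R.mulVec) : 0 < gramRoot R := by
  have hpd : (Rᴴ * R).PosDef := Matrix.PosDef.conjTranspose_mul_self R hR
  exact Real.sqrt_pos.2 (Complex.pos_iff.1 hpd.det_pos).1

/-- Up to a constant, left multiplication by an injective matrix does not decrease the Gram
determinant. By homogeneity it suffices to look at the compact set of orthonormal frames. -/
theorem exists_gramRoot_mul_le {W : Matrix μ ν ℂ} (hW : Function.Injective W.mulVec) :
    ∃ c : ℝ, 0 < c ∧ ∀ D : Matrix ν κ ℂ, c * gramRoot D ≤ gramRoot (W * D) := by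
  have hcont : Continuous fun O : Matrix ν κ ℂ => gramRoot (W * O) := by
    unfold gramRoot; fun_prop
  have hpos : ∀ O ∈ {O : Matrix ν κ ℂ | Oᴴ * O = 1}, 0 < gramRoot (W * O) := by
    intro O hO
    have h1 : Function.Injective O.mulVec := mulVec_injective_of_gram (by
      rw [show Oᴴ * O = 1 from hO]; simp)
    refine gramRoot_pos fun x y hxy => h1 (hW ?_)
    simpa only [Matrix.mulVec_mulVec] using hxy
  obtain ⟨c, hc, hmin⟩ : ∃ c : ℝ, 0 < c ∧
      ∀ O ∈ {O : Matrix ν κ ℂ | Oᴴ * O = 1}, c ≤ gramRoot (W * O) := by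
    rcases Set.eq_empty_or_nonempty {O : Matrix ν κ ℂ | Oᴴ * O = 1} with h0 | h0
    · exact ⟨1, one_pos, by simp [h0]⟩
    · obtain ⟨O, hO, hm⟩ := isCompact_orthonormal.exists_isMinOn h0 hcont.continuousOn
      exact ⟨_, hpos O hO, fun X hX => hm hX⟩
  refine ⟨c, hc, fun D => ?_⟩
  by_cases hD : Function.Injective D.mulVec
  · obtain ⟨Z, hZ, hO⟩ := exists_orthonormalize hD
    have h1 := hmin _ hO
    have h2 := gramRoot_of_orthonormal hO
    rw [gramRoot_mul] at h2
    rw [← Matrix.mul_assoc, gramRoot_mul] at h1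
    have hz : 0 < ‖Z.det‖ := norm_pos_iff.2 hZ.ne_zero
    have h3 : c * gramRoot D * ‖Z.det‖ ≤ gramRoot (W * D) * ‖Z.det‖ := by
      rw [mul_assoc, h2, mul_one]; exact h1
    exact le_of_mul_le_mul_right h3 hz
  · have h0 : gramRoot D = 0 := by
      have : (Dᴴ * D).det = 0 := by
        by_contra hne
        exact hD (mulVec_injective_of_gram (isUnit_iff_ne_zero.2 hne))
      simp [gramRoot, this]
    rw [h0, mul_zero]; exact gramRoot_nonneg _

end Gram

/-! ### Stable invariant subspaces -/

section Splitting

open Module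

theorem finrank_biSup_le_sum {ι V : Type*} [AddCommGroup V] [Module ℂ V] [FiniteDimensional ℂ V]
    (f : ι → Submodule ℂ V) (s : Finset ι) :
    finrank ℂ ↥(⨆ i ∈ s, f i) ≤ ∑ i ∈ s, finrank ℂ (f i) := by
  classical
  induction s using Finset.induction_on with
  | empty => simp
  | insert a s ha ih =>
    rw [Finset.iSup_insert, Finset.sum_insert ha]
    exact (Submodule.finrank_add_le_finrank_add_finrank _ _).trans (by omega)

variable {ν : Type*} [Fintype ν] [DecidableEq ν]

/-- The sum of the generalized eigenspaces of `X` for the eigenvalues satisfying `p`. -/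
def eigenSum (X : Matrix ν ν ℂ) (p : ℂ → Prop) : Submodule ℂ (ν → ℂ) :=
  ⨆ z, ⨆ (_ : p z), Module.End.maxGenEigenspace (toLin' X) z

theorem finrank_eigenSum_le (X : Matrix ν ν ℂ) (p : ℂ → Prop) [DecidablePred p] :
    finrank ℂ (eigenSum X p) ≤ X.charpoly.roots.countP p := by
  classical
  have hmult : ∀ z, finrank ℂ (Module.End.maxGenEigenspace (toLin' X) z) =
      X.charpoly.roots.count z := by
    intro z
    rw [LinearMap.finrank_maxGenEigenspace_eq, Matrix.charpoly_toLin', Polynomial.count_roots]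
  have hle : eigenSum X p ≤
      ⨆ z ∈ (X.charpoly.roots.filter p).toFinset, Module.End.maxGenEigenspace (toLin' X) z := by
    refine iSup₂_le fun z hz => ?_
    by_cases hr : z ∈ X.charpoly.roots
    · exact le_iSup₂_of_le z (by simpa [hz] using hr) le_rfl
    · have h0 : Module.End.maxGenEigenspace (toLin' X) z = ⊥ := by
        rw [← Submodule.finrank_eq_zero (R := ℂ), hmult, Multiset.count_eq_zero_of_notMem hr]
      rw [h0]; exact bot_le
  refine (Submodule.finrank_mono hle).trans ((finrank_biSup_le_sum _ _).trans (le_of_eq ?_))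
  rw [Multiset.countP_eq_card_filter, ← Multiset.toFinset_sum_count_eq]
  refine Finset.sum_congr rfl fun z hz => ?_
  rw [hmult, Multiset.count_filter_of_pos]
  exact (Multiset.mem_filter.1 (Multiset.mem_toFinset.1 hz)).2

theorem eq_zero_of_mem_eigenSum {X : Matrix ν ν ℂ} {p : ℂ → Prop} {z : ℂ}
    (hz : ¬ p z) {x : ν → ℂ} (hx : x ∈ eigenSum X p)
    (hxz : X *ᵥ x = z • x) : x = 0 := by
  have h := (Module.End.independent_maxGenEigenspace (toLin' X)).disjoint_biSup
    (x := z) (y := {z | p z}) hz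
  refine (Submodule.disjoint_def.1 h) x ?_ hx
  refine Module.End.mem_maxGenEigenspace _ _ _ |>.2 ⟨1, ?_⟩
  rw [pow_one, LinearMap.sub_apply, toLin'_apply, hxz]
  simp

theorem mulVec_mem_eigenSum (X : Matrix ν ν ℂ) (p : ℂ → Prop) {x : ν → ℂ}
    (hx : x ∈ eigenSum X p) :
    X *ᵥ x ∈ eigenSum X p := by
  have h : eigenSum X p ≤
      (eigenSum X p).comap (toLin' X) := by
    refine iSup₂_le fun z hz y hy => ?_
    refine Submodule.mem_comap.2 ?_
    have h1 := Module.End.mapsTo_maxGenEigenspace_of_comm (Commute.refl (toLin' X)) z hy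
    exact (le_iSup₂_of_le (f := fun z (_ : p z) => Module.End.maxGenEigenspace (toLin' X) z) z hz
      le_rfl) h1
  have := h hx
  rwa [Submodule.mem_comap, toLin'_apply] at this

/-- The stable invariant subspace of a matrix, of dimension the number of stable eigenvalues, and
the invariant subspace of the other generalized eigenvectors. -/
theorem exists_spectral_splitting (X : Matrix ν ν ℂ) :
    ∃ Es Eu : Submodule ℂ (ν → ℂ),
      (∀ x ∈ Es, X *ᵥ x ∈ Es) ∧ (∀ x ∈ Eu, X *ᵥ x ∈ Eu) ∧
      (∀ z : ℂ, 0 ≤ z.re → ∀ x ∈ Es, X *ᵥ x = z • x → x = 0) ∧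
      (∀ z : ℂ, z.re < 0 → ∀ x ∈ Eu, X *ᵥ x = z • x → x = 0) ∧
      finrank ℂ Es = stableCount X ∧ finrank ℂ Es + finrank ℂ Eu = Fintype.card ν := by
  classical
  refine ⟨eigenSum X fun z => z.re < 0,
    eigenSum X fun z => ¬ z.re < 0,
    fun x hx => mulVec_mem_eigenSum X _ hx,
    fun x hx => mulVec_mem_eigenSum X _ hx,
    fun z hz x hx h => eq_zero_of_mem_eigenSum (p := fun z => z.re < 0) (not_lt.2 hz) hx h,
    fun z hz x hx h => eq_zero_of_mem_eigenSum (p := fun z => ¬ z.re < 0) (not_not.2 hz) hx h, ?_⟩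
  have h1 := finrank_eigenSum_le X (fun z => z.re < 0)
  have h2 := finrank_eigenSum_le X (fun z => ¬ z.re < 0)
  have h3 : Fintype.card ν ≤ finrank ℂ (eigenSum X fun z => z.re < 0) +
      finrank ℂ (eigenSum X fun z => ¬ z.re < 0) := by
    have := iSup_split (fun z => Module.End.maxGenEigenspace (toLin' X) z) (fun z => z.re < 0)
    rw [Module.End.iSup_maxGenEigenspace_eq_top] at this
    rw [← Module.finrank_fintype_fun_eq_card ℂ, ← finrank_top, this]
    exact Submodule.finrank_add_le_finrank_add_finrank _ _
  have h4 : X.charpoly.roots.countP (fun z => z.re < 0) +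
      X.charpoly.roots.countP (fun z => ¬ z.re < 0) ≤ Fintype.card ν := by
    rw [← Multiset.card_eq_countP_add_countP]
    exact (Polynomial.card_roots' _).trans (Matrix.charpoly_natDegree_eq_dim X).le
  simp only [stableCount]
  omega

end Splitting

/-! ### Hermitian forms and Lyapunov's theorem -/

section Lyapunov

open Filter Topology

/-- The powers of an operator all of whose eigenvalues lie in the open unit disc tend to zero. -/
theorem tendsto_pow_apply_zero {E : Type*} [NormedAddCommGroup E] [NormedSpace ℂ E]
    [FiniteDimensional ℂ E] (f : Module.End ℂ E)
    (h : ∀ z : ℂ, 1 ≤ ‖z‖ → ∀ x, f x = z • x → x = 0) (x : E) :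
    Tendsto (fun n => (f ^ n) x) atTop (𝓝 0) := by
  rcases subsingleton_or_nontrivial E with hE | hE
  · simp only [Subsingleton.elim _ (0 : E)]
    exact tendsto_const_nhds
  have : CompleteSpace E := FiniteDimensional.complete ℂ E
  set F : E →L[ℂ] E := Module.End.toContinuousLinearMap E f with hF
  have hFn : ∀ n, (F ^ n) x = (f ^ n) x := by
    intro n
    rw [hF, ← map_pow]; rfl
  have hr : spectralRadius ℂ F < ((1 : NNReal) : ENNReal) := by
    refine spectrum.spectralRadius_lt_of_forall_lt F fun z hz => ?_
    rw [hF, AlgEquiv.spectrum_eq, ← Module.End.hasEigenvalue_iff_mem_spectrum] at hz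
    obtain ⟨v, hv⟩ := hz.exists_hasEigenvector
    by_contra hlt
    exact hv.2 (h z (by exact_mod_cast not_lt.1 hlt) v hv.apply_eq_smul)
  have hg := spectrum.pow_nnnorm_pow_one_div_tendsto_nhds_spectralRadius F
  obtain ⟨ρ, hρ1, hρ2⟩ := ENNReal.lt_iff_exists_nnreal_btwn.1 hr
  have hρ : ρ < 1 := by exact_mod_cast hρ2
  have hev : ∀ᶠ n in atTop, ‖F ^ n‖ ≤ (ρ : ℝ) ^ n := by
    filter_upwards [hg.eventually_lt_const hρ1, eventually_gt_atTop 0] with n hn hn0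
    have hn' : (0 : ℝ) < n := by exact_mod_cast hn0
    have h1 : (‖F ^ n‖₊ : ENNReal) ≤ (ρ : ENNReal) ^ (n : ℝ) := by
      have := ENNReal.rpow_le_rpow hn.le hn'.le
      rwa [← ENNReal.rpow_mul, one_div, inv_mul_cancel₀ hn'.ne', ENNReal.rpow_one] at this
    rw [ENNReal.rpow_natCast] at h1
    exact_mod_cast h1
  have h0 : Tendsto (fun n => F ^ n) atTop (𝓝 0) :=
    squeeze_zero_norm' hev (tendsto_pow_atTop_nhds_zero_of_lt_one ρ.2 (by exact_mod_cast hρ))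
  have h1 : Tendsto (fun n => (F ^ n) x) atTop (𝓝 ((0 : E →L[ℂ] E) x)) :=
    ((ContinuousLinearMap.apply ℂ E x).continuous.tendsto _).comp h0
  simpa [hFn] using h1

variable {ν : Type*} [Fintype ν]

/-- The form `Re x* H x` of a matrix, which is `x* H x` if `H` is Hermitian. -/
def hForm (H : Matrix ν ν ℂ) (x : ν → ℂ) : ℝ := (star x ⬝ᵥ H *ᵥ x).re

theorem hForm_zero (H : Matrix ν ν ℂ) : hForm H 0 = 0 := by simp [hForm]

theorem star_dotProduct_mulVec_of_isHermitian {H : Matrix ν ν ℂ} (hH : H.IsHermitian)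
    (x y : ν → ℂ) : star y ⬝ᵥ H *ᵥ x = star (star x ⬝ᵥ H *ᵥ y) := by
  rw [Matrix.star_dotProduct, star_mulVec, hH.eq, Matrix.dotProduct_mulVec]

theorem hForm_add {H : Matrix ν ν ℂ} (hH : H.IsHermitian) (x y : ν → ℂ) :
    hForm H (x + y) = hForm H x + hForm H y + 2 * (star x ⬝ᵥ H *ᵥ y).re := by
  have h := congrArg Complex.re (star_dotProduct_mulVec_of_isHermitian hH x y)
  rw [Complex.star_def, Complex.conj_re] at h
  simp only [hForm, star_add, Matrix.mulVec_add, add_dotProduct, dotProduct_add, Complex.add_re, h]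
  ring

theorem hForm_sub {H : Matrix ν ν ℂ} (hH : H.IsHermitian) (x y : ν → ℂ) :
    hForm H (x - y) = hForm H x + hForm H y - 2 * (star x ⬝ᵥ H *ᵥ y).re := by
  have h := congrArg Complex.re (star_dotProduct_mulVec_of_isHermitian hH x y)
  rw [Complex.star_def, Complex.conj_re] at h
  simp only [hForm, star_sub, Matrix.mulVec_sub, sub_dotProduct, dotProduct_sub, Complex.sub_re, h]
  ring

theorem hForm_smul (H : Matrix ν ν ℂ) (c : ℂ) (x : ν → ℂ) :
    hForm H (c • x) = ‖c‖ ^ 2 * hForm H x := by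
  rw [hForm, star_smul, Matrix.mulVec_smul, smul_dotProduct, dotProduct_smul, smul_smul,
    Complex.star_def, Complex.conj_mul', smul_eq_mul, hForm, ← Complex.ofReal_pow,
    Complex.re_ofReal_mul]

theorem continuous_hForm (H : Matrix ν ν ℂ) : Continuous (hForm H) := by
  unfold hForm; fun_prop

/-- **Cauchy-Schwarz** in the form in which it is used: on a subspace on which a Hermitian form is
nonnegative, an isotropic vector is orthogonal to everything. -/
theorem dotProduct_mulVec_eq_zero_of_isotropic {H : Matrix ν ν ℂ} (hH : H.IsHermitian)
    {W : Submodule ℂ (ν → ℂ)} (hW : ∀ x ∈ W, 0 ≤ hForm H x) {x y : ν → ℂ} (hx : x ∈ W)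
    (hy : y ∈ W) (h0 : hForm H x = 0) : star y ⬝ᵥ H *ᵥ x = 0 := by
  set s := star y ⬝ᵥ H *ᵥ x with hs
  by_contra hne
  have hpos : 0 < ‖s‖ ^ 2 := by positivity
  -- Along the real line `y - t s̄ x` the form is affine in `t`, with slope `-2 |s|²`.
  have key : ∀ t : ℝ, 0 ≤ hForm H y - 2 * t * ‖s‖ ^ 2 := by
    intro t
    have h1 := hW _ (W.sub_mem hy (W.smul_mem ((t : ℂ) * star s) hx))
    rw [hForm_sub hH, hForm_smul, h0, mul_zero, add_zero, Matrix.mulVec_smul, dotProduct_smul,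
      ← hs, smul_eq_mul, mul_assoc, Complex.star_def, Complex.conj_mul', ← Complex.ofReal_pow,
      ← Complex.ofReal_mul, Complex.ofReal_re] at h1
    linarith
  have h2 := key ((hForm H y + 1) / (2 * ‖s‖ ^ 2))
  have h3 : 2 * ((hForm H y + 1) / (2 * ‖s‖ ^ 2)) * ‖s‖ ^ 2 = hForm H y + 1 := by
    field_simp
  linarith

/-- **Lyapunov's theorem.** If `Re x* H X x < 0` on an `X`-invariant subspace on which `X` has only
stable eigenvalues, then `H` is positive definite there. The Cayley transform
`(X + 1) (X - 1)⁻¹` strictly decreases the form of `H`, and its powers tend to zero. -/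
theorem hForm_pos_of_stable {H X : Matrix ν ν ℂ} (hH : H.IsHermitian) {W : Submodule ℂ (ν → ℂ)}
    (hWX : ∀ x ∈ W, X *ᵥ x ∈ W)
    (hneg : ∀ x ∈ W, x ≠ 0 → (star x ⬝ᵥ H *ᵥ (X *ᵥ x)).re < 0)
    (hst : ∀ z : ℂ, 0 ≤ z.re → ∀ x ∈ W, X *ᵥ x = z • x → x = 0) {x : ν → ℂ} (hx : x ∈ W)
    (hx0 : x ≠ 0) : 0 < hForm H x := by
  set f : Module.End ℂ W := X.mulVecLin.restrict hWX with hf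
  have hfv : ∀ w : W, ((f w : W) : ν → ℂ) = X *ᵥ (w : ν → ℂ) := fun w => rfl
  have hinj : Function.Injective (f - 1 : Module.End ℂ W) := by
    rw [← LinearMap.ker_eq_bot, LinearMap.ker_eq_bot']
    intro w hw
    have h1 : X *ᵥ (w : ν → ℂ) = (1 : ℂ) • (w : ν → ℂ) := by
      have := congrArg Subtype.val (sub_eq_zero.1 (by simpa using hw) : f w = w)
      rw [one_smul]; exact this
    exact Subtype.ext (hst 1 (by simp) w w.2 h1)
  set g : W ≃ₗ[ℂ] W := LinearEquiv.ofInjectiveEndo (f - 1) hinj with hg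
  have hgv : ∀ w : W, g w = f w - w := fun w => rfl
  set A : Module.End ℂ W := (f + 1) ∘ₗ (g.symm : W →ₗ[ℂ] W) with hA
  have hAg : ∀ w : W, A (g w) = f w + w := by
    intro w; simp [hA]
  have hdec : ∀ w : W, w ≠ 0 → hForm H (A w : W) < hForm H (w : ν → ℂ) := by
    intro w hw
    obtain ⟨y, rfl⟩ := g.surjective w
    have hy : (y : ν → ℂ) ≠ 0 := by
      intro h0; apply hw
      rw [(Subtype.ext h0 : y = 0), map_zero]
    have h1 := hneg y y.2 hy
    have h2 := congrArg Complex.re (star_dotProduct_mulVec_of_isHermitian hH (y : ν → ℂ)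
      (X *ᵥ (y : ν → ℂ)))
    rw [Complex.star_def, Complex.conj_re] at h2
    rw [hAg, hgv, Submodule.coe_add, Submodule.coe_sub, hfv, hForm_add hH, hForm_sub hH, h2]
    linarith
  have hle : ∀ w : W, hForm H (A w : W) ≤ hForm H (w : ν → ℂ) := by
    intro w
    by_cases hw : w = 0
    · simp [hw]
    · exact (hdec w hw).le
  have hAz : ∀ z : ℂ, 1 ≤ ‖z‖ → ∀ w, A w = z • w → w = 0 := by
    intro z hz w hw
    obtain ⟨y, rfl⟩ := g.surjective w
    rw [hAg, hgv] at hw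
    have h1 : X *ᵥ (y : ν → ℂ) + y = z • (X *ᵥ (y : ν → ℂ) - y) := congrArg Subtype.val hw
    have hy : (y : ν → ℂ) = 0 := by
      by_cases hz1 : z = 1
      · rw [hz1, one_smul] at h1
        have h2 : (2 : ℂ) • (y : ν → ℂ) = 0 := by
          calc (2 : ℂ) • (y : ν → ℂ) = (X *ᵥ (y : ν → ℂ) + y) - (X *ᵥ (y : ν → ℂ) - y) := by module
            _ = 0 := by rw [h1, sub_self]
        simpa using h2
      · have hz1' : z - 1 ≠ 0 := sub_ne_zero.2 hz1
        have h2 : X *ᵥ (y : ν → ℂ) = ((z + 1) / (z - 1)) • (y : ν → ℂ) := by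
          have h3 : (z - 1) • (X *ᵥ (y : ν → ℂ)) = (z + 1) • (y : ν → ℂ) := by
            calc (z - 1) • (X *ᵥ (y : ν → ℂ)) =
                  z • (X *ᵥ (y : ν → ℂ) - y) - (X *ᵥ (y : ν → ℂ) + y) + (z + 1) • (y : ν → ℂ) := by
                    module
              _ = (z + 1) • (y : ν → ℂ) := by rw [h1, sub_self, zero_add]
          rw [div_eq_inv_mul, mul_smul, ← h3, smul_smul, inv_mul_cancel₀ hz1', one_smul]
        refine hst _ ?_ y y.2 h2
        rw [Complex.div_re, ← add_div]
        refine div_nonneg ?_ (Complex.normSq_nonneg _)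
        have h4 : 1 ≤ Complex.normSq z := by
          rw [Complex.normSq_eq_norm_sq]; nlinarith
        rw [Complex.normSq_apply] at h4
        simp
        linarith
    rw [(Subtype.ext hy : y = 0), map_zero]
  have hlim := tendsto_pow_apply_zero A hAz ⟨x, hx⟩
  have hlim' : Tendsto (fun n => hForm H (((A ^ n) ⟨x, hx⟩ : W) : ν → ℂ)) atTop (𝓝 0) := by
    have h1 := ((continuous_hForm H).comp continuous_subtype_val).tendsto (0 : W)
    rw [Function.comp_apply, Submodule.coe_zero, hForm_zero] at h1
    exact h1.comp hlim
  have hanti : Antitone fun n => hForm H (((A ^ n) ⟨x, hx⟩ : W) : ν → ℂ) := by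
    refine antitone_nat_of_succ_le fun n => ?_
    rw [pow_succ']
    exact hle _
  have h1 : 0 ≤ hForm H (((A ^ 1) ⟨x, hx⟩ : W) : ν → ℂ) := hanti.le_of_tendsto hlim' 1
  rw [pow_one] at h1
  refine h1.trans_lt (hdec ⟨x, hx⟩ fun h0 => hx0 (congrArg Subtype.val h0))

end Lyapunov

/-! ### Inertia of symmetric matrices -/

section Inertia

open Module

variable {ν ι : Type*} [Fintype ν] [DecidableEq ν] [Fintype ι] [DecidableEq ι]

/-- `X = V diag(d) V*` with `V` orthogonal. The rows and columns of `V` may be indexed by different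
types, so that a spectral frame `(P₁, P₀)` is an instance. -/
structure IsOrthDiag (X : Matrix ν ν ℝ) (V : Matrix ν ι ℝ) (d : ι → ℝ) : Prop where
  left : Vᵀ * V = 1
  right : V * Vᵀ = 1
  eq : X = V * diagonal d * Vᵀ

theorem exists_isOrthDiag {X : Matrix ν ν ℝ} (hX : X.IsSymm) :
    ∃ (V : Matrix ν ν ℝ) (d : ν → ℝ), IsOrthDiag X V d := by
  have hH : X.IsHermitian := by
    rw [Matrix.IsHermitian, Matrix.conjTranspose_eq_transpose_of_trivial]; exact hX
  refine ⟨(hH.eigenvectorUnitary : Matrix ν ν ℝ), hH.eigenvalues, ?_, ?_, ?_⟩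
  · have := (Matrix.mem_unitaryGroup_iff').1 hH.eigenvectorUnitary.2
    rwa [Matrix.star_eq_conjTranspose, Matrix.conjTranspose_eq_transpose_of_trivial] at this
  · have := (Matrix.mem_unitaryGroup_iff).1 hH.eigenvectorUnitary.2
    rwa [Matrix.star_eq_conjTranspose, Matrix.conjTranspose_eq_transpose_of_trivial] at this
  · have := hH.spectral_theorem
    rw [Unitary.conjStarAlgAut_apply, Matrix.star_eq_conjTranspose,
      Matrix.conjTranspose_eq_transpose_of_trivial] at this
    exact this

namespace IsOrthDiag

variable {X : Matrix ν ν ℝ} {V : Matrix ν ι ℝ} {d : ι → ℝ}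

theorem isSymm (h : IsOrthDiag X V d) : X.IsSymm := by
  rw [Matrix.IsSymm, h.eq]
  simp [Matrix.mul_assoc]

theorem mul_eq (h : IsOrthDiag X V d) : X * V = V * diagonal d := by
  rw [h.eq, Matrix.mul_assoc, h.left, Matrix.mul_one]

theorem card_eq (h : IsOrthDiag X V d) : Fintype.card ι = Fintype.card ν := by
  have h1 := congrArg Matrix.trace h.left
  rw [Matrix.trace_mul_comm, h.right, Matrix.trace_one, Matrix.trace_one] at h1
  exact_mod_cast h1.symm

theorem posEigCount_eq (h : IsOrthDiag X V d) :
    posEigCount X = Fintype.card {i // 0 < d i} := by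
  obtain ⟨e⟩ := Fintype.card_eq.1 h.card_eq
  have hdet : IsUnit (V.submatrix id e.symm).det := by
    rw [isUnit_iff_exists_inv]
    refine ⟨(Vᵀ.submatrix e.symm id).det, ?_⟩
    rw [← Matrix.det_mul, Matrix.submatrix_mul_equiv (e₂ := e.symm), h.right]
    simp
  have hX : X = V.submatrix id e.symm * (diagonal d).submatrix e.symm e.symm *
      (V.submatrix id e.symm)⁻¹ := by
    have hi : (V.submatrix id e.symm)⁻¹ = Vᵀ.submatrix e.symm id := by
      refine Matrix.inv_eq_right_inv ?_
      rw [Matrix.submatrix_mul_equiv (e₂ := e.symm), h.right]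
      simp
    rw [hi, Matrix.submatrix_mul_equiv (e₂ := e.symm), Matrix.submatrix_mul_equiv (e₂ := e.symm),
      ← h.eq]
    simp
  have hc : X.charpoly = ∏ i, (Polynomial.X - Polynomial.C (d i)) := by
    obtain ⟨U, hU⟩ := (Matrix.isUnit_iff_isUnit_det _).2 hdet
    rw [hX, ← hU, Matrix.charpoly_units_conj]
    rw [show (diagonal d).submatrix e.symm e.symm = Matrix.reindex e e (diagonal d) from rfl,
      Matrix.charpoly_reindex, Matrix.charpoly_diagonal]
  have hr : X.charpoly.roots = Finset.univ.val.map d := by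
    rw [hc]; exact Polynomial.roots_multiset_prod_X_sub_C (Finset.univ.val.map d) ▸ by
      rw [Multiset.map_map]; rfl
  rw [posEigCount, hr, Multiset.countP_map, Fintype.card_subtype]
  rfl

theorem hForm_eq (h : IsOrthDiag X V d) (x : ν → ℂ) :
    hForm (toC X) x = ∑ i, d i * ‖((toC V)ᴴ *ᵥ x) i‖ ^ 2 := by
  have h1 : toC X = toC V * toC (diagonal d) * (toC V)ᴴ := by
    rw [← toC_transpose, ← toC_mul, ← toC_mul, ← h.eq]
  set y := (toC V)ᴴ *ᵥ x with hy
  have h2 : star x ⬝ᵥ toC X *ᵥ x = star y ⬝ᵥ toC (diagonal d) *ᵥ y := by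
    rw [h1, hy, star_mulVec, Matrix.conjTranspose_conjTranspose, ← Matrix.mulVec_mulVec,
      ← Matrix.mulVec_mulVec, ← Matrix.dotProduct_mulVec]
  rw [hForm, h2, toC_diagonal, dotProduct, Complex.re_sum]
  refine Finset.sum_congr rfl fun i _ => ?_
  rw [Matrix.mulVec_diagonal, Pi.star_apply, mul_left_comm, Complex.star_def, Complex.conj_mul',
    ← Complex.ofReal_pow, ← Complex.ofReal_mul, Complex.ofReal_re]

theorem eq_zero_of_conjTranspose_mulVec (h : IsOrthDiag X V d) {x : ν → ℂ}
    (hx : (toC V)ᴴ *ᵥ x = 0) : x = 0 := by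
  have h1 : toC V *ᵥ ((toC V)ᴴ *ᵥ x) = x := by
    rw [Matrix.mulVec_mulVec, ← toC_transpose, ← toC_mul, h.right, toC_one, Matrix.one_mulVec]
  rw [← h1, hx, Matrix.mulVec_zero]

/-- If the coordinates in `p` determine whether a vector of `W` vanishes, then they are coordinates
on `W`. -/
theorem finrank_le_card (h : IsOrthDiag X V d) (p : ι → Prop) [DecidablePred p]
    {W : Submodule ℂ (ν → ℂ)}
    (hW : ∀ x ∈ W, (∀ i, p i → ((toC V)ᴴ *ᵥ x) i = 0) → (∀ i, ¬ p i → ((toC V)ᴴ *ᵥ x) i = 0)) :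
    finrank ℂ W ≤ Fintype.card {i // p i} := by
  set f : W →ₗ[ℂ] ({i // p i} → ℂ) :=
    (LinearMap.funLeft ℂ ℂ Subtype.val) ∘ₗ (toC V)ᴴ.mulVecLin ∘ₗ W.subtype with hf
  have hfa : ∀ (x : W) (i : {i // p i}), f x i = ((toC V)ᴴ *ᵥ (x : ν → ℂ)) i := fun x i => rfl
  have hinj : Function.Injective f := by
    rw [← LinearMap.ker_eq_bot, LinearMap.ker_eq_bot']
    intro x hx
    have h0 : ∀ i, p i → ((toC V)ᴴ *ᵥ (x : ν → ℂ)) i = 0 := fun i hi => by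
      rw [← hfa x ⟨i, hi⟩, hx]; rfl
    refine Subtype.ext (h.eq_zero_of_conjTranspose_mulVec (funext fun i => ?_))
    by_cases hi : p i
    · exact h0 i hi
    · exact hW x x.2 h0 i hi
  have := LinearMap.finrank_le_finrank_of_injective hinj
  rwa [Module.finrank_fintype_fun_eq_card] at this

theorem finrank_le_of_nonneg (h : IsOrthDiag X V d) {W : Submodule ℂ (ν → ℂ)}
    (hW : ∀ x ∈ W, 0 ≤ hForm (toC X) x) : finrank ℂ W ≤ Fintype.card {i // 0 ≤ d i} := by
  refine h.finrank_le_card (fun i => 0 ≤ d i) fun x hx h0 i hi => ?_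
  have h1 := hW x hx
  rw [h.hForm_eq] at h1
  have h2 : ∀ j ∈ Finset.univ, d j * ‖((toC V)ᴴ *ᵥ x) j‖ ^ 2 ≤ 0 := by
    intro j _
    by_cases hj : 0 ≤ d j
    · rw [h0 j hj]; simp
    · exact mul_nonpos_of_nonpos_of_nonneg (not_le.1 hj).le (sq_nonneg _)
  have h3 := (Finset.sum_eq_zero_iff_of_nonpos h2).1 (le_antisymm (Finset.sum_nonpos h2) h1) i
    (Finset.mem_univ i)
  rcases mul_eq_zero.1 h3 with h4 | h4
  · exact absurd h4.ge hi
  · simpa using h4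

theorem finrank_le_of_pos (h : IsOrthDiag X V d) {W : Submodule ℂ (ν → ℂ)}
    (hW : ∀ x ∈ W, x ≠ 0 → 0 < hForm (toC X) x) : finrank ℂ W ≤ Fintype.card {i // 0 < d i} := by
  refine h.finrank_le_card (fun i => 0 < d i) fun x hx h0 i _ => ?_
  have h2 : hForm (toC X) x ≤ 0 := by
    rw [h.hForm_eq]
    refine Finset.sum_nonpos fun j _ => ?_
    by_cases hj : 0 < d j
    · rw [h0 j hj]; simp
    · exact mul_nonpos_of_nonpos_of_nonneg (not_lt.1 hj) (sq_nonneg _)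
  by_contra hne
  refine absurd (hW x hx ?_) (not_lt.2 h2)
  rintro rfl
  exact hne (by simp)

theorem finrank_le_of_neg (h : IsOrthDiag X V d) {W : Submodule ℂ (ν → ℂ)}
    (hW : ∀ x ∈ W, x ≠ 0 → hForm (toC X) x < 0) : finrank ℂ W ≤ Fintype.card {i // d i < 0} := by
  refine h.finrank_le_card (fun i => d i < 0) fun x hx h0 i _ => ?_
  have h2 : 0 ≤ hForm (toC X) x := by
    rw [h.hForm_eq]
    refine Finset.sum_nonneg fun j _ => ?_
    by_cases hj : d j < 0
    · rw [h0 j hj]; simp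
    · exact mul_nonneg (not_lt.1 hj) (sq_nonneg _)
  by_contra hne
  refine absurd (hW x hx ?_) (not_lt.2 h2)
  rintro rfl
  exact hne (by simp)

/-- **Inertia theorem** of Ostrowski and Schneider: if `Re x* X Y x < 0` for `x ≠ 0`, then `Y` has
as many stable eigenvalues as `X` has positive ones. -/
theorem stableCount_eq (h : IsOrthDiag X V d) {Y : Matrix ν ν ℂ}
    (hneg : ∀ x, x ≠ 0 → (star x ⬝ᵥ toC X *ᵥ (Y *ᵥ x)).re < 0) :
    stableCount Y = posEigCount X := by
  have hX := isHermitian_toC h.isSymm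
  obtain ⟨Es, Eu, hs, hu, hs0, hu0, hdim, hsum⟩ := exists_spectral_splitting Y
  have h1 := h.finrank_le_of_pos (W := Es) fun x hx hx0 =>
    hForm_pos_of_stable hX hs (fun x _ h0 => hneg x h0) hs0 hx hx0
  have h2 : finrank ℂ Eu ≤ Fintype.card {i // d i < 0} := by
    refine h.finrank_le_of_neg fun x hx hx0 => ?_
    have h3 : 0 < hForm (-toC X) x := by
      refine hForm_pos_of_stable (X := -Y) hX.neg (W := Eu)
        (fun x hx => by rw [Matrix.neg_mulVec]; exact Eu.neg_mem (hu x hx))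
        (fun x _ h0 => ?_) (fun z hz x hx hxz => ?_) hx hx0
      · rw [Matrix.neg_mulVec, Matrix.neg_mulVec, Matrix.mulVec_neg, neg_neg]
        exact hneg x h0
      · have hxz' : Y *ᵥ x = (-z) • x := by
          rw [neg_smul, ← hxz, Matrix.neg_mulVec, neg_neg]
        by_cases hz0 : z.re = 0
        · -- An imaginary eigenvalue makes `x* X Y x` purely imaginary.
          by_contra hne
          have h4 := hneg x hne
          have h5 : (star x ⬝ᵥ toC X *ᵥ x).im = 0 := by
            have := congrArg Complex.im (star_dotProduct_mulVec_of_isHermitian hX x x)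
            rw [Complex.star_def, Complex.conj_im] at this
            linarith
          rw [hxz', Matrix.mulVec_smul, dotProduct_smul, smul_eq_mul, Complex.mul_re, h5,
            Complex.neg_re, hz0] at h4
          simp at h4
        · refine hu0 (-z) ?_ x hx hxz'
          rw [Complex.neg_re, neg_lt_zero]
          exact lt_of_le_of_ne hz (Ne.symm hz0)
    rw [hForm, Matrix.neg_mulVec, dotProduct_neg, Complex.neg_re] at h3
    exact neg_pos.1 h3
  have h3 : Fintype.card {i // 0 < d i} + Fintype.card {i // d i < 0} ≤ Fintype.card ν := by
    rw [← h.card_eq, ← Fintype.card_subtype_or_disjoint]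
    · exact Fintype.card_subtype_le _
    · rw [Pi.disjoint_iff]
      intro i
      rw [Prop.disjoint_iff]
      rintro ⟨h1, h2⟩
      exact lt_asymm h1 h2
  rw [h.posEigCount_eq]
  omega

end IsOrthDiag

end Inertia

/-! ### Right-stable matrices -/

section RightStable

open Module

variable {ν κ : Type*} [Fintype ν] [DecidableEq ν] [Fintype κ] [DecidableEq κ]

/-- Right-stability is a property of the range of `R`: it is invariant under `X`, without an
eigenvector for an eigenvalue in the closed right half plane. -/
theorem isRightStable_of_range {X : Matrix ν ν ℂ} {R : Matrix ν κ ℂ}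
    (hcard : stableCount X = Fintype.card κ) (hR : Function.Injective R.mulVec)
    (hinv : ∀ x ∈ LinearMap.range R.mulVecLin, X *ᵥ x ∈ LinearMap.range R.mulVecLin)
    (hst : ∀ z : ℂ, 0 ≤ z.re → ∀ x ∈ LinearMap.range R.mulVecLin, X *ᵥ x = z • x → x = 0) :
    IsRightStable X R := by
  have h1 : ∀ j : κ, ∃ y : κ → ℂ, R *ᵥ y = X *ᵥ (R *ᵥ Pi.single j 1) := fun j =>
    hinv _ ⟨Pi.single j 1, rfl⟩
  choose y hy using h1
  have hXR : X * R = R * (Matrix.of y)ᵀ := by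
    refine Matrix.ext_of_mulVec_single fun j => ?_
    rw [← Matrix.mulVec_mulVec, ← hy, ← Matrix.mulVec_mulVec, Matrix.mulVec_single_one]
    rfl
  refine ⟨hcard, rank_of_mulVec_injective hR, (Matrix.of y)ᵀ, hXR, fun z hz => ?_⟩
  by_contra hre
  rw [← Matrix.spectrum_toLin', ← Module.End.hasEigenvalue_iff_mem_spectrum] at hz
  obtain ⟨v, hv⟩ := hz.exists_hasEigenvector
  have hv1 : (Matrix.of y)ᵀ *ᵥ v = z • v := hv.apply_eq_smul
  refine hv.2 (hR ?_)
  rw [Matrix.mulVec_zero]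
  refine hst z (not_lt.1 hre) (R *ᵥ v) ⟨v, rfl⟩ ?_
  rw [Matrix.mulVec_mulVec, hXR, ← Matrix.mulVec_mulVec, hv1, Matrix.mulVec_smul]

namespace IsRightStable

variable {X : Matrix ν ν ℂ} {R : Matrix ν κ ℂ}

theorem injective (h : IsRightStable X R) : Function.Injective R.mulVec :=
  mulVec_injective_of_rank h.2.1

theorem mulVec_mem_range (h : IsRightStable X R) {x : ν → ℂ}
    (hx : x ∈ LinearMap.range R.mulVecLin) : X *ᵥ x ∈ LinearMap.range R.mulVecLin := by
  obtain ⟨Y, hY, -⟩ := h.2.2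
  obtain ⟨y, rfl⟩ := hx
  refine ⟨Y *ᵥ y, ?_⟩
  simp only [Matrix.mulVecLin_apply, Matrix.mulVec_mulVec, hY]

theorem eq_zero_of_eigen (h : IsRightStable X R) {z : ℂ} (hz : 0 ≤ z.re) {x : ν → ℂ}
    (hx : x ∈ LinearMap.range R.mulVecLin) (hxz : X *ᵥ x = z • x) : x = 0 := by
  obtain ⟨Y, hY, hYs⟩ := h.2.2
  obtain ⟨y, rfl⟩ := hx
  by_contra hne
  have hy0 : y ≠ 0 := by rintro rfl; exact hne (map_zero _)
  have h1 : Y *ᵥ y = z • y := h.injective (by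
    rw [Matrix.mulVec_mulVec, ← hY, ← Matrix.mulVec_mulVec, Matrix.mulVec_smul]
    exact hxz)
  refine absurd (hYs z ?_) (not_lt.2 hz)
  rw [← Matrix.spectrum_toLin', ← Module.End.hasEigenvalue_iff_mem_spectrum]
  exact Module.End.hasEigenvalue_of_hasEigenvector ⟨Module.End.mem_eigenspace_iff.2 h1, hy0⟩

theorem mul_right (h : IsRightStable X R) {Z : Matrix κ κ ℂ} (hZ : IsUnit Z.det) :
    IsRightStable X (R * Z) := by
  have hle : LinearMap.range (R * Z).mulVecLin = LinearMap.range R.mulVecLin := by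
    rw [Matrix.mulVecLin_mul, LinearMap.range_comp_of_range_eq_top]
    exact LinearMap.range_eq_top.2
      (Matrix.mulVec_surjective_iff_isUnit.2 ((Matrix.isUnit_iff_isUnit_det _).2 hZ))
  have hZi := Matrix.mulVec_injective_of_isUnit ((Matrix.isUnit_iff_isUnit_det _).2 hZ)
  refine isRightStable_of_range h.1 ?_ (fun x hx => ?_) (fun z hz x hx hxz => ?_)
  · intro x y hxy
    rw [← Matrix.mulVec_mulVec, ← Matrix.mulVec_mulVec] at hxy
    exact hZi (h.injective hxy)
  · rw [hle] at hx ⊢; exact h.mulVec_mem_range hx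
  · rw [hle] at hx; exact h.eq_zero_of_eigen hz hx hxz

/-- A change of unknowns transports right-stable matrices. -/
theorem of_conj {T : Matrix ν ν ℂ} (hT : IsUnit T.det)
    (h : IsRightStable (T * X * T⁻¹) R) : IsRightStable X (T⁻¹ * R) := by
  have hcp : (T * X * T⁻¹).charpoly = X.charpoly := by
    obtain ⟨U, hU⟩ := (Matrix.isUnit_iff_isUnit_det _).2 hT
    rw [← hU, Matrix.charpoly_units_conj]
  have hTi : Function.Injective T⁻¹.mulVec := Matrix.mulVec_injective_of_isUnit
    ((Matrix.isUnit_iff_isUnit_det _).2 (Matrix.isUnit_nonsing_inv_det _ hT))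
  have hinj := h.injective
  obtain ⟨h1, -, Y, hY, hYs⟩ := h
  refine ⟨?_, ?_, Y, ?_, hYs⟩
  · rw [← h1, stableCount, stableCount, hcp]
  · refine rank_of_mulVec_injective fun x y hxy => ?_
    rw [← Matrix.mulVec_mulVec, ← Matrix.mulVec_mulVec] at hxy
    exact hinj (hTi hxy)
  · have := congrArg (T⁻¹ * ·) hY
    simp only [← Matrix.mul_assoc, Matrix.nonsing_inv_mul _ hT, Matrix.one_mul] at this
    simpa only [Matrix.mul_assoc] using this

end IsRightStable

theorem exists_isRightStable (X : Matrix ν ν ℂ) {s : ℕ} (hs : stableCount X = s) :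
    ∃ R : Matrix ν (Fin s) ℂ, IsRightStable X R := by
  obtain ⟨Es, -, hinv, -, hst, -, hdim, -⟩ := exists_spectral_splitting X
  set b : Basis (Fin s) ℂ Es := finBasisOfFinrankEq ℂ Es (hdim.trans hs)
  set R : Matrix ν (Fin s) ℂ := (Matrix.of fun j => (b j : ν → ℂ))ᵀ with hRdef
  have hR : ∀ y, R *ᵥ y = ((b.equivFun.symm y : Es) : ν → ℂ) := by
    intro y
    rw [Basis.equivFun_symm_apply]
    ext i
    simp [hRdef, Matrix.mulVec, dotProduct, mul_comm]
  have hrange : LinearMap.range R.mulVecLin = Es := by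
    ext x
    constructor
    · rintro ⟨y, rfl⟩
      rw [Matrix.mulVecLin_apply, hR]
      exact (b.equivFun.symm y).2
    · intro hx
      refine ⟨b.equivFun ⟨x, hx⟩, ?_⟩
      rw [Matrix.mulVecLin_apply, hR, LinearEquiv.symm_apply_apply]
  refine ⟨R, isRightStable_of_range (by rw [hs, Fintype.card_fin]) ?_ ?_ ?_⟩
  · intro x y hxy
    rw [hR, hR] at hxy
    exact b.equivFun.symm.injective (Subtype.ext hxy)
  · rw [hrange]; exact hinv
  · rw [hrange]; exact hst

end RightStable

/-! ### Energy identities -/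

section Energy

variable {ν : Type*} [Fintype ν] [DecidableEq ν]

theorem exists_transpose_mul_self_of_posDef {X : Matrix ν ν ℝ} (hX : X.PosDef) :
    ∃ L : Matrix ν ν ℝ, IsUnit L.det ∧ X = Lᵀ * L := by
  have hs : X.IsSymm := by
    have := hX.isHermitian
    rwa [Matrix.IsHermitian, Matrix.conjTranspose_eq_transpose_of_trivial] at this
  obtain ⟨V, d, h⟩ := exists_isOrthDiag hs
  have hVi : Function.Injective V.mulVec := fun x y hxy => by
    have := congrArg (Vᵀ *ᵥ ·) hxy
    simpa only [Matrix.mulVec_mulVec, h.left, Matrix.one_mulVec] using this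
  have hd : ∀ i, 0 < d i := by
    have h1 := hX.conjTranspose_mul_mul_same hVi
    rw [Matrix.conjTranspose_eq_transpose_of_trivial, Matrix.mul_assoc, h.mul_eq,
      ← Matrix.mul_assoc, h.left, Matrix.one_mul] at h1
    exact Matrix.posDef_diagonal_iff.1 h1
  have hL : X = (diagonal (fun i => Real.sqrt (d i)) * Vᵀ)ᵀ *
      (diagonal (fun i => Real.sqrt (d i)) * Vᵀ) := by
    rw [Matrix.transpose_mul, Matrix.transpose_transpose, Matrix.diagonal_transpose,
      Matrix.mul_assoc, ← Matrix.mul_assoc (diagonal _), Matrix.diagonal_mul_diagonal,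
      ← Matrix.mul_assoc]
    simp only [Real.mul_self_sqrt (hd _).le]
    exact h.eq
  refine ⟨_, ?_, hL⟩
  rw [isUnit_iff_ne_zero]
  intro h0
  have h1 := hX.det_pos
  rw [hL, Matrix.det_mul, h0, mul_zero] at h1
  exact lt_irrefl _ h1

omit [DecidableEq ν] in
theorem hForm_sub_left (H K : Matrix ν ν ℂ) (x : ν → ℂ) :
    hForm (H - K) x = hForm H x - hForm K x := by
  simp [hForm, Matrix.sub_mulVec, dotProduct_sub]

theorem hForm_one (x : ν → ℂ) : hForm 1 x = ∑ i, ‖x i‖ ^ 2 := by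
  rw [hForm, Matrix.one_mulVec, dotProduct, Complex.re_sum]
  refine Finset.sum_congr rfl fun i _ => ?_
  rw [Pi.star_apply, Complex.star_def, Complex.conj_mul', ← Complex.ofReal_pow,
    Complex.ofReal_re]

theorem hForm_one_pos {x : ν → ℂ} (hx : x ≠ 0) : 0 < hForm 1 x := by
  rw [hForm_one]
  obtain ⟨i, hi⟩ := Function.ne_iff.1 hx
  refine Finset.sum_pos' (fun i _ => sq_nonneg _) ⟨i, Finset.mem_univ i, ?_⟩
  have : 0 < ‖x i‖ := norm_pos_iff.2 hi
  positivity

omit [DecidableEq ν] in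
theorem im_hForm_eq_zero {H : Matrix ν ν ℂ} (hH : H.IsHermitian) (x : ν → ℂ) :
    (star x ⬝ᵥ H *ᵥ x).im = 0 := by
  have := congrArg Complex.im (star_dotProduct_mulVec_of_isHermitian hH x x)
  rw [Complex.star_def, Complex.conj_im] at this
  linarith

omit [DecidableEq ν] in
theorem hForm_toC_transpose_mul {μ : Type*} [Fintype μ] [DecidableEq μ] (L : Matrix μ ν ℝ)
    (x : ν → ℂ) : hForm (toC (Lᵀ * L)) x = hForm 1 (toC L *ᵥ x) := by
  rw [hForm, hForm, toC_mul, toC_transpose, ← Matrix.mulVec_mulVec, Matrix.dotProduct_mulVec,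
    ← star_mulVec, Matrix.one_mulVec]

theorem hForm_toC_nonneg {X : Matrix ν ν ℝ} (hX : X.PosDef) (x : ν → ℂ) :
    0 ≤ hForm (toC X) x := by
  obtain ⟨L, -, rfl⟩ := exists_transpose_mul_self_of_posDef hX
  rw [hForm_toC_transpose_mul, hForm_one]
  positivity

theorem hForm_toC_pos {X : Matrix ν ν ℝ} (hX : X.PosDef) {x : ν → ℂ} (hx : x ≠ 0) :
    0 < hForm (toC X) x := by
  obtain ⟨L, hL, rfl⟩ := exists_transpose_mul_self_of_posDef hX
  rw [hForm_toC_transpose_mul]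
  refine hForm_one_pos fun h0 => hx ?_
  refine Matrix.mulVec_injective_of_isUnit
    ((Matrix.isUnit_iff_isUnit_det _).2 (isUnit_det_toC hL)) ?_
  rw [h0, Matrix.mulVec_zero]

omit [DecidableEq ν] in
/-- The symbol of a symmetric tangential operator is skew-Hermitian. -/
theorem hForm_tangentialSymbol {k : ℕ} {A : Fin (k + 1) → Matrix ν ν ℝ}
    (hA : ∀ j, (A j).IsSymm) (ω : Fin k → ℝ) (x : ν → ℂ) :
    hForm (tangentialSymbol A ω) x = 0 := by
  have h : star x ⬝ᵥ (tangentialSymbol A ω) *ᵥ x =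
      Complex.I * ∑ j : Fin k, (ω j : ℂ) * (star x ⬝ᵥ toC (A j.succ) *ᵥ x) := by
    rw [tangentialSymbol, Matrix.smul_mulVec, dotProduct_smul, Matrix.sum_mulVec, dotProduct_sum,
      smul_eq_mul]
    simp only [Matrix.smul_mulVec, dotProduct_smul, smul_eq_mul]
  rw [hForm, h, Complex.I_mul_re, Complex.im_sum, neg_eq_zero]
  refine Finset.sum_eq_zero fun j _ => ?_
  rw [Complex.im_ofReal_mul, im_hForm_eq_zero (isHermitian_toC (hA _)), mul_zero]

/-- `ξ I + i ∑ ω_j A_j` is accretive for symmetric `A_j` and `Re ξ > 0`. -/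
theorem hForm_symbol {k : ℕ} {A : Fin (k + 1) → Matrix ν ν ℝ}
    (hA : ∀ j, (A j).IsSymm) (ξ : ℂ) (ω : Fin k → ℝ) (x : ν → ℂ) :
    hForm (ξ • (1 : Matrix ν ν ℂ) + tangentialSymbol A ω) x = ξ.re * hForm 1 x := by
  have h := hForm_tangentialSymbol hA ω x
  rw [hForm] at h
  rw [hForm, Matrix.add_mulVec, dotProduct_add, Complex.add_re, h, add_zero, Matrix.smul_mulVec,
    dotProduct_smul, smul_eq_mul, Complex.mul_re, im_hForm_eq_zero Matrix.isHermitian_one, hForm]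
  ring

end Energy

/-! ### Systems in normal form and the relaxation limit -/

section NormalForm

open Filter Topology

variable {k m r : ℕ}

/-- The system in normal form: symmetric coefficients, with `A 0` invertible, and the source matrix
`diag(0, S)` with `S` negative definite. -/
structure IsNormalForm (A : Fin (k + 1) → Matrix (Fin m ⊕ Fin r) (Fin m ⊕ Fin r) ℝ)
    (Q : Matrix (Fin m ⊕ Fin r) (Fin m ⊕ Fin r) ℝ) (S : Matrix (Fin r) (Fin r) ℝ) : Prop where
  symm : ∀ j, (A j).IsSymm
  isUnit : IsUnit (A 0).det
  source : Q = fromBlocks 0 0 0 S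
  neg : (-S).PosDef

namespace IsNormalForm

variable {A : Fin (k + 1) → Matrix (Fin m ⊕ Fin r) (Fin m ⊕ Fin r) ℝ}
  {Q : Matrix (Fin m ⊕ Fin r) (Fin m ⊕ Fin r) ℝ} {S : Matrix (Fin r) (Fin r) ℝ}

theorem source_mulVec (h : IsNormalForm A Q S) (x : Fin m ⊕ Fin r → ℂ) :
    toC Q *ᵥ x = Sum.elim (0 : Fin m → ℂ) (toC S *ᵥ (x ∘ Sum.inr)) := by
  rw [h.source, toC_fromBlocks, Matrix.fromBlocks_mulVec]
  simp [toC_zero]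

theorem hForm_source (h : IsNormalForm A Q S) (x : Fin m ⊕ Fin r → ℂ) :
    hForm (toC Q) x = -hForm (toC (-S)) (x ∘ Sum.inr) := by
  rw [hForm, hForm, h.source_mulVec, dotProduct, Fintype.sum_sum_type, toC_neg,
    Matrix.neg_mulVec, dotProduct_neg, Complex.neg_re, neg_neg, dotProduct]
  simp

theorem hForm_source_nonpos (h : IsNormalForm A Q S) (x : Fin m ⊕ Fin r → ℂ) :
    hForm (toC Q) x ≤ 0 := by
  rw [h.hForm_source, neg_nonpos]
  exact hForm_toC_nonneg h.neg _

theorem source_mulVec_eq_zero (h : IsNormalForm A Q S) {x : Fin m ⊕ Fin r → ℂ}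
    (hx : hForm (toC Q) x = 0) : toC Q *ᵥ x = 0 := by
  have h1 : x ∘ Sum.inr = 0 := by
    by_contra hne
    have := hForm_toC_pos h.neg hne
    rw [h.hForm_source] at hx
    linarith
  rw [h.source_mulVec, h1, Matrix.mulVec_zero]
  ext (i | i) <;> rfl

theorem isUnit_toC (h : IsNormalForm A Q S) : IsUnit (toC (A 0)).det := isUnit_det_toC h.isUnit

theorem mul_kreissMatrix (h : IsNormalForm A Q S) (ξ : ℂ) (ω : Fin k → ℝ) (η : ℝ) :
    toC (A 0) * kreissMatrix A Q ξ ω η = (η : ℂ) • toC Q - (ξ • 1 + tangentialSymbol A ω) := by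
  rw [kreissMatrix, ← Matrix.mul_assoc, Matrix.mul_nonsing_inv _ h.isUnit_toC, Matrix.one_mul,
    sub_sub]

/-- The energy estimate: the source is dissipative and the tangential part conservative. -/
theorem hForm_kreiss (h : IsNormalForm A Q S) (ξ : ℂ) (ω : Fin k → ℝ) {η : ℝ} (hη : 0 ≤ η)
    (x : Fin m ⊕ Fin r → ℂ) :
    hForm ((η : ℂ) • toC Q - (ξ • 1 + tangentialSymbol A ω)) x ≤ -(ξ.re * hForm 1 x) := by
  rw [hForm_sub_left, hForm_symbol h.symm]
  have h1 : hForm ((η : ℂ) • toC Q) x = η * hForm (toC Q) x := by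
    rw [hForm, Matrix.smul_mulVec, dotProduct_smul, smul_eq_mul, Complex.re_ofReal_mul, hForm]
  have := mul_nonpos_of_nonneg_of_nonpos hη (h.hForm_source_nonpos x)
  linarith

theorem dissipative (h : IsNormalForm A Q S) {ξ : ℂ} (hξ : 0 < ξ.re) (ω : Fin k → ℝ) {η : ℝ}
    (hη : 0 ≤ η) {x : Fin m ⊕ Fin r → ℂ} (hx : x ≠ 0) :
    (star x ⬝ᵥ toC (A 0) *ᵥ (kreissMatrix A Q ξ ω η *ᵥ x)).re < 0 := by
  rw [Matrix.mulVec_mulVec, h.mul_kreissMatrix]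
  have h1 := h.hForm_kreiss ξ ω hη x
  have h2 := mul_pos hξ (hForm_one_pos hx)
  rw [hForm] at h1
  linarith

theorem stableCount_kreissMatrix (h : IsNormalForm A Q S) {ξ : ℂ} (hξ : 0 < ξ.re)
    (ω : Fin k → ℝ) {η : ℝ} (hη : 0 ≤ η) :
    stableCount (kreissMatrix A Q ξ ω η) = posEigCount (A 0) := by
  obtain ⟨V, d, hV⟩ := exists_isOrthDiag (h.symm 0)
  exact hV.stableCount_eq fun x hx => h.dissipative hξ ω hη hx

theorem isUnit_kreiss (h : IsNormalForm A Q S) {ξ : ℂ} (hξ : 0 < ξ.re) (ω : Fin k → ℝ) {η : ℝ}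
    (hη : 0 ≤ η) : IsUnit ((η : ℂ) • toC Q - (ξ • 1 + tangentialSymbol A ω)).det := by
  rw [← Matrix.isUnit_iff_isUnit_det, ← Matrix.mulVec_injective_iff_isUnit]
  refine (injective_iff_map_eq_zero (Matrix.mulVecLin _)).2 fun x hx => ?_
  by_contra hne
  have h1 := h.hForm_kreiss ξ ω hη x
  rw [hForm, show _ *ᵥ x = 0 from hx, dotProduct_zero, Complex.zero_re] at h1
  have h2 := mul_pos hξ (hForm_one_pos hne)
  linarith

/-- The energy estimate bounds the resolvent uniformly in `η`. -/
theorem norm_inv_kreiss_le (h : IsNormalForm A Q S) {ξ : ℂ} (hξ : 0 < ξ.re) (ω : Fin k → ℝ)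
    {η : ℝ} (hη : 0 ≤ η) (i j : Fin m ⊕ Fin r) :
    ‖((η : ℂ) • toC Q - (ξ • 1 + tangentialSymbol A ω))⁻¹ i j‖ ≤ ξ.re⁻¹ := by
  set H := (η : ℂ) • toC Q - (ξ • 1 + tangentialSymbol A ω) with hH
  set y := H⁻¹ *ᵥ Pi.single j 1 with hy
  have hyi : ∀ i, H⁻¹ i j = y i := fun i => by
    rw [hy, Matrix.mulVec_single_one]; rfl
  have hHy : H *ᵥ y = Pi.single j 1 := by
    rw [hy, Matrix.mulVec_mulVec, Matrix.mul_nonsing_inv _ (h.isUnit_kreiss hξ ω hη),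
      Matrix.one_mulVec]
  have h1 := h.hForm_kreiss ξ ω hη y
  rw [← hH, hForm, hHy, dotProduct_single, mul_one, Pi.star_apply, Complex.star_def,
    Complex.conj_re] at h1
  have h2 : ξ.re * hForm 1 y ≤ ‖y j‖ := by
    have := (abs_le.1 (Complex.abs_re_le_norm (y j))).1
    linarith
  have h3 : ∀ i, ξ.re * ‖y i‖ ^ 2 ≤ ‖y j‖ := fun i => by
    refine le_trans ?_ h2
    rw [hForm_one]
    exact mul_le_mul_of_nonneg_left (Finset.single_le_sum (f := fun i => ‖y i‖ ^ 2)
      (fun i _ => sq_nonneg _) (Finset.mem_univ i)) hξ.le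
  have h4 : ‖y j‖ ≤ ξ.re⁻¹ := by
    rw [← one_div, le_div_iff₀ hξ]
    rcases (norm_nonneg (y j)).eq_or_lt with h0 | h0
    · rw [← h0]; simp
    · refine le_of_mul_le_mul_right ?_ h0
      have := h3 j
      nlinarith
  have h5 : ‖y i‖ ^ 2 ≤ ξ.re⁻¹ ^ 2 := by
    have h6 : ‖y i‖ ^ 2 ≤ ξ.re⁻¹ * ‖y j‖ := by
      rw [inv_mul_eq_div, le_div_iff₀ hξ, mul_comm]
      exact h3 i
    rw [sq ξ.re⁻¹]
    exact h6.trans (mul_le_mul_of_nonneg_left h4 (inv_nonneg.2 hξ.le))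
  rw [hyi]
  exact (pow_le_pow_iff_left₀ (norm_nonneg _) (inv_nonneg.2 hξ.le) two_ne_zero).1 h5

/-- The range of an orthonormal frame is invariant under `X` if and only if `X R = R R* X R`, a
closed condition. -/
theorem mulVec_mem_range_of_frame {ν κ : Type*} [Fintype ν] [Fintype κ] {X : Matrix ν ν ℂ}
    {R : Matrix ν κ ℂ} (hXR : X * R - R * (Rᴴ * (X * R)) = 0) :
    ∀ x ∈ LinearMap.range R.mulVecLin, X *ᵥ x ∈ LinearMap.range R.mulVecLin := by
  rintro _ ⟨y, rfl⟩
  refine ⟨(Rᴴ * (X * R)) *ᵥ y, ?_⟩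
  simp only [Matrix.mulVecLin_apply, Matrix.mulVec_mulVec, ← sub_eq_zero.1 hXR]

theorem frame_eq {ν κ : Type*} [Fintype ν] [Fintype κ] [DecidableEq κ] {X : Matrix ν ν ℂ}
    {R : Matrix ν κ ℂ} {Y : Matrix κ κ ℂ} (hR : Rᴴ * R = 1) (hXR : X * R = R * Y) :
    X * R - R * (Rᴴ * (X * R)) = 0 := by
  rw [hXR, ← Matrix.mul_assoc Rᴴ, hR, Matrix.one_mul, sub_self]

/-- The relaxation limit `η → ∞` of the stable subspaces. For fixed `ξ` and `ω`, a limit of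
orthonormal frames of the stable subspaces of `M(ξ, ω, η)` spans a subspace on which `A 0` is
nonnegative, which is invariant under the limit `A_1⁻¹ Q` of `M / η`, and under the limit `K A_1`
of `M⁻¹ = (η Q - ξ I - i ∑ ω_j A_j)⁻¹ A_1`; the last two identities determine `K`. -/
theorem exists_limit_frame (h : IsNormalForm A Q S) {s : ℕ} (hs : posEigCount (A 0) = s)
    (B : Matrix (Fin s) (Fin m ⊕ Fin r) ℝ) {c : ℝ} {ξ : ℂ} (hξ : 0 < ξ.re) (ω : Fin k → ℝ)
    (hB : ∀ η : ℝ, 0 ≤ η → ∀ R : Matrix (Fin m ⊕ Fin r) (Fin s) ℂ,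
      IsRightStable (kreissMatrix A Q ξ ω η) R → c * gramRoot R ≤ ‖(toC B * R).det‖) :
    ∃ (R : Matrix (Fin m ⊕ Fin r) (Fin s) ℂ) (K : Matrix (Fin m ⊕ Fin r) (Fin m ⊕ Fin r) ℂ),
      Rᴴ * R = 1 ∧ c ≤ ‖(toC B * R).det‖ ∧
      (∀ x ∈ LinearMap.range R.mulVecLin, 0 ≤ hForm (toC (A 0)) x) ∧
      (∀ x ∈ LinearMap.range R.mulVecLin,
        ((toC (A 0))⁻¹ * toC Q) *ᵥ x ∈ LinearMap.range R.mulVecLin) ∧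
      (∀ x ∈ LinearMap.range R.mulVecLin,
        (K * toC (A 0)) *ᵥ x ∈ LinearMap.range R.mulVecLin) ∧
      toC Q * K = 0 ∧
      fromBlocks 1 0 0 0 * (ξ • 1 + tangentialSymbol A ω) * K = -fromBlocks 1 0 0 0 := by
  set G := ξ • (1 : Matrix (Fin m ⊕ Fin r) (Fin m ⊕ Fin r) ℂ) + tangentialSymbol A ω
  set η : ℕ → ℝ := fun n => (n : ℝ) + 1
  have hη0 : ∀ n, 0 < η n := fun n => by positivity
  have hηC : ∀ n, (η n : ℂ) ≠ 0 := fun n => Complex.ofReal_ne_zero.2 (hη0 n).ne'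
  have hex : ∀ n, ∃ R : Matrix (Fin m ⊕ Fin r) (Fin s) ℂ,
      IsRightStable (kreissMatrix A Q ξ ω (η n)) R ∧ Rᴴ * R = 1 := fun n => by
    obtain ⟨R, hR⟩ := exists_isRightStable (kreissMatrix A Q ξ ω (η n))
      ((h.stableCount_kreissMatrix hξ ω (hη0 n).le).trans hs)
    obtain ⟨Z, hZ, hRZ⟩ := exists_orthonormalize hR.injective
    exact ⟨R * Z, hR.mul_right hZ, hRZ⟩
  choose R hRs hRo using hex
  set H : ℕ → Matrix (Fin m ⊕ Fin r) (Fin m ⊕ Fin r) ℂ := fun n => (η n : ℂ) • toC Q - G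
  have hHn : ∀ n, H n = (η n : ℂ) • toC Q - G := fun n => rfl
  have hHu : ∀ n, IsUnit (H n).det := fun n => h.isUnit_kreiss hξ ω (hη0 n).le
  have hAu := h.isUnit_toC
  have hM : ∀ n, kreissMatrix A Q ξ ω (η n) = (toC (A 0))⁻¹ * H n := fun n => by
    rw [show H n = toC (A 0) * kreissMatrix A Q ξ ω (η n) from (h.mul_kreissMatrix ξ ω (η n)).symm,
      ← Matrix.mul_assoc, Matrix.nonsing_inv_mul _ hAu,
      Matrix.one_mul]
  -- Limits are taken along an ultrafilter, which plays the role of a convergent subsequence.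
  set U := Filter.hyperfilter ℕ
  have hUle : (U : Filter ℕ) ≤ atTop := by
    rw [← Nat.cofinite_eq_atTop]; exact Filter.hyperfilter_le_cofinite
  obtain ⟨R₀, hR₀, hlimR⟩ := isCompact_orthonormal.ultrafilter_le_nhds (U.map R)
    (le_principal_iff.2 (Ultrafilter.mem_map.2 (Filter.univ_mem' hRo)))
  obtain ⟨K, -, hlimK⟩ := (isCompact_entrywise_bounded ξ.re⁻¹).ultrafilter_le_nhds
    (U.map fun n => (H n)⁻¹) (le_principal_iff.2 (Ultrafilter.mem_map.2
      (Filter.univ_mem' fun n i j => h.norm_inv_kreiss_le hξ ω (hη0 n).le i j)))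
  have hR : Tendsto R U (𝓝 R₀) := hlimR
  have hK : Tendsto (fun n => (H n)⁻¹) U (𝓝 K) := hlimK
  have hδ : Tendsto (fun n => ((η n)⁻¹ : ℂ)) U (𝓝 0) := by
    have h1 : Tendsto (fun n => (η n)⁻¹) atTop (𝓝 0) :=
      tendsto_inv_atTop_zero.comp (tendsto_atTop_add_const_right _ _ tendsto_natCast_atTop_atTop)
    have h2 := (Complex.continuous_ofReal.tendsto 0).comp (h1.mono_left hUle)
    simpa [Function.comp_def] using h2
  -- An identity or a closed inequality that is continuous in the data passes to the limit.
  have hclosed : ∀ {α : Type} (Φ : ℂ → Matrix (Fin m ⊕ Fin r) (Fin s) ℂ →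
      Matrix (Fin m ⊕ Fin r) (Fin m ⊕ Fin r) ℂ → Matrix (Fin m ⊕ Fin r) α ℂ),
      Continuous (fun p : ℂ × Matrix (Fin m ⊕ Fin r) (Fin s) ℂ ×
        Matrix (Fin m ⊕ Fin r) (Fin m ⊕ Fin r) ℂ => Φ p.1 p.2.1 p.2.2) →
      (∀ n, Φ ((η n)⁻¹ : ℂ) (R n) (H n)⁻¹ = 0) → Φ 0 R₀ K = 0 := by
    intro α Φ hΦ h0
    have h1 := (hΦ.tendsto (0, R₀, K)).comp (hδ.prodMk_nhds (hR.prodMk_nhds hK))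
    refine tendsto_nhds_unique h1 ?_
    simp only [Function.comp_def, h0]
    exact tendsto_const_nhds
  have hscale : ∀ n, toC Q - ((η n)⁻¹ : ℂ) • G = ((η n)⁻¹ : ℂ) • H n := fun n => by
    rw [hHn, smul_sub, smul_smul, inv_mul_cancel₀ (hηC n), one_smul]
  refine ⟨R₀, K, hR₀, ?_, ?_, ?_, ?_, ?_, ?_⟩
  · have h1 : Tendsto (fun n => ‖(toC B * R n).det‖) U (𝓝 ‖(toC B * R₀).det‖) := by
      have hc : Continuous fun R : Matrix (Fin m ⊕ Fin r) (Fin s) ℂ => ‖(toC B * R).det‖ := by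
        fun_prop
      exact (hc.tendsto R₀).comp hR
    refine ge_of_tendsto h1 (Filter.Eventually.of_forall fun n => ?_)
    have h2 := hB (η n) (hη0 n).le (R n) (hRs n)
    rwa [gramRoot_of_orthonormal (hRo n), mul_one] at h2
  · rintro _ ⟨y, rfl⟩
    have hc : Continuous fun R : Matrix (Fin m ⊕ Fin r) (Fin s) ℂ =>
        hForm (toC (A 0)) (R *ᵥ y) :=
      (continuous_hForm _).comp (by fun_prop)
    refine ge_of_tendsto ((hc.tendsto R₀).comp hR) (Filter.Eventually.of_forall fun n => ?_)
    by_cases h0 : R n *ᵥ y = 0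
    · simp [h0, hForm_zero]
    · exact (hForm_pos_of_stable (isHermitian_toC (h.symm 0))
        (fun x hx => (hRs n).mulVec_mem_range hx)
        (fun x _ hx => h.dissipative hξ ω (hη0 n).le hx)
        (fun z hz x hx => (hRs n).eq_zero_of_eigen hz hx) ⟨y, rfl⟩ h0).le
  · refine mulVec_mem_range_of_frame ?_
    have := hclosed (fun δ R _ => ((toC (A 0))⁻¹ * (toC Q - δ • G)) * R -
      R * (Rᴴ * (((toC (A 0))⁻¹ * (toC Q - δ • G)) * R))) (by fun_prop) fun n => by
        obtain ⟨Y, hY, -⟩ := (hRs n).2.2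
        refine frame_eq (Y := ((η n)⁻¹ : ℂ) • Y) (hRo n) ?_
        rw [hscale, Matrix.mul_smul, ← hM, Matrix.smul_mul, hY, Matrix.mul_smul]
    simpa using this
  · refine mulVec_mem_range_of_frame ?_
    refine hclosed (fun _ R K => (K * toC (A 0)) * R - R * (Rᴴ * ((K * toC (A 0)) * R)))
      (by fun_prop) fun n => ?_
    obtain ⟨Y, hY, hYs⟩ := (hRs n).2.2
    have hYu : IsUnit Y.det := by
      by_contra hne
      have h1 : (0 : ℂ) ∈ spectrum ℂ Y := by
        rw [spectrum.zero_mem_iff, Matrix.isUnit_iff_isUnit_det]; exact hne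
      exact absurd (hYs 0 h1) (by simp)
    refine frame_eq (Y := Y⁻¹) (hRo n) ?_
    have h1 : ((H n)⁻¹ * toC (A 0)) * kreissMatrix A Q ξ ω (η n) = 1 := by
      rw [hM, Matrix.mul_assoc, ← Matrix.mul_assoc (toC (A 0)), Matrix.mul_nonsing_inv _ hAu,
        Matrix.one_mul, Matrix.nonsing_inv_mul _ (hHu n)]
    calc ((H n)⁻¹ * toC (A 0)) * R n
        = ((H n)⁻¹ * toC (A 0)) * (R n * Y) * Y⁻¹ := by
          rw [Matrix.mul_assoc _ (R n * Y), Matrix.mul_assoc (R n), Matrix.mul_nonsing_inv _ hYu,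
            Matrix.mul_one]
      _ = R n * Y⁻¹ := by
          rw [← hY, ← Matrix.mul_assoc, h1, Matrix.one_mul]
  · have := hclosed (fun δ _ K => (toC Q - δ • G) * K - δ • 1) (by fun_prop) fun n => by
      rw [hscale, Matrix.smul_mul, Matrix.mul_nonsing_inv _ (hHu n), sub_self]
    simpa using this
  · have hE : fromBlocks 1 0 0 0 * toC Q = 0 := by
      rw [h.source, toC_fromBlocks, Matrix.fromBlocks_multiply]
      simp [toC_zero]
    have := hclosed (fun _ _ K => fromBlocks 1 0 0 0 * G * K + fromBlocks 1 0 0 0) (by fun_prop)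
      fun n => by
        have h1 : fromBlocks 1 0 0 0 * G = -(fromBlocks 1 0 0 0 * H n) := by
          rw [hHn, Matrix.mul_sub, Matrix.mul_smul, hE, smul_zero, zero_sub, neg_neg]
        rw [h1, Matrix.neg_mul, Matrix.mul_assoc, Matrix.mul_nonsing_inv _ (hHu n),
          Matrix.mul_one, neg_add_cancel]
    exact eq_neg_of_add_eq_zero_left this

end IsNormalForm

end NormalForm

/-! ### Invariant subspaces -/

section InvariantSubspaces

variable {ν : Type*} [Fintype ν]

/-- An injective endomorphism of an invariant subspace is onto. -/
theorem exists_preimage_of_injOn {W : Submodule ℂ (ν → ℂ)} {X : Matrix ν ν ℂ}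
    (hX : ∀ x ∈ W, X *ᵥ x ∈ W) (hinj : ∀ x ∈ W, X *ᵥ x = 0 → x = 0) {x : ν → ℂ} (hx : x ∈ W) :
    ∃ y ∈ W, X *ᵥ y = x := by
  set f : W →ₗ[ℂ] W := X.mulVecLin.restrict hX
  have hf : Function.Injective f := by
    rw [← LinearMap.ker_eq_bot, LinearMap.ker_eq_bot']
    exact fun w hw => Subtype.ext (hinj w w.2 (congrArg Subtype.val hw))
  obtain ⟨y, hy⟩ := LinearMap.injective_iff_surjective.1 hf ⟨x, hx⟩
  exact ⟨y, y.2, congrArg Subtype.val hy⟩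

theorem eq_zero_of_forall_exists_preimage {W : Submodule ℂ (ν → ℂ)} {X : Matrix ν ν ℂ}
    (hX : ∀ x ∈ W, X *ᵥ x ∈ W) (hsurj : ∀ x ∈ W, ∃ y ∈ W, X *ᵥ y = x) {x : ν → ℂ} (hx : x ∈ W)
    (hx0 : X *ᵥ x = 0) : x = 0 := by
  set f : W →ₗ[ℂ] W := X.mulVecLin.restrict hX
  have hf : Function.Surjective f := fun w => by
    obtain ⟨y, hy, hyw⟩ := hsurj w w.2
    exact ⟨⟨y, hy⟩, Subtype.ext hyw⟩
  have := LinearMap.injective_iff_surjective.2 hf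
  exact congrArg Subtype.val (@this ⟨x, hx⟩ 0 (by rw [map_zero]; exact Subtype.ext hx0))

theorem mulVec_mem_of_forall_exists_preimage {W : Submodule ℂ (ν → ℂ)} {X : Matrix ν ν ℂ}
    (hsurj : ∀ x ∈ W, ∃ y ∈ W, X *ᵥ y = x) {x : ν → ℂ} (hx : x ∈ W) : X *ᵥ x ∈ W := by
  have hle : W ≤ W.map X.mulVecLin := fun x hx => by
    obtain ⟨y, hy, hyx⟩ := hsurj x hx
    exact ⟨y, hy, hyx⟩
  have heq := Submodule.eq_of_le_of_finrank_le hle (Submodule.finrank_map_le _ _)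
  rw [heq]
  exact ⟨x, hx, rfl⟩

/-- The sum of two invariant subspaces without the eigenvalue `z` does not have it either. -/
theorem eq_zero_of_mem_sup_of_eigen [DecidableEq ν] {V W : Submodule ℂ (ν → ℂ)}
    {X : Matrix ν ν ℂ} (hV : ∀ x ∈ V, X *ᵥ x ∈ V) (hW : ∀ x ∈ W, X *ᵥ x ∈ W) {z : ℂ}
    (hVz : ∀ x ∈ V, X *ᵥ x = z • x → x = 0) (hWz : ∀ x ∈ W, X *ᵥ x = z • x → x = 0)
    {x : ν → ℂ} (hx : x ∈ V ⊔ W) (hxz : X *ᵥ x = z • x) : x = 0 := by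
  have hsub : ∀ x, (X - z • 1) *ᵥ x = X *ᵥ x - z • x := fun x => by
    rw [Matrix.sub_mulVec, Matrix.smul_mulVec, Matrix.one_mulVec]
  have hinv : ∀ {V : Submodule ℂ (ν → ℂ)}, (∀ x ∈ V, X *ᵥ x ∈ V) →
      ∀ x ∈ V, (X - z • 1) *ᵥ x ∈ V := fun {V} h x hx => by
    rw [hsub]; exact V.sub_mem (h x hx) (V.smul_mem _ hx)
  have hpre : ∀ {V : Submodule ℂ (ν → ℂ)}, (∀ x ∈ V, X *ᵥ x ∈ V) →
      (∀ x ∈ V, X *ᵥ x = z • x → x = 0) → ∀ x ∈ V, ∃ y ∈ V, (X - z • 1) *ᵥ y = x :=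
    fun {V} h h0 x hx => exists_preimage_of_injOn (hinv h)
      (fun x hx hx0 => h0 x hx (sub_eq_zero.1 (by rwa [← hsub]))) hx
  refine eq_zero_of_forall_exists_preimage (W := V ⊔ W) (X := X - z • 1) ?_ ?_ hx
    (by rw [hsub, hxz, sub_self])
  · intro x hx
    obtain ⟨v, hv, w, hw, rfl⟩ := Submodule.mem_sup.1 hx
    rw [Matrix.mulVec_add]
    exact Submodule.add_mem_sup (hinv hV v hv) (hinv hW w hw)
  · intro x hx
    obtain ⟨v, hv, w, hw, rfl⟩ := Submodule.mem_sup.1 hx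
    obtain ⟨v', hv', rfl⟩ := hpre hV hVz v hv
    obtain ⟨w', hw', rfl⟩ := hpre hW hWz w hw
    exact ⟨v' + w', Submodule.add_mem_sup hv' hw', Matrix.mulVec_add _ _ _⟩

end InvariantSubspaces

/-! ### The reduced matrix of the equilibrium system -/

namespace IsSpectralFrame

open Module

variable {k m p q : ℕ} {E : Fin (k + 1) → Matrix (Fin m) (Fin m) ℝ}
  {P₁ : Matrix (Fin m) (Fin p) ℝ} {P₀ : Matrix (Fin m) (Fin q) ℝ} {lam : Fin p → ℝ}
  {X : Matrix (Fin m) (Fin m) ℝ}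

theorem isOrthDiag (h : IsSpectralFrame X P₁ P₀ lam) :
    IsOrthDiag X (fromCols P₁ P₀) (Sum.elim lam 0) := by
  refine ⟨h.orth_left, h.orth_right, ?_⟩
  have hd : diagonal (Sum.elim lam (0 : Fin q → ℝ)) = fromBlocks (diagonal lam) 0 0 0 := by
    rw [← Matrix.fromBlocks_diagonal]
    congr 1
    exact Matrix.diagonal_zero'
  rw [hd, ← h.diag]
  simp only [← Matrix.mul_assoc]
  rw [h.orth_right, Matrix.one_mul, Matrix.mul_assoc, h.orth_right, Matrix.mul_one]

theorem gram_blocks (h : IsSpectralFrame X P₁ P₀ lam) :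
    P₁ᵀ * P₁ = 1 ∧ P₁ᵀ * P₀ = 0 ∧ P₀ᵀ * P₁ = 0 ∧ P₀ᵀ * P₀ = 1 := by
  have h1 := h.orth_left
  rw [Matrix.transpose_fromCols, Matrix.fromRows_mul_fromCols, ← Matrix.fromBlocks_one,
    Matrix.fromBlocks_inj] at h1
  exact h1

theorem resolution (h : IsSpectralFrame X P₁ P₀ lam) (x : Fin m → ℂ) :
    toC P₁ *ᵥ ((toC P₁)ᴴ *ᵥ x) + toC P₀ *ᵥ ((toC P₀)ᴴ *ᵥ x) = x := by
  have h1 := h.orth_right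
  rw [Matrix.transpose_fromCols, Matrix.fromCols_mul_fromRows] at h1
  have h2 : toC P₁ * (toC P₁)ᴴ + toC P₀ * (toC P₀)ᴴ = 1 := by
    rw [← toC_transpose, ← toC_transpose, ← toC_mul, ← toC_mul, ← toC_one, ← h1]
    ext i j; simp [toC]
  rw [Matrix.mulVec_mulVec, Matrix.mulVec_mulVec, ← Matrix.add_mulVec, h2, Matrix.one_mulVec]

theorem conjTranspose_mul_P₁ (h : IsSpectralFrame X P₁ P₀ lam) : (toC P₁)ᴴ * toC P₁ = 1 := by
  rw [← toC_transpose, ← toC_mul, h.gram_blocks.1, toC_one]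

theorem conjTranspose_P₁_mul_P₀ (h : IsSpectralFrame X P₁ P₀ lam) :
    (toC P₁)ᴴ * toC P₀ = 0 := by
  rw [← toC_transpose, ← toC_mul, h.gram_blocks.2.1, toC_zero]

theorem conjTranspose_P₀_mul_P₁ (h : IsSpectralFrame X P₁ P₀ lam) :
    (toC P₀)ᴴ * toC P₁ = 0 := by
  rw [← toC_transpose, ← toC_mul, h.gram_blocks.2.2.1, toC_zero]

theorem conjTranspose_mul_P₀ (h : IsSpectralFrame X P₁ P₀ lam) : (toC P₀)ᴴ * toC P₀ = 1 := by
  rw [← toC_transpose, ← toC_mul, h.gram_blocks.2.2.2, toC_one]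

theorem mul_blocks (h : IsSpectralFrame X P₁ P₀ lam) :
    X * P₁ = P₁ * diagonal lam ∧ X * P₀ = 0 := by
  have h1 := congrArg (fromCols P₁ P₀ * ·) h.diag
  simp only [← Matrix.mul_assoc, h.orth_right, Matrix.one_mul] at h1
  rw [Matrix.mul_fromCols, Matrix.fromCols_mul_fromBlocks] at h1
  simpa using Matrix.fromCols_inj h1

theorem toC_mul_P₁ (h : IsSpectralFrame X P₁ P₀ lam) :
    toC X * toC P₁ = toC P₁ * toC (diagonal lam) := by
  rw [← toC_mul, h.mul_blocks.1, toC_mul]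

theorem toC_mul_P₀ (h : IsSpectralFrame X P₁ P₀ lam) : toC X * toC P₀ = 0 := by
  rw [← toC_mul, h.mul_blocks.2, toC_zero]

theorem isHermitian (h : IsSpectralFrame X P₁ P₀ lam) : (toC X).IsHermitian :=
  isHermitian_toC h.isOrthDiag.isSymm

theorem conjTranspose_P₁_mul (h : IsSpectralFrame X P₁ P₀ lam) :
    (toC P₁)ᴴ * toC X = toC (diagonal lam) * (toC P₁)ᴴ := by
  have h1 := congrArg conjTranspose h.toC_mul_P₁
  rwa [Matrix.conjTranspose_mul, Matrix.conjTranspose_mul, h.isHermitian.eq,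
    (isHermitian_toC (Matrix.isSymm_diagonal lam)).eq] at h1

theorem conjTranspose_P₀_mul (h : IsSpectralFrame X P₁ P₀ lam) : (toC P₀)ᴴ * toC X = 0 := by
  have h1 := congrArg conjTranspose h.toC_mul_P₀
  rwa [Matrix.conjTranspose_mul, h.isHermitian.eq, Matrix.conjTranspose_zero] at h1

theorem card_nonneg (h : IsSpectralFrame X P₁ P₀ lam) :
    Fintype.card {i : Fin p ⊕ Fin q // 0 ≤ Sum.elim lam (0 : Fin q → ℝ) i} =
      posEigCount X + q := by
  rw [h.isOrthDiag.posEigCount_eq, Fintype.card_subtype, Fintype.card_subtype,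
    Finset.card_filter, Finset.card_filter, Fintype.sum_sum_type, Fintype.sum_sum_type]
  simp only [Sum.elim_inl, Sum.elim_inr, Pi.zero_apply, le_refl, lt_irrefl, if_true, if_false,
    Finset.sum_const_zero, add_zero, Finset.sum_const, Finset.card_univ, Fintype.card_fin,
    smul_eq_mul, mul_one, add_left_inj]
  refine Finset.sum_congr rfl fun i _ => ?_
  simp only [le_iff_lt_or_eq, (h.ne_zero i).symm, or_false]
  congr

theorem isOrthDiag_diagonal (lam : Fin p → ℝ) : IsOrthDiag (diagonal lam) 1 lam :=
  ⟨by simp, by simp, by simp⟩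

theorem posEigCount_eq (h : IsSpectralFrame X P₁ P₀ lam) :
    posEigCount (diagonal lam) = posEigCount X := by
  rw [h.isOrthDiag.posEigCount_eq, (isOrthDiag_diagonal lam).posEigCount_eq,
    Fintype.card_subtype, Fintype.card_subtype,
    Finset.card_filter, Finset.card_filter, Fintype.sum_sum_type]
  simp only [Sum.elim_inl, Sum.elim_inr, Pi.zero_apply, lt_irrefl, if_false,
    Finset.sum_const_zero, add_zero]
  exact Finset.sum_congr rfl fun i _ => by congr

/-- In the spectral frame the form of `X` only sees the component along `P₁`. -/
theorem hForm_eq (h : IsSpectralFrame X P₁ P₀ lam) (x : Fin m → ℂ) :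
    hForm (toC X) x = hForm (toC (diagonal lam)) ((toC P₁)ᴴ *ᵥ x) := by
  have h1 : toC X *ᵥ x = toC P₁ *ᵥ (toC (diagonal lam) *ᵥ ((toC P₁)ᴴ *ᵥ x)) := by
    conv_lhs => rw [← h.resolution x]
    rw [Matrix.mulVec_add, Matrix.mulVec_mulVec, Matrix.mulVec_mulVec, h.toC_mul_P₁,
      Matrix.mulVec_mulVec _ (toC X), h.toC_mul_P₀, Matrix.zero_mulVec, add_zero,
      ← Matrix.mulVec_mulVec, Matrix.mulVec_mulVec]
    simp only [Matrix.mulVec_mulVec, Matrix.mul_assoc]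
  rw [hForm, h1, Matrix.dotProduct_mulVec, hForm, star_mulVec, Matrix.conjTranspose_conjTranspose]

theorem isUnit_diagonal (h : IsSpectralFrame X P₁ P₀ lam) : IsUnit (toC (diagonal lam)).det := by
  refine isUnit_det_toC ?_
  rw [Matrix.det_diagonal, isUnit_iff_ne_zero]
  exact Finset.prod_ne_zero_iff.2 fun i _ => h.ne_zero i

theorem isUnit_compression (h : IsSpectralFrame X P₁ P₀ lam) (hE : ∀ j, (E j).IsSymm) {ξ : ℂ}
    (hξ : 0 < ξ.re) (ω : Fin k → ℝ) :
    IsUnit ((toC P₀)ᴴ * (ξ • 1 + tangentialSymbol E ω) * toC P₀).det := by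
  rw [← Matrix.isUnit_iff_isUnit_det, ← Matrix.mulVec_injective_iff_isUnit]
  refine (injective_iff_map_eq_zero (Matrix.mulVecLin _)).2 fun b hb => ?_
  have hb' : ((toC P₀)ᴴ * (ξ • 1 + tangentialSymbol E ω) * toC P₀) *ᵥ b = 0 := hb
  have h1 : hForm (ξ • 1 + tangentialSymbol E ω) (toC P₀ *ᵥ b) = 0 := by
    rw [hForm, star_mulVec, ← Matrix.dotProduct_mulVec, Matrix.mulVec_mulVec,
      Matrix.mulVec_mulVec, hb', dotProduct_zero, Complex.zero_re]
  rw [hForm_symbol hE] at h1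
  have h2 : toC P₀ *ᵥ b = 0 := by
    by_contra hne
    exact (mul_pos hξ (hForm_one_pos hne)).ne' h1
  rw [← Matrix.one_mulVec b, ← h.conjTranspose_mul_P₀, ← Matrix.mulVec_mulVec, h2,
    Matrix.mulVec_zero]

/-- `M₁` is a Schur complement of the symbol `ξ I + i ∑ ω_j E_j`. -/
theorem reducedMatrix_eq (h : IsSpectralFrame X P₁ P₀ lam) (ξ : ℂ) (ω : Fin k → ℝ) :
    reducedMatrix E P₁ P₀ lam ξ ω = -((toC (diagonal lam))⁻¹ *
      ((toC P₁)ᴴ * (ξ • 1 + tangentialSymbol E ω) * toC P₁ -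
        (toC P₁)ᴴ * (ξ • 1 + tangentialSymbol E ω) * toC P₀ *
        ((toC P₀)ᴴ * (ξ • 1 + tangentialSymbol E ω) * toC P₀)⁻¹ *
        ((toC P₀)ᴴ * (ξ • 1 + tangentialSymbol E ω) * toC P₁))) := by
  simp only [reducedMatrix, Matrix.mul_add, Matrix.add_mul, Matrix.mul_smul, Matrix.smul_mul,
    Matrix.mul_one, h.conjTranspose_mul_P₁, h.conjTranspose_mul_P₀, h.conjTranspose_P₁_mul_P₀,
    h.conjTranspose_P₀_mul_P₁, smul_zero, zero_add]

/-- On states whose image under the symbol has no component along `P₀`, the matrix `Λ₁ M₁` acts as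
minus the symbol. -/
theorem diagonal_mulVec_reducedMatrix (h : IsSpectralFrame X P₁ P₀ lam) (hE : ∀ j, (E j).IsSymm)
    {ξ : ℂ} (hξ : 0 < ξ.re) (ω : Fin k → ℝ) {y : Fin m → ℂ}
    (hy : (toC P₀)ᴴ *ᵥ ((ξ • 1 + tangentialSymbol E ω) *ᵥ y) = 0) :
    toC (diagonal lam) *ᵥ (reducedMatrix E P₁ P₀ lam ξ ω *ᵥ ((toC P₁)ᴴ *ᵥ y)) =
      -((toC P₁)ᴴ *ᵥ ((ξ • 1 + tangentialSymbol E ω) *ᵥ y)) := by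
  have hu := h.isUnit_compression hE hξ ω
  rw [h.reducedMatrix_eq]
  set G := ξ • 1 + tangentialSymbol E ω
  set w := (toC P₁)ᴴ *ᵥ y with hw
  set b := (toC P₀)ᴴ *ᵥ y with hb
  have hsplit : ∀ {l : ℕ} (Z : Matrix (Fin l) (Fin m) ℂ), Z *ᵥ y =
      (Z * toC P₁) *ᵥ w + (Z * toC P₀) *ᵥ b := fun Z => by
    rw [← Matrix.mulVec_mulVec, ← Matrix.mulVec_mulVec, ← Matrix.mulVec_add, hw, hb,
      h.resolution]
  have hb' : ((toC P₀)ᴴ * G * toC P₀)⁻¹ *ᵥ (((toC P₀)ᴴ * G * toC P₁) *ᵥ w) = -b := by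
    rw [Matrix.mulVec_mulVec, hsplit] at hy
    rw [eq_neg_of_add_eq_zero_left hy, Matrix.mulVec_neg, Matrix.mulVec_mulVec,
      Matrix.nonsing_inv_mul _ hu, Matrix.one_mulVec]
  rw [Matrix.neg_mulVec, Matrix.mulVec_neg, Matrix.mulVec_mulVec, ← Matrix.mul_assoc,
    Matrix.mul_nonsing_inv _ h.isUnit_diagonal, Matrix.one_mul, Matrix.sub_mulVec,
    Matrix.mulVec_mulVec y (toC P₁)ᴴ G, hsplit ((toC P₁)ᴴ * G),
    ← Matrix.mulVec_mulVec w _ ((toC P₀)ᴴ * G * toC P₁),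
    ← Matrix.mulVec_mulVec _ ((toC P₁)ᴴ * G * toC P₀), hb',
    Matrix.mulVec_neg, sub_neg_eq_add]

/-- The component along `P₀` is recovered from the one along `P₁` by the characteristic part of the
equilibrium system, which contains no normal derivative. -/
theorem exists_lift (h : IsSpectralFrame X P₁ P₀ lam) (hE : ∀ j, (E j).IsSymm) {ξ : ℂ}
    (hξ : 0 < ξ.re) (ω : Fin k → ℝ) (w : Fin p → ℂ) :
    ∃ y : Fin m → ℂ, (toC P₁)ᴴ *ᵥ y = w ∧
      (toC P₀)ᴴ *ᵥ ((ξ • 1 + tangentialSymbol E ω) *ᵥ y) = 0 := by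
  have hu := h.isUnit_compression hE hξ ω
  set G := ξ • 1 + tangentialSymbol E ω
  refine ⟨toC P₁ *ᵥ w - toC P₀ *ᵥ
    (((toC P₀)ᴴ * G * toC P₀)⁻¹ *ᵥ (((toC P₀)ᴴ * G * toC P₁) *ᵥ w)), ?_, ?_⟩
  · rw [Matrix.mulVec_sub, Matrix.mulVec_mulVec, Matrix.mulVec_mulVec, h.conjTranspose_mul_P₁,
      h.conjTranspose_P₁_mul_P₀, Matrix.one_mulVec, Matrix.zero_mulVec, sub_zero]
  · rw [Matrix.mulVec_sub, Matrix.mulVec_sub]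
    simp only [Matrix.mulVec_mulVec]
    simp only [← Matrix.mul_assoc]
    rw [Matrix.mul_nonsing_inv _ hu, Matrix.one_mul, sub_self]

theorem dissipative_reducedMatrix (h : IsSpectralFrame X P₁ P₀ lam) (hE : ∀ j, (E j).IsSymm)
    {ξ : ℂ} (hξ : 0 < ξ.re) (ω : Fin k → ℝ) {w : Fin p → ℂ} (hw : w ≠ 0) :
    (star w ⬝ᵥ toC (diagonal lam) *ᵥ (reducedMatrix E P₁ P₀ lam ξ ω *ᵥ w)).re < 0 := by
  obtain ⟨y, rfl, hy⟩ := h.exists_lift hE hξ ω w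
  rw [h.diagonal_mulVec_reducedMatrix hE hξ ω hy]
  have hy0 : y ≠ 0 := by
    rintro rfl; exact hw (Matrix.mulVec_zero _)
  have h1 := hForm_symbol hE ξ ω y
  have h2 := mul_pos hξ (hForm_one_pos hy0)
  set G := ξ • 1 + tangentialSymbol E ω
  rw [hForm, ← h.resolution (G *ᵥ y), hy, Matrix.mulVec_zero, add_zero, Matrix.dotProduct_mulVec]
    at h1
  rw [star_mulVec, Matrix.conjTranspose_conjTranspose, dotProduct_neg, Complex.neg_re]
  linarith

theorem stableCount_reducedMatrix (h : IsSpectralFrame X P₁ P₀ lam) (hE : ∀ j, (E j).IsSymm)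
    {ξ : ℂ} (hξ : 0 < ξ.re) (ω : Fin k → ℝ) :
    stableCount (reducedMatrix E P₁ P₀ lam ξ ω) = posEigCount X := by
  rw [← h.posEigCount_eq]
  exact (isOrthDiag_diagonal lam).stableCount_eq fun w hw => h.dissipative_reducedMatrix hE hξ ω hw

theorem finrank_le_of_nonneg (h : IsSpectralFrame X P₁ P₀ lam) {W : Submodule ℂ (Fin m → ℂ)}
    (hW : ∀ u ∈ W, 0 ≤ hForm (toC X) u) : finrank ℂ W ≤ posEigCount X + q :=
  h.card_nonneg ▸ h.isOrthDiag.finrank_le_of_nonneg hW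

/-- A maximal nonnegative subspace for `X` contains the kernel `P₀`. -/
theorem mulVec_P₀_mem (h : IsSpectralFrame X P₁ P₀ lam) {W : Submodule ℂ (Fin m → ℂ)}
    (hW : ∀ u ∈ W, 0 ≤ hForm (toC X) u) (hdim : posEigCount X + q ≤ finrank ℂ W)
    (b : Fin q → ℂ) : toC P₀ *ᵥ b ∈ W := by
  have hsup : W = W ⊔ LinearMap.range (toC P₀).mulVecLin := by
    refine Submodule.eq_of_le_of_finrank_le le_sup_left ((h.finrank_le_of_nonneg ?_).trans hdim)
    intro x hx
    obtain ⟨u, hu, _, ⟨b, rfl⟩, rfl⟩ := Submodule.mem_sup.1 hx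
    rw [h.hForm_eq, Matrix.mulVec_add, Matrix.mulVecLin_apply, Matrix.mulVec_mulVec,
      h.conjTranspose_P₁_mul_P₀, Matrix.zero_mulVec, add_zero, ← h.hForm_eq]
    exact hW u hu
  rw [hsup]
  exact Submodule.mem_sup_right ⟨b, rfl⟩

/-- A maximal nonnegative subspace for `X` which is invariant under `-(ξ I + i ∑ ω_j E_j)⁻¹ X`
contains the stable solutions of the reduced system: its component along `P₁` is invariant under
`M₁` and nonnegative for `Λ₁`, hence it is the stable subspace of `M₁`. -/
theorem mulVec_P₁_mem (h : IsSpectralFrame X P₁ P₀ lam) (hE : ∀ j, (E j).IsSymm)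
    {ξ : ℂ} (hξ : 0 < ξ.re) (ω : Fin k → ℝ) {W : Submodule ℂ (Fin m → ℂ)}
    (hW : ∀ u ∈ W, 0 ≤ hForm (toC X) u) (hdim : posEigCount X + q ≤ finrank ℂ W)
    (hinv : ∀ u ∈ W, ∃ y ∈ W, (ξ • 1 + tangentialSymbol E ω) *ᵥ y = -(toC X *ᵥ u))
    {κ : Type*} [Fintype κ] [DecidableEq κ] {R : Matrix (Fin p) κ ℂ}
    (hR : IsRightStable (reducedMatrix E P₁ P₀ lam ξ ω) R) (t : κ → ℂ) :
    toC P₁ *ᵥ (R *ᵥ t) ∈ W := by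
  set M := reducedMatrix E P₁ P₀ lam ξ ω
  set V := W.map (toC P₁)ᴴ.mulVecLin with hV
  have hVpre : ∀ w ∈ V, ∃ w' ∈ V, M *ᵥ w' = w := by
    rintro _ ⟨u, hu, rfl⟩
    obtain ⟨y, hy, hyu⟩ := hinv u hu
    refine ⟨_, ⟨y, hy, rfl⟩, ?_⟩
    have h0 : (toC P₀)ᴴ *ᵥ ((ξ • 1 + tangentialSymbol E ω) *ᵥ y) = 0 := by
      rw [hyu, Matrix.mulVec_neg, Matrix.mulVec_mulVec, h.conjTranspose_P₀_mul,
        Matrix.zero_mulVec, neg_zero]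
    have h1 := h.diagonal_mulVec_reducedMatrix hE hξ ω h0
    rw [hyu, Matrix.mulVec_neg, neg_neg, Matrix.mulVec_mulVec _ _ (toC X),
      h.conjTranspose_P₁_mul, ← Matrix.mulVec_mulVec] at h1
    exact Matrix.mulVec_injective_of_isUnit
      ((Matrix.isUnit_iff_isUnit_det _).2 h.isUnit_diagonal) h1
  have hVinv : ∀ w ∈ V, M *ᵥ w ∈ V := fun w hw =>
    mulVec_mem_of_forall_exists_preimage hVpre hw
  have hVst : ∀ z : ℂ, 0 ≤ z.re → ∀ w ∈ V, M *ᵥ w = z • w → w = 0 := by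
    rintro z hz _ ⟨u, hu, rfl⟩ hwz
    by_contra hne
    have h1 := h.dissipative_reducedMatrix hE hξ ω hne
    have h2 := hW u hu
    rw [h.hForm_eq] at h2
    rw [show reducedMatrix E P₁ P₀ lam ξ ω *ᵥ _ = _ from hwz, Matrix.mulVec_smul,
      dotProduct_smul, smul_eq_mul, Complex.mul_re,
      im_hForm_eq_zero (isHermitian_toC (Matrix.isSymm_diagonal lam)), mul_zero, sub_zero] at h1
    exact absurd (mul_nonneg hz h2) (not_le.2 h1)
  have hVdim : posEigCount X ≤ finrank ℂ V := by
    set g : W →ₗ[ℂ] V × (Fin q → ℂ) :=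
      (((toC P₁)ᴴ.mulVecLin.domRestrict W).codRestrict V fun u => ⟨u, u.2, rfl⟩).prod
        ((toC P₀)ᴴ.mulVecLin.domRestrict W)
    have hg : Function.Injective g := by
      rw [← LinearMap.ker_eq_bot, LinearMap.ker_eq_bot']
      intro x hx
      have hx0 : (toC P₀)ᴴ *ᵥ (x : Fin m → ℂ) = 0 := congrArg Prod.snd hx
      have hx1 : (toC P₁)ᴴ *ᵥ (x : Fin m → ℂ) = 0 := congrArg (fun y => (y.1 : Fin p → ℂ)) hx
      have := h.resolution (x : Fin m → ℂ)
      rw [hx0, hx1, Matrix.mulVec_zero, Matrix.mulVec_zero, add_zero] at this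
      exact Subtype.ext this.symm
    have h1 := LinearMap.finrank_le_finrank_of_injective hg
    rw [Module.finrank_prod, Module.finrank_fin_fun] at h1
    omega
  have hsup : V = V ⊔ LinearMap.range R.mulVecLin := by
    refine Submodule.eq_of_le_of_finrank_le le_sup_left (le_trans ?_ hVdim)
    rw [← h.posEigCount_eq, (isOrthDiag_diagonal lam).posEigCount_eq]
    refine (isOrthDiag_diagonal lam).finrank_le_of_pos fun x hx hx0 => ?_
    refine hForm_pos_of_stable (X := M) (isHermitian_toC (Matrix.isSymm_diagonal lam)) ?_
      (fun w _ hw => h.dissipative_reducedMatrix hE hξ ω hw) ?_ hx hx0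
    · intro x hx
      obtain ⟨v, hv, w, hw, rfl⟩ := Submodule.mem_sup.1 hx
      rw [Matrix.mulVec_add]
      exact Submodule.add_mem_sup (hVinv v hv) (hR.mulVec_mem_range hw)
    · exact fun z hz x hx hxz => eq_zero_of_mem_sup_of_eigen hVinv
        (fun x hx => hR.mulVec_mem_range hx) (hVst z hz)
        (fun x hx => hR.eq_zero_of_eigen hz hx) hx hxz
  obtain ⟨u, hu, hut⟩ : R *ᵥ t ∈ V := by
    rw [hsup]; exact Submodule.mem_sup_right ⟨t, rfl⟩
  have h1 : toC P₁ *ᵥ (R *ᵥ t) = u - toC P₀ *ᵥ ((toC P₀)ᴴ *ᵥ u) := by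
    rw [← hut, eq_sub_iff_add_eq]
    exact h.resolution u
  rw [h1]
  exact W.sub_mem hu (h.mulVec_P₀_mem hW hdim _)

end IsSpectralFrame

/-! ### Boundary layers -/

section Layers

open Module

namespace IsOrthDiag

variable {ν ι κ : Type*} [Fintype ν] [DecidableEq ν] [Fintype ι] [DecidableEq ι] [Fintype κ]
  [DecidableEq κ] {X : Matrix ν ν ℝ} {V : Matrix ν ι ℝ} {d : ι → ℝ}

theorem gram_submatrix {κ : Type*} [DecidableEq κ] (h : IsOrthDiag X V d) {f : κ → ι}
    (hf : Function.Injective f) : (V.submatrix id f)ᵀ * V.submatrix id f = 1 := by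
  have := congrArg (fun Y => Y.submatrix f f) h.left
  rwa [← Matrix.submatrix_mul_equiv _ _ f (Equiv.refl ν) f, Matrix.submatrix_one f hf] at this

theorem hForm_submatrix (h : IsOrthDiag X V d) {f : κ → ι} (hf : Function.Injective f)
    (x : κ → ℂ) :
    hForm (toC X) (toC (V.submatrix id f) *ᵥ x) = ∑ j, d (f j) * ‖x j‖ ^ 2 := by
  have h1 : (toC (V.submatrix id f))ᴴ * toC X * toC (V.submatrix id f) =
      toC (diagonal (d ∘ f)) := by
    have h2 : (V.submatrix id f)ᵀ * X * V.submatrix id f = diagonal (d ∘ f) := by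
      have h3 : Vᵀ * X * V = diagonal d := by
        rw [Matrix.mul_assoc, h.mul_eq, ← Matrix.mul_assoc, h.left, Matrix.one_mul]
      rw [← Matrix.submatrix_diagonal d f hf, ← h3]
      ext i j
      simp [Matrix.mul_apply]
    rw [← toC_transpose, ← toC_mul, ← toC_mul, h2]
  have h4 : IsOrthDiag (diagonal (d ∘ f)) 1 (d ∘ f) := ⟨by simp, by simp, by simp⟩
  have h5 := h4.hForm_eq x
  rw [← h1, toC_one, Matrix.conjTranspose_one, Matrix.one_mulVec] at h5
  rw [hForm, star_mulVec, ← Matrix.dotProduct_mulVec, Matrix.mulVec_mulVec, Matrix.mulVec_mulVec]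
  exact h5

end IsOrthDiag

theorem injective_toC_of_gram {ν κ : Type*} [Fintype ν] [Fintype κ] [DecidableEq κ]
    {V : Matrix ν κ ℝ} (hV : Vᵀ * V = 1) : Function.Injective (toC V).mulVec := fun x y hxy => by
  have := congrArg ((toC V)ᴴ *ᵥ ·) hxy
  simpa only [Matrix.mulVec_mulVec, ← toC_transpose, ← toC_mul, hV, toC_one,
    Matrix.one_mulVec] using this

/-- A nonnegative subspace of a nondegenerate form has at most the dimension of a positive one. -/
theorem finrank_le_posEigCount {ν : Type*} [Fintype ν] [DecidableEq ν] {X : Matrix ν ν ℝ}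
    (hX : X.IsSymm) (hu : IsUnit X.det) {W : Submodule ℂ (ν → ℂ)}
    (hW : ∀ x ∈ W, 0 ≤ hForm (toC X) x) : finrank ℂ W ≤ posEigCount X := by
  obtain ⟨V, d, h⟩ := exists_isOrthDiag hX
  have hd : ∀ i, d i ≠ 0 := fun i hi => by
    have h1 := hu.ne_zero
    rw [h.eq, Matrix.det_mul, Matrix.det_mul, Matrix.det_diagonal,
      Finset.prod_eq_zero (Finset.mem_univ i) hi] at h1
    simp at h1
  rw [h.posEigCount_eq]
  refine (h.finrank_le_of_nonneg hW).trans (le_of_eq ?_)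
  refine Fintype.card_congr (Equiv.subtypeEquivRight fun i => ?_)
  exact ⟨fun h0 => lt_of_le_of_ne h0 (hd i).symm, le_of_lt⟩

/-- The inclusion `u ↦ (u, 0)` of the equilibrium unknowns. -/
def inlVec (m r : ℕ) : (Fin m → ℂ) →ₗ[ℂ] (Fin m ⊕ Fin r → ℂ) where
  toFun u := Sum.elim u 0
  map_add' u v := by ext (i | i) <;> simp
  map_smul' c u := by ext (i | i) <;> simp

section InlVec

variable {m r : ℕ}

theorem inlVec_inl (u : Fin m → ℂ) : (inlVec m r u) ∘ Sum.inl = u := rfl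

theorem inlVec_injective : Function.Injective (inlVec m r) := fun u v huv => by
  rw [← inlVec_inl (r := r) u, huv, inlVec_inl]

theorem inlVec_comp_inl {x : Fin m ⊕ Fin r → ℂ} (hx : x ∘ Sum.inr = 0) :
    inlVec m r (x ∘ Sum.inl) = x := by
  ext (i | i)
  · rfl
  · exact (congrFun hx i).symm

theorem mulVec_inlVec (X : Matrix (Fin m ⊕ Fin r) (Fin m ⊕ Fin r) ℂ) (u : Fin m → ℂ) :
    (X *ᵥ inlVec m r u) ∘ Sum.inl = X.toBlocks₁₁ *ᵥ u := by
  ext i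
  simp [inlVec, Matrix.mulVec, dotProduct, Matrix.toBlocks₁₁]

theorem star_inlVec_dotProduct (u : Fin m → ℂ) (z : Fin m ⊕ Fin r → ℂ) :
    star (inlVec m r u) ⬝ᵥ z = star u ⬝ᵥ (z ∘ Sum.inl) := by
  simp [inlVec, dotProduct]

theorem hForm_inlVec (X : Matrix (Fin m ⊕ Fin r) (Fin m ⊕ Fin r) ℂ) (u : Fin m → ℂ) :
    hForm X (inlVec m r u) = hForm X.toBlocks₁₁ u := by
  rw [hForm, star_inlVec_dotProduct, mulVec_inlVec, hForm]

theorem symbol_toBlocks₁₁ {k : ℕ} (A : Fin (k + 1) → Matrix (Fin m ⊕ Fin r) (Fin m ⊕ Fin r) ℝ)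
    (ξ : ℂ) (ω : Fin k → ℝ) :
    (ξ • (1 : Matrix (Fin m ⊕ Fin r) (Fin m ⊕ Fin r) ℂ) + tangentialSymbol A ω).toBlocks₁₁ =
      ξ • 1 + tangentialSymbol (fun j => (A j).toBlocks₁₁) ω := by
  ext i j
  simp [tangentialSymbol, Matrix.toBlocks₁₁, Matrix.sum_apply, Matrix.one_apply, toC]

end InlVec

variable {k m r : ℕ} {A : Fin (k + 1) → Matrix (Fin m ⊕ Fin r) (Fin m ⊕ Fin r) ℝ}
  {Q : Matrix (Fin m ⊕ Fin r) (Fin m ⊕ Fin r) ℝ} {S : Matrix (Fin r) (Fin r) ℝ}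

/-- The columns of `Z` span the initial values of the boundary layers of `A_1 U_y = Q U`, that is,
the sum of the eigenspaces of `A_1⁻¹ Q` for negative eigenvalues. What is recorded is that these
vectors have no flux `A_1 Z` in the equilibrium equations, that `A_1` is positive definite on them,
and that they span the largest subspace of the range of `A_1⁻¹ Q` which is invariant under
`A_1⁻¹ Q` and on which `A_1` is positive definite. -/
structure IsFastFrame (A : Fin (k + 1) → Matrix (Fin m ⊕ Fin r) (Fin m ⊕ Fin r) ℝ)
    (Q : Matrix (Fin m ⊕ Fin r) (Fin m ⊕ Fin r) ℝ) {nf : ℕ}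
    (Z : Matrix (Fin m ⊕ Fin r) (Fin nf) ℝ) : Prop where
  flux : ∀ y, (toC (A 0) *ᵥ (toC Z *ᵥ y)) ∘ Sum.inl = 0
  pos : ∀ y, y ≠ 0 → 0 < hForm (toC (A 0)) (toC Z *ᵥ y)
  maximal : ∀ W : Submodule ℂ (Fin m ⊕ Fin r → ℂ),
    (∀ x ∈ W, ((toC (A 0))⁻¹ * toC Q) *ᵥ x ∈ W) →
    (∀ x ∈ W, ∃ x', x = ((toC (A 0))⁻¹ * toC Q) *ᵥ x') →
    (∀ x ∈ W, x ≠ 0 → 0 < hForm (toC (A 0)) x) →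
    finrank ℂ W ≤ nf ∧ (nf ≤ finrank ℂ W → ∀ y, toC Z *ᵥ y ∈ W)

theorem IsNormalForm.exists_isFastFrame (h : IsNormalForm A Q S) :
    ∃ (nf : ℕ) (Z : Matrix (Fin m ⊕ Fin r) (Fin nf) ℝ), IsFastFrame A Q Z := by
  obtain ⟨L, hL, hSL⟩ := exists_transpose_mul_self_of_posDef h.neg
  have hA := h.isUnit
  obtain ⟨N, hN⟩ : ∃ N : Matrix (Fin m ⊕ Fin r) (Fin r) ℝ,
      N = (A 0)⁻¹ * (fromRows 0 Lᵀ : Matrix (Fin m ⊕ Fin r) (Fin r) ℝ) := ⟨_, rfl⟩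
  have hAN : A 0 * N = fromRows 0 Lᵀ := by
    rw [hN, ← Matrix.mul_assoc, Matrix.mul_nonsing_inv _ hA, Matrix.one_mul]
  -- In these terms `A_1⁻¹ Q = -N N* A_1`, so that `A_1⁻¹ Q N = -N G` with `G = N* A_1 N` symmetric.
  have hF : (A 0)⁻¹ * Q = -(N * (Nᵀ * A 0)) := by
    have h1 : Nᵀ * A 0 = fromCols 0 L := by
      have := congrArg Matrix.transpose hAN
      rwa [Matrix.transpose_mul, (h.symm 0).eq, Matrix.transpose_fromRows,
        Matrix.transpose_transpose, Matrix.transpose_zero] at this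
    have h2 : Q = -((fromRows 0 Lᵀ : Matrix (Fin m ⊕ Fin r) (Fin r) ℝ) *
        (fromCols 0 L : Matrix (Fin r) (Fin m ⊕ Fin r) ℝ)) := by
      rw [h.source, Matrix.fromRows_mul_fromCols, ← hSL, Matrix.fromBlocks_neg]
      simp
    rw [h1, h2, Matrix.mul_neg, ← Matrix.mul_assoc, ← hN]
  obtain ⟨G, hGN⟩ : ∃ G, G = Nᵀ * A 0 * N := ⟨_, rfl⟩
  have hG : G.IsSymm := by
    rw [hGN, Matrix.IsSymm, Matrix.transpose_mul, Matrix.transpose_mul, Matrix.transpose_transpose,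
      (h.symm 0).eq, Matrix.mul_assoc]
  have hFC : (toC (A 0))⁻¹ * toC Q = -(toC N * toC (Nᵀ * A 0)) := by
    rw [← toC_inv hA, ← toC_mul, hF, toC_neg, toC_mul]
  have hFN : ∀ y, ((toC (A 0))⁻¹ * toC Q) *ᵥ (toC N *ᵥ y) = -(toC N *ᵥ (toC G *ᵥ y)) := fun y => by
    rw [hFC, Matrix.neg_mulVec, Matrix.mulVec_mulVec, Matrix.mulVec_mulVec, Matrix.mul_assoc,
      ← toC_mul, ← hGN]
  have hform : ∀ y, hForm (toC (A 0)) (toC N *ᵥ y) = hForm (toC G) y := fun y => by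
    rw [hForm, hForm, star_mulVec, ← Matrix.dotProduct_mulVec, Matrix.mulVec_mulVec,
      Matrix.mulVec_mulVec, ← toC_transpose, ← toC_mul, ← toC_mul, ← hGN]
  have hNinj : Function.Injective (toC N).mulVec := fun x y hxy => by
    have h1 := congrArg (toC (A 0) *ᵥ ·) hxy
    simp only [Matrix.mulVec_mulVec, ← toC_mul, hAN] at h1
    have h2 : toC Lᵀ *ᵥ x = toC Lᵀ *ᵥ y := by
      ext i
      exact congrFun h1 (Sum.inr i)
    refine Matrix.mulVec_injective_of_isUnit ((Matrix.isUnit_iff_isUnit_det _).2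
      (isUnit_det_toC ?_)) h2
    rwa [Matrix.det_transpose]
  obtain ⟨V, d, hV⟩ := exists_isOrthDiag hG
  set e := (Fintype.equivFin {i // 0 < d i}).symm
  set f : Fin (Fintype.card {i // 0 < d i}) → Fin r := fun j => (e j : Fin r)
  have hf : Function.Injective f := Subtype.val_injective.comp e.injective
  have hfd : ∀ j, 0 < d (f j) := fun j => (e j).2
  refine ⟨_, N * V.submatrix id f, ?_, ?_, ?_⟩
  · intro y
    rw [toC_mul, ← Matrix.mulVec_mulVec, Matrix.mulVec_mulVec _ (toC (A 0)), ← toC_mul, hAN]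
    ext i
    have h1 : ∀ j, toC (fromRows (0 : Matrix (Fin m) (Fin r) ℝ) Lᵀ) (Sum.inl i) j = 0 := fun j => by
      simp [toC]
    simp [Matrix.mulVec, dotProduct, Matrix.mul_apply, h1]
  · intro y hy
    rw [toC_mul, ← Matrix.mulVec_mulVec, hform, hV.hForm_submatrix hf]
    obtain ⟨j, hj⟩ := Function.ne_iff.1 hy
    have : 0 < ‖y j‖ := norm_pos_iff.2 hj
    exact Finset.sum_pos' (fun j _ => mul_nonneg (hfd j).le (sq_nonneg _))
      ⟨j, Finset.mem_univ j, mul_pos (hfd j) (by positivity)⟩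
  · intro W hWF hWr hWpos
    set Y := W.comap (toC N).mulVecLin
    have hWY : W = Y.map (toC N).mulVecLin := by
      refine le_antisymm (fun x hx => ?_) (Submodule.map_comap_le _ _)
      obtain ⟨x', rfl⟩ := hWr x hx
      rw [hFC, Matrix.neg_mulVec, ← Matrix.mulVec_mulVec, ← Matrix.mulVec_neg] at hx ⊢
      exact ⟨_, hx, rfl⟩
    have hWle : finrank ℂ W ≤ finrank ℂ Y := by
      rw [hWY]; exact Submodule.finrank_map_le _ _
    have hYpos : ∀ y ∈ Y, y ≠ 0 → 0 < hForm (toC G) y := fun y hy hy0 => by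
      rw [← hform]
      exact hWpos _ hy fun h0 => hy0 (hNinj (by rw [h0, Matrix.mulVec_zero]))
    have hYinv : ∀ y ∈ Y, toC G *ᵥ y ∈ Y := fun y hy => by
      have h1 := W.neg_mem (hWF _ hy)
      rw [Matrix.mulVecLin_apply, hFN, neg_neg] at h1
      exact h1
    refine ⟨hWle.trans (hV.finrank_le_of_pos hYpos), fun hdim => ?_⟩
    have hYV : Y = LinearMap.range (toC (V.submatrix id f)).mulVecLin := by
      refine Submodule.eq_of_le_of_finrank_le (fun y hy => ?_) ?_
      · have h0 : ∀ i, ¬ 0 < d i → ((toC V)ᴴ *ᵥ y) i = 0 := fun i hi => by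
          -- `G - d_i` is injective on `Y`, hence onto, and `V* (G - d_i)` has no `i`-th component.
          have hsub : ∀ y, (toC G - (d i : ℂ) • 1) *ᵥ y = toC G *ᵥ y - (d i : ℂ) • y :=
            fun y => by rw [Matrix.sub_mulVec, Matrix.smul_mulVec, Matrix.one_mulVec]
          obtain ⟨y', hy', rfl⟩ := exists_preimage_of_injOn (W := Y)
            (X := toC G - (d i : ℂ) • 1)
            (fun y hy => by rw [hsub]; exact Y.sub_mem (hYinv y hy) (Y.smul_mem _ hy))
            (fun y hy hy0 => by
              by_contra hne
              have h1 := hYpos y hy hne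
              rw [hsub] at hy0
              rw [hForm, sub_eq_zero.1 hy0, dotProduct_smul, smul_eq_mul,
                Complex.re_ofReal_mul] at h1
              have h2 : 0 ≤ (star y ⬝ᵥ y).re := by
                have h3 := (hForm_one_pos hne).le
                rwa [hForm, Matrix.one_mulVec] at h3
              exact absurd (mul_nonpos_of_nonpos_of_nonneg (not_lt.1 hi) h2) (not_le.2 h1)) hy
          have h1 : (toC V)ᴴ * toC G = toC (diagonal d) * (toC V)ᴴ := by
            rw [← toC_transpose, ← toC_mul, ← toC_mul]
            nth_rewrite 1 [hV.eq]
            rw [← Matrix.mul_assoc, ← Matrix.mul_assoc, hV.left, Matrix.one_mul]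
          rw [hsub, Matrix.mulVec_sub, Matrix.mulVec_mulVec, h1, ← Matrix.mulVec_mulVec,
            Matrix.mulVec_smul, toC_diagonal, Pi.sub_apply, Matrix.mulVec_diagonal,
            Pi.smul_apply, smul_eq_mul, sub_self]
        refine ⟨fun j => ((toC V)ᴴ *ᵥ y) (f j), ?_⟩
        have h1 : toC V *ᵥ ((toC V)ᴴ *ᵥ y) = y := by
          rw [Matrix.mulVec_mulVec, ← toC_transpose, ← toC_mul, hV.right, toC_one,
            Matrix.one_mulVec]
        conv_rhs => rw [← h1]
        ext i
        refine Fintype.sum_of_injective f hf _ _ (fun i' hi' => ?_) (fun j => rfl)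
        rw [h0 i' fun hpos => hi' ⟨e.symm ⟨i', hpos⟩, by simp [f]⟩, mul_zero]
      · refine le_trans (LinearMap.finrank_range_le _) ?_
        rw [Module.finrank_fin_fun]
        exact hdim.trans hWle
    intro y
    rw [toC_mul, ← Matrix.mulVec_mulVec]
    have h1 : toC (V.submatrix id f) *ᵥ y ∈ Y := by
      rw [hYV]; exact ⟨y, rfl⟩
    exact h1

end Layers

/-! ### Decomposition of the limit of the stable subspaces -/

section Decomposition

open Module

variable {k m r p q nf : ℕ} {A : Fin (k + 1) → Matrix (Fin m ⊕ Fin r) (Fin m ⊕ Fin r) ℝ}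
  {Q : Matrix (Fin m ⊕ Fin r) (Fin m ⊕ Fin r) ℝ} {S : Matrix (Fin r) (Fin r) ℝ}
  {P₁ : Matrix (Fin m) (Fin p) ℝ} {P₀ : Matrix (Fin m) (Fin q) ℝ} {lam : Fin p → ℝ}
  {Z : Matrix (Fin m ⊕ Fin r) (Fin nf) ℝ}

theorem IsNormalForm.comp_inr_eq_zero (h : IsNormalForm A Q S) {x : Fin m ⊕ Fin r → ℂ}
    (hx : toC Q *ᵥ x = 0) : x ∘ Sum.inr = 0 := by
  by_contra hne
  have h1 := hForm_toC_pos h.neg hne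
  have h2 := h.hForm_source x
  rw [hForm, hx, dotProduct_zero, Complex.zero_re] at h2
  linarith

theorem IsNormalForm.toBlocks_symm (h : IsNormalForm A Q S) (j : Fin (k + 1)) :
    (A j).toBlocks₁₁.IsSymm := by
  ext i i'
  exact congrFun (congrFun (h.symm j) (Sum.inl i)) (Sum.inl i')

namespace IsFastFrame

/-- The form of `A_1` splits on equilibrium states and boundary layers. -/
theorem hForm_add (hZ : IsFastFrame A Q Z) (h : IsNormalForm A Q S) (u : Fin m → ℂ)
    (y : Fin nf → ℂ) :
    hForm (toC (A 0)) (inlVec m r u + toC Z *ᵥ y) =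
      hForm (toC (A 0).toBlocks₁₁) u + hForm (toC (A 0)) (toC Z *ᵥ y) := by
  rw [RelaxationIBVP.hForm_add (isHermitian_toC (h.symm 0)), hForm_inlVec,
    star_inlVec_dotProduct, hZ.flux, dotProduct_zero, Complex.zero_re, mul_zero, add_zero]
  rfl

/-- The equilibrium states on which `A_1` is nonnegative and the boundary layers are independent,
and `A_1` is nonnegative on their sum. -/
theorem card_le (hZ : IsFastFrame A Q Z) (h : IsNormalForm A Q S)
    (hF : IsSpectralFrame (A 0).toBlocks₁₁ P₁ P₀ lam) :
    posEigCount (A 0).toBlocks₁₁ + q + nf ≤ posEigCount (A 0) := by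
  have hD := hF.isOrthDiag
  set d : Fin p ⊕ Fin q → ℝ := Sum.elim lam 0
  set V := fromCols P₁ P₀
  set f : {i // 0 ≤ d i} → Fin p ⊕ Fin q := Subtype.val
  have hf : Function.Injective f := Subtype.val_injective
  set W : Matrix (Fin m) {i // 0 ≤ d i} ℝ := V.submatrix id f
  have hW0 : ∀ x, 0 ≤ hForm (toC (A 0).toBlocks₁₁) (toC W *ᵥ x) := fun x => by
    rw [hD.hForm_submatrix hf]
    exact Finset.sum_nonneg fun j _ => mul_nonneg j.2 (sq_nonneg _)
  have hZ0 : ∀ y, 0 ≤ hForm (toC (A 0)) (toC Z *ᵥ y) := fun y => by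
    by_cases hy : y = 0
    · rw [hy, Matrix.mulVec_zero, hForm_zero]
    · exact (hZ.pos y hy).le
  set g : ({i // 0 ≤ d i} → ℂ) × (Fin nf → ℂ) →ₗ[ℂ] (Fin m ⊕ Fin r → ℂ) :=
    (inlVec m r ∘ₗ (toC W).mulVecLin).coprod (toC Z).mulVecLin
  have hg : ∀ x y, g (x, y) = inlVec m r (toC W *ᵥ x) + toC Z *ᵥ y := fun x y => rfl
  have hinj : Function.Injective g := by
    rw [← LinearMap.ker_eq_bot, LinearMap.ker_eq_bot']
    rintro ⟨x, y⟩ hxy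
    rw [hg] at hxy
    have h1 := hZ.hForm_add h (toC W *ᵥ x) y
    rw [hxy, hForm_zero] at h1
    have hy : y = 0 := by
      by_contra hne
      linarith [hZ.pos y hne, hW0 x]
    rw [hy, Matrix.mulVec_zero, add_zero] at hxy
    have hx : toC W *ᵥ x = 0 := inlVec_injective (hxy.trans (map_zero _).symm)
    rw [hy, injective_toC_of_gram (hD.gram_submatrix hf) (hx.trans (Matrix.mulVec_zero _).symm)]
    rfl
  have h2 := LinearMap.finrank_range_of_inj hinj
  rw [Module.finrank_prod, Module.finrank_fin_fun, Module.finrank_fintype_fun_eq_card,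
    hF.card_nonneg] at h2
  rw [← h2]
  refine finrank_le_posEigCount (h.symm 0) h.isUnit ?_
  rintro _ ⟨⟨x, y⟩, rfl⟩
  rw [hg, hZ.hForm_add h]
  exact add_nonneg (hW0 x) (hZ0 y)

/-- The limit of the stable subspaces consists of the stable solutions of the equilibrium system,
the states in the kernel of `A_11`, which are the traces of the intermediate layers, and the
boundary layers. It is characterized by its dimension, its invariance and the sign of `A_1`. -/
theorem mem_limit (hZ : IsFastFrame A Q Z) (h : IsNormalForm A Q S)
    (hF : IsSpectralFrame (A 0).toBlocks₁₁ P₁ P₀ lam) {ξ : ℂ} (hξ : 0 < ξ.re) (ω : Fin k → ℝ)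
    {K : Matrix (Fin m ⊕ Fin r) (Fin m ⊕ Fin r) ℂ} (hQK : toC Q * K = 0)
    (hK : fromBlocks 1 0 0 0 * (ξ • 1 + tangentialSymbol A ω) * K = -fromBlocks 1 0 0 0)
    {W : Submodule ℂ (Fin m ⊕ Fin r → ℂ)} (hdim : finrank ℂ W = posEigCount (A 0))
    (hW : ∀ x ∈ W, 0 ≤ hForm (toC (A 0)) x)
    (hWF : ∀ x ∈ W, ((toC (A 0))⁻¹ * toC Q) *ᵥ x ∈ W)
    (hWK : ∀ x ∈ W, (K * toC (A 0)) *ᵥ x ∈ W) :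
    posEigCount (A 0).toBlocks₁₁ + q + nf = posEigCount (A 0) ∧
      (∀ b, inlVec m r (toC P₀ *ᵥ b) ∈ W) ∧ (∀ y, toC Z *ᵥ y ∈ W) ∧
      ∀ {κ : Type} [Fintype κ] [DecidableEq κ] (R : Matrix (Fin p) κ ℂ),
        IsRightStable (reducedMatrix (fun j => (A j).toBlocks₁₁) P₁ P₀ lam ξ ω) R →
        ∀ t, inlVec m r (toC P₁ *ᵥ (R *ᵥ t)) ∈ W := by
  have hH := isHermitian_toC (h.symm 0)
  have hAu := h.isUnit_toC
  set F := (toC (A 0))⁻¹ * toC Q with hFdef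
  have hAF : ∀ x, toC (A 0) *ᵥ (F *ᵥ x) = toC Q *ᵥ x := fun x => by
    rw [Matrix.mulVec_mulVec, hFdef, ← Matrix.mul_assoc, Matrix.mul_nonsing_inv _ hAu,
      Matrix.one_mul]
  set U := W.comap (inlVec m r) with hU
  have hUpos : ∀ u ∈ U, 0 ≤ hForm (toC (A 0).toBlocks₁₁) u := fun u hu => by
    have := hW _ hu
    rwa [hForm_inlVec] at this
  have hUinv : ∀ u ∈ U, ∃ y ∈ U, (ξ • 1 + tangentialSymbol (fun j => (A j).toBlocks₁₁) ω) *ᵥ y =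
      -(toC (A 0).toBlocks₁₁ *ᵥ u) := fun u hu => by
    set x := (K * toC (A 0)) *ᵥ inlVec m r u with hx
    have hx0 : x ∘ Sum.inr = 0 := by
      refine h.comp_inr_eq_zero ?_
      rw [hx, Matrix.mulVec_mulVec, ← Matrix.mul_assoc, hQK, Matrix.zero_mul, Matrix.zero_mulVec]
    refine ⟨x ∘ Sum.inl, ?_, ?_⟩
    · rw [hU, Submodule.mem_comap, inlVec_comp_inl hx0]
      exact hWK _ hu
    · have h1 : fromBlocks (1 : Matrix (Fin m) (Fin m) ℂ) 0 0 (0 : Matrix (Fin r) (Fin r) ℂ) *ᵥ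
          ((ξ • 1 + tangentialSymbol A ω) *ᵥ x) =
          -(fromBlocks 1 0 0 0 *ᵥ (toC (A 0) *ᵥ inlVec m r u)) := by
        rw [hx, Matrix.mulVec_mulVec, Matrix.mulVec_mulVec, ← Matrix.mul_assoc, hK,
          Matrix.neg_mul, Matrix.neg_mulVec, Matrix.mulVec_mulVec]
      have h2 := congrArg (fun z => z ∘ Sum.inl) h1
      simp only [Matrix.fromBlocks_mulVec, Matrix.one_mulVec, Matrix.zero_mulVec, add_zero] at h2
      rw [← inlVec_comp_inl hx0, mulVec_inlVec, symbol_toBlocks₁₁] at h2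
      have h3 := mulVec_inlVec (r := r) (toC (A 0)) u
      ext i
      have h4 := congrFun h2 i
      simp only [Function.comp_apply, Sum.elim_inl, Pi.neg_apply] at h4
      have h5 := congrFun h3 i
      rw [Function.comp_apply] at h5
      rw [h4, h5]
      rfl
  have hUdim := hF.finrank_le_of_nonneg hUpos
  -- The range of `A_1⁻¹ Q` on `W` consists of boundary layers: `A_1` is definite on it, since an
  -- isotropic `F x` is orthogonal to `x`, whence `Re x* Q x = 0` and `Q x = 0`.
  set Y := W.map F.mulVecLin with hY
  have hYW : Y ≤ W := by
    rintro _ ⟨x, hx, rfl⟩; exact hWF x hx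
  have hYmax := hZ.maximal Y
    (by rintro _ ⟨x, hx, rfl⟩; exact ⟨_, hWF x hx, rfl⟩)
    (by rintro _ ⟨x, -, rfl⟩; exact ⟨x, rfl⟩)
    (by
      rintro _ ⟨x, hx, rfl⟩ hne
      refine lt_of_le_of_ne (hW _ (hWF x hx)) fun h0 => hne ?_
      have h1 := dotProduct_mulVec_eq_zero_of_isotropic hH hW (hWF x hx) hx h0.symm
      rw [hAF] at h1
      have h2 := h.source_mulVec_eq_zero (x := x) (by rw [hForm, h1, Complex.zero_re])
      rw [Matrix.mulVecLin_apply, hFdef, ← Matrix.mulVec_mulVec, h2, Matrix.mulVec_zero])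
  -- Rank and nullity of `A_1⁻¹ Q` on `W`; its kernel consists of equilibrium states.
  have hsum : finrank ℂ W ≤ finrank ℂ Y + finrank ℂ U := by
    have h1 := LinearMap.finrank_range_add_finrank_ker (F.mulVecLin.domRestrict W)
    rw [LinearMap.range_domRestrict, ← hY] at h1
    have h2 : finrank ℂ (LinearMap.ker (F.mulVecLin.domRestrict W)) ≤ finrank ℂ U := by
      have h3 : (LinearMap.ker (F.mulVecLin.domRestrict W)).map W.subtype ≤
          U.map (inlVec m r) := by
        rintro _ ⟨x, hx, rfl⟩
        have hx0 : F *ᵥ (x : Fin m ⊕ Fin r → ℂ) = 0 := hx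
        have hQx := hAF (x : Fin m ⊕ Fin r → ℂ)
        rw [hx0, Matrix.mulVec_zero] at hQx
        have hinl := inlVec_comp_inl (h.comp_inr_eq_zero hQx.symm)
        refine ⟨(x : Fin m ⊕ Fin r → ℂ) ∘ Sum.inl, ?_, hinl⟩
        change inlVec m r _ ∈ W
        rw [hinl]; exact x.2
      have h4 := Submodule.finrank_mono h3
      rw [Submodule.finrank_map_subtype_eq] at h4
      exact h4.trans (Submodule.finrank_map_le _ _)
    omega
  have hle := hZ.card_le h hF
  have hYdim := hYmax.1
  have hUfull : posEigCount (A 0).toBlocks₁₁ + q ≤ finrank ℂ U := by omega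
  refine ⟨by omega, fun b => hF.mulVec_P₀_mem hUpos hUfull b,
    fun y => hYW (hYmax.2 (by omega) y), fun R hR t => ?_⟩
  exact hF.mulVec_P₁_mem (E := fun j => (A j).toBlocks₁₁) h.toBlocks_symm hξ ω hUpos hUfull hUinv
    hR t

end IsFastFrame

end Decomposition

/-! ### Change of unknowns -/

section ChangeOfUnknowns

variable {ν : Type*} [Fintype ν] [DecidableEq ν]

/-- If `T* T` symmetrizes `X`, then `T X T⁻¹` is symmetric. -/
theorem isSymm_conj {T X : Matrix ν ν ℝ} (hT : IsUnit T.det) (h : (Tᵀ * T * X).IsSymm) :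
    (T * X * T⁻¹).IsSymm := by
  have h1 : T * X * T⁻¹ = (T⁻¹)ᵀ * (Tᵀ * T * X) * T⁻¹ := by
    simp only [← Matrix.mul_assoc]
    rw [← Matrix.transpose_mul, Matrix.mul_nonsing_inv _ hT, Matrix.transpose_one, Matrix.one_mul]
  rw [h1, Matrix.IsSymm, Matrix.transpose_mul, Matrix.transpose_mul, h.eq,
    Matrix.transpose_transpose, ← Matrix.mul_assoc]

theorem posEigCount_conj {T : Matrix ν ν ℝ} (X : Matrix ν ν ℝ) (hT : IsUnit T.det) :
    posEigCount (T * X * T⁻¹) = posEigCount X := by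
  obtain ⟨U, hU⟩ := (Matrix.isUnit_iff_isUnit_det _).2 hT
  rw [posEigCount, posEigCount, ← hU, Matrix.charpoly_units_conj]

theorem isUnit_det_conj {T X : Matrix ν ν ℝ} (hT : IsUnit T.det) (hX : IsUnit X.det) :
    IsUnit (T * X * T⁻¹).det := by
  rw [Matrix.det_mul, Matrix.det_mul]
  exact (hT.mul hX).mul (Matrix.isUnit_nonsing_inv_det _ hT)

theorem toC_conj {T : Matrix ν ν ℝ} (X : Matrix ν ν ℝ) (hT : IsUnit T.det) :
    toC (T * X * T⁻¹) = toC T * toC X * (toC T)⁻¹ := by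
  rw [toC_mul, toC_mul, toC_inv hT]

theorem tangentialSymbol_conj {k : ℕ} (A : Fin (k + 1) → Matrix ν ν ℝ) {T : Matrix ν ν ℝ}
    (hT : IsUnit T.det) (ω : Fin k → ℝ) :
    tangentialSymbol (fun j => T * A j * T⁻¹) ω = toC T * tangentialSymbol A ω * (toC T)⁻¹ := by
  simp only [tangentialSymbol, toC_conj _ hT, Matrix.mul_smul, Matrix.smul_mul, Finset.mul_sum,
    Finset.sum_mul]

theorem kreissMatrix_conj {k : ℕ} (A : Fin (k + 1) → Matrix ν ν ℝ) (Q : Matrix ν ν ℝ)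
    {T : Matrix ν ν ℝ} (hT : IsUnit T.det) (ξ : ℂ) (ω : Fin k → ℝ) (η : ℝ) :
    kreissMatrix (fun j => T * A j * T⁻¹) (T * Q * T⁻¹) ξ ω η =
      toC T * kreissMatrix A Q ξ ω η * (toC T)⁻¹ := by
  have hTC := isUnit_det_toC hT
  have h1 : ξ • (1 : Matrix ν ν ℂ) = toC T * (ξ • 1) * (toC T)⁻¹ := by
    rw [Matrix.mul_smul, Matrix.mul_one, Matrix.smul_mul, Matrix.mul_nonsing_inv _ hTC]
  have h2 : (η : ℂ) • (toC T * toC Q * (toC T)⁻¹) = toC T * ((η : ℂ) • toC Q) * (toC T)⁻¹ := by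
    rw [Matrix.mul_smul, Matrix.smul_mul]
  rw [kreissMatrix, tangentialSymbol_conj A hT, toC_conj _ hT, toC_conj _ hT, h1, h2,
    ← Matrix.sub_mul, ← Matrix.mul_sub, ← Matrix.sub_mul, ← Matrix.mul_sub, Matrix.mul_inv_rev,
    Matrix.mul_inv_rev, Matrix.nonsing_inv_nonsing_inv _ hTC, kreissMatrix]
  simp only [Matrix.mul_assoc]
  rw [← Matrix.mul_assoc (toC T)⁻¹ (toC T), Matrix.nonsing_inv_mul _ hTC, Matrix.one_mul]

/-- The Generalized Kreiss Condition does not depend on the choice of the unknowns. -/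
theorem GeneralizedKreissCondition.conj {k s : ℕ} {A : Fin (k + 1) → Matrix ν ν ℝ}
    {Q T : Matrix ν ν ℝ} {B : Matrix (Fin s) ν ℝ} (h : GeneralizedKreissCondition A Q B)
    (hT : IsUnit T.det) :
    GeneralizedKreissCondition (fun j => T * A j * T⁻¹) (T * Q * T⁻¹) (B * T⁻¹) := by
  obtain ⟨c, hc, h⟩ := h
  have hTC := isUnit_det_toC hT
  obtain ⟨c', hc', h'⟩ := exists_gramRoot_mul_le (κ := Fin s) (W := (toC T)⁻¹)
    (Matrix.mulVec_injective_of_isUnit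
      ((Matrix.isUnit_iff_isUnit_det _).2 (Matrix.isUnit_nonsing_inv_det _ hTC)))
  refine ⟨c * c', mul_pos hc hc', fun η ω ξ hη hξ R hR => ?_⟩
  rw [kreissMatrix_conj A Q hT] at hR
  have h1 := h η ω ξ hη hξ _ (hR.of_conj hTC)
  rw [← Matrix.mul_assoc, ← toC_inv hT, ← toC_mul] at h1
  refine le_trans ?_ h1
  rw [mul_assoc, toC_inv hT]
  exact mul_le_mul_of_nonneg_left (h' R) hc.le

end ChangeOfUnknowns

/-! ### Existence of the normal form -/

section Normalization

variable {k m r : ℕ} {A : Fin (k + 1) → Matrix (Fin m ⊕ Fin r) (Fin m ⊕ Fin r) ℝ}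
  {Q P A₀ T : Matrix (Fin m ⊕ Fin r) (Fin m ⊕ Fin r) ℝ} {S : Matrix (Fin r) (Fin r) ℝ}

theorem StructuralStability.isNormalForm (h : StructuralStability A Q P S A₀)
    (hA : IsUnit (A 0).det) (hT : IsNormalizing Q A₀ T) :
    ∃ S', IsNormalForm (fun j => T * A j * T⁻¹) (T * Q * T⁻¹) S' := by
  obtain ⟨hTu, hTT, S', hneg, hQ⟩ := hT
  exact ⟨S', fun j => isSymm_conj hTu (by rw [hTT]; exact h.symm j), isUnit_det_conj hTu hA, hQ,
    hneg⟩

theorem StructuralStability.rank_source (h : StructuralStability A Q P S A₀) : Q.rank = r := by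
  have h1 : (fromBlocks 0 0 0 S : Matrix (Fin m ⊕ Fin r) (Fin m ⊕ Fin r) ℝ) =
      fromBlocks 1 0 0 S * diagonal (Sum.elim 0 1) := by
    rw [← Matrix.fromBlocks_diagonal, Matrix.fromBlocks_multiply]
    simp
  have h2 : IsUnit (fromBlocks 1 0 0 S : Matrix (Fin m ⊕ Fin r) (Fin m ⊕ Fin r) ℝ).det := by
    rw [Matrix.det_fromBlocks_zero₁₂, Matrix.det_one, one_mul]; exact h.isUnit_S
  rw [← Matrix.rank_mul_eq_right_of_isUnit_det P Q h.isUnit_P, h.source,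
    Matrix.rank_mul_eq_left_of_isUnit_det _ _ h.isUnit_P, h1,
    Matrix.rank_mul_eq_right_of_isUnit_det _ _ h2, Matrix.rank_diagonal,
    Fintype.card_subtype, Finset.card_filter, Fintype.sum_sum_type]
  simp

theorem StructuralStability.posSemidef_neg (h : StructuralStability A Q P S A₀)
    (hsymm : A₀ * Q = Qᵀ * A₀) : (-(A₀ * Q)).PosSemidef := by
  have h1 : (Pᵀ * fromBlocks 0 0 0 1 * P).PosSemidef := by
    have h2 : (fromBlocks 0 0 0 1 : Matrix (Fin m ⊕ Fin r) (Fin m ⊕ Fin r) ℝ).PosSemidef := by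
      have : (fromBlocks 0 0 0 1 : Matrix (Fin m ⊕ Fin r) (Fin m ⊕ Fin r) ℝ) =
          diagonal (Sum.elim 0 1) := by
        rw [← Matrix.fromBlocks_diagonal]; simp
      rw [this]
      refine Matrix.PosSemidef.diagonal fun i => ?_
      cases i <;> simp
    have := h2.conjTranspose_mul_mul_same P
    rwa [Matrix.conjTranspose_eq_transpose_of_trivial] at this
  have h3 := (h.coupling.add h1).smul (show (0 : ℝ) ≤ 1 / 2 by norm_num)
  convert h3 using 1
  rw [← hsymm]
  ext i j
  simp only [Matrix.neg_apply, Matrix.smul_apply, Matrix.add_apply, Matrix.sub_apply, smul_eq_mul]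
  ring

theorem StructuralStability.exists_isNormalizing (h : StructuralStability A Q P S A₀)
    (hsymm : A₀ * Q = Qᵀ * A₀) : ∃ T, IsNormalizing Q A₀ T := by
  obtain ⟨L, hL, hLL⟩ := exists_transpose_mul_self_of_posDef h.posDef
  have hA₀ : A₀ᵀ = A₀ := by rw [hLL, Matrix.transpose_mul, Matrix.transpose_transpose]
  have hX : (L * Q * L⁻¹).IsSymm := isSymm_conj hL (by
    rw [← hLL, Matrix.IsSymm, Matrix.transpose_mul, hA₀, hsymm])
  obtain ⟨V, d, hV⟩ := exists_isOrthDiag hX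
  have hLinv := Matrix.isUnit_nonsing_inv_det _ hL
  have hd : ∀ i, d i ≤ 0 := by
    have h1 := ((h.posSemidef_neg hsymm).conjTranspose_mul_mul_same (L⁻¹ * V))
    have h2 : (L⁻¹ * V)ᴴ * (-(A₀ * Q)) * (L⁻¹ * V) = diagonal (-d) := by
      rw [Matrix.conjTranspose_eq_transpose_of_trivial, hLL, Matrix.transpose_mul]
      have h3 : (L⁻¹)ᵀ * Lᵀ = 1 := by
        rw [← Matrix.transpose_mul, Matrix.mul_nonsing_inv _ hL, Matrix.transpose_one]
      calc Vᵀ * (L⁻¹)ᵀ * -(Lᵀ * L * Q) * (L⁻¹ * V)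
          = -(Vᵀ * ((L⁻¹)ᵀ * Lᵀ) * (L * Q * L⁻¹ * V)) := by
            simp only [Matrix.mul_neg, Matrix.neg_mul, Matrix.mul_assoc]
        _ = -diagonal d := by
            rw [h3, Matrix.mul_one, hV.mul_eq, ← Matrix.mul_assoc, hV.left, Matrix.one_mul]
        _ = diagonal (-d) := Matrix.diagonal_neg d
    rw [h2] at h1
    exact fun i => neg_nonneg.1 (Matrix.posSemidef_diagonal_iff.1 h1 i)
  have hVu : IsUnit V.det := (Matrix.isUnit_iff_isUnit_det _).1 (IsUnit.of_mul_eq_one _ hV.right)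
  have hr : Fintype.card {i // d i ≠ 0} = r := by
    rw [← Matrix.rank_diagonal, ← Matrix.rank_mul_eq_right_of_isUnit_det V _ hVu, ← hV.mul_eq,
      Matrix.rank_mul_eq_left_of_isUnit_det _ _ hVu, Matrix.rank_mul_eq_left_of_isUnit_det _ _ hLinv,
      Matrix.rank_mul_eq_right_of_isUnit_det _ _ hL, h.rank_source]
  have hm : Fintype.card {i // d i = 0} = m := by
    have := Fintype.card_subtype_compl (fun i => d i = 0)
    have h2 := Fintype.card_subtype_le (fun i => d i = 0)
    rw [Fintype.card_sum, Fintype.card_fin, Fintype.card_fin] at this h2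
    have h3 : Fintype.card {i // ¬ d i = 0} = r := hr
    omega
  -- Reorder the orthonormal eigenvectors of `L Q L⁻¹` so that those in the kernel come first.
  set e : Fin m ⊕ Fin r ≃ Fin m ⊕ Fin r :=
    ((Fintype.equivFinOfCardEq hm).symm.sumCongr (Fintype.equivFinOfCardEq hr).symm).trans
      (Equiv.sumCompl fun i => d i = 0) with he
  have he0 : ∀ i, d (e (Sum.inl i)) = 0 := fun i =>
    ((Fintype.equivFinOfCardEq hm).symm i).2
  have he1 : ∀ i, d (e (Sum.inr i)) ≠ 0 := fun i =>
    ((Fintype.equivFinOfCardEq hr).symm i).2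
  set O := V.submatrix id e
  have hO1 : Oᵀ * O = 1 := hV.gram_submatrix e.injective
  have hO2 : O * Oᵀ = 1 := mul_eq_one_comm.1 hO1
  have hO : (L * Q * L⁻¹) * O = O * diagonal (d ∘ e) := by
    have := congrArg (fun Y => Y.submatrix id e) hV.mul_eq
    ext i j
    have h1 := congrFun (congrFun this i) j
    simp only [Matrix.submatrix_apply, id, Matrix.mul_diagonal] at h1 ⊢
    exact h1
  have hOu : IsUnit O.det := (Matrix.isUnit_iff_isUnit_det _).1 (IsUnit.of_mul_eq_one _ hO2)
  refine ⟨Oᵀ * L, ?_, ?_, diagonal (fun i => d (e (Sum.inr i))), ?_, ?_⟩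
  · rw [Matrix.det_mul, Matrix.det_transpose]; exact hOu.mul hL
  · rw [Matrix.transpose_mul, Matrix.transpose_transpose, Matrix.mul_assoc, ← Matrix.mul_assoc O,
      hO2, Matrix.one_mul, hLL]
  · rw [Matrix.diagonal_neg]
    exact Matrix.posDef_diagonal_iff.2 fun i => neg_pos.2 (lt_of_le_of_ne (hd _) (he1 i))
  · have h1 : (Oᵀ * L)⁻¹ = L⁻¹ * O := by
      rw [Matrix.mul_inv_rev, Matrix.inv_eq_left_inv hO2]
    rw [h1]
    calc Oᵀ * L * Q * (L⁻¹ * O) = Oᵀ * ((L * Q * L⁻¹) * O) := by simp only [Matrix.mul_assoc]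
      _ = diagonal (d ∘ e) := by rw [hO, ← Matrix.mul_assoc, hO1, Matrix.one_mul]
      _ = fromBlocks 0 0 0 (diagonal fun i => d (e (Sum.inr i))) := by
        have h2 : d ∘ e = Sum.elim (0 : Fin m → ℝ) (fun i => d (e (Sum.inr i))) := by
          ext (i | i)
          · exact he0 i
          · rfl
        rw [h2, ← Matrix.fromBlocks_diagonal]
        simp

end Normalization

open Module

/-! ### Block matrices -/

section BlockAlgebra

/-- An injective matrix `Φ` is completed to an invertible one, whose inverse is `Y`. The upper rows
of `Y` annihilate `Φ`. -/
theorem exists_left_inverse_fromCols {s n : ℕ} {κ : Type*} [Fintype κ] [DecidableEq κ]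
    {Φ : Matrix (Fin s) κ ℝ} (hΦ : Function.Injective Φ.mulVec) (hcard : n + Fintype.card κ = s) :
    ∃ (Y : Matrix (Fin n ⊕ κ) (Fin s) ℝ) (Ψ : Matrix (Fin s) (Fin n) ℝ), Y * fromCols Ψ Φ = 1 := by
  obtain ⟨C, hC⟩ := Submodule.exists_isCompl (LinearMap.range Φ.mulVecLin)
  have h1 : finrank ℝ (LinearMap.range Φ.mulVecLin) = Fintype.card κ := by
    rw [LinearMap.finrank_range_of_inj (f := Φ.mulVecLin) hΦ, finrank_fintype_fun_eq_card]
  have h2 := Submodule.finrank_add_eq_of_isCompl hC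
  rw [h1, finrank_fintype_fun_eq_card, Fintype.card_fin] at h2
  set b : Basis (Fin n) ℝ C := finBasisOfFinrankEq ℝ C (by omega)
  set Ψ : Matrix (Fin s) (Fin n) ℝ := (Matrix.of fun j => (b j : Fin s → ℝ))ᵀ with hΨdef
  have hΨ : ∀ y, Ψ *ᵥ y = ((b.equivFun.symm y : C) : Fin s → ℝ) := fun y => by
    rw [Basis.equivFun_symm_apply]
    ext i
    simp [hΨdef, Matrix.mulVec, dotProduct, mul_comm]
  have hinj : Function.Injective (fromCols Ψ Φ).mulVec := by
    refine (injective_iff_map_eq_zero (fromCols Ψ Φ).mulVecLin).2 fun z hz => ?_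
    rw [Matrix.mulVecLin_apply, Matrix.fromCols_mulVec] at hz
    have h3 : Ψ *ᵥ (z ∘ Sum.inl) ∈ C := by rw [hΨ]; exact (b.equivFun.symm _).2
    have h4 : Φ *ᵥ (z ∘ Sum.inr) ∈ LinearMap.range Φ.mulVecLin := ⟨_, rfl⟩
    have h5 : Φ *ᵥ (z ∘ Sum.inr) = 0 := by
      refine Submodule.disjoint_def.1 hC.disjoint _ h4 ?_
      rw [eq_neg_of_add_eq_zero_right hz]
      exact C.neg_mem h3
    rw [h5, add_zero, hΨ] at hz
    have h6 : z ∘ Sum.inl = 0 := b.equivFun.symm.injective (Subtype.ext (by rw [hz, map_zero]; rfl))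
    have h7 : z ∘ Sum.inr = 0 := hΦ (h5.trans (Matrix.mulVec_zero _).symm)
    ext (i | i)
    · exact congrFun h6 i
    · exact congrFun h7 i
  obtain ⟨e⟩ : Nonempty (Fin n ⊕ κ ≃ Fin s) := Fintype.card_eq.1 (by
    rw [Fintype.card_sum, Fintype.card_fin, Fintype.card_fin, hcard])
  set M := (fromCols Ψ Φ).submatrix id e.symm
  have hM : IsUnit M.det := by
    rw [← Matrix.isUnit_iff_isUnit_det, ← Matrix.mulVec_injective_iff_isUnit]
    intro x y hxy
    have h8 : ∀ x, M *ᵥ x = fromCols Ψ Φ *ᵥ (x ∘ e) := fun x => by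
      simpa using Matrix.submatrix_mulVec_equiv (fromCols Ψ Φ) x id e.symm
    rw [h8, h8] at hxy
    exact e.surjective.injective_comp_right (hinj hxy)
  refine ⟨M⁻¹.submatrix e id, Ψ, ?_⟩
  have h9 := congrArg (fun X => X.submatrix e e) (Matrix.nonsing_inv_mul M hM)
  simp only [Matrix.submatrix_one_equiv] at h9
  rw [← h9]
  ext i j
  simp [Matrix.mul_apply, M]

theorem gramRoot_fromBlocks_one {ν κ μ : Type*} [Fintype ν] [Fintype κ] [DecidableEq κ] [Fintype μ]
    [DecidableEq μ] (R : Matrix ν κ ℂ) :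
    gramRoot (fromBlocks R 0 0 (1 : Matrix μ μ ℂ)) = gramRoot R := by
  rw [gramRoot, Matrix.fromBlocks_conjTranspose, Matrix.fromBlocks_multiply]
  simp [gramRoot]

theorem exists_eq_mul_of_range {ν κ μ : Type*} [Fintype κ] [Fintype μ] [DecidableEq μ]
    {R : Matrix ν κ ℂ} {D : Matrix ν μ ℂ}
    (h : ∀ t, D *ᵥ t ∈ LinearMap.range R.mulVecLin) :
    ∃ Z : Matrix κ μ ℂ, D = R * Z := by
  choose y hy using fun j => h (Pi.single j 1)
  refine ⟨((Matrix.of y)ᵀ : Matrix κ μ ℂ), Matrix.ext_of_mulVec_single fun j => ?_⟩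
  rw [← hy, Matrix.mulVecLin_apply, ← Matrix.mulVec_mulVec, Matrix.mulVec_single_one]
  rfl

theorem injective_of_toC {ν κ : Type*} [Fintype κ] {X : Matrix ν κ ℝ}
    (h : Function.Injective (toC X).mulVec) : Function.Injective X.mulVec := fun x y hxy => by
  have h1 : ∀ x : κ → ℝ, toC X *ᵥ (fun i => (x i : ℂ)) = fun i => ((X *ᵥ x) i : ℂ) := fun x => by
    ext i
    simp [toC, Matrix.mulVec, dotProduct]
  have h2 := @h (fun i => (x i : ℂ)) (fun i => (y i : ℂ)) (by rw [h1, h1, hxy])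
  ext i
  exact Complex.ofReal_injective (congrFun h2 i)

end BlockAlgebra

/-! ### The reduced boundary condition -/

section ReducedBoundary

variable {k m r p q nf : ℕ} {A : Fin (k + 1) → Matrix (Fin m ⊕ Fin r) (Fin m ⊕ Fin r) ℝ}
  {Q : Matrix (Fin m ⊕ Fin r) (Fin m ⊕ Fin r) ℝ} {S : Matrix (Fin r) (Fin r) ℝ}
  {P₁ : Matrix (Fin m) (Fin p) ℝ} {P₀ : Matrix (Fin m) (Fin q) ℝ} {lam : Fin p → ℝ}
  {Z : Matrix (Fin m ⊕ Fin r) (Fin nf) ℝ}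

/-- The boundary values that the reduced boundary condition has to ignore, as the columns of
`((P₀, 0), Z)`: states in the kernel of `A_11`, and boundary layers. -/
def layerFrame (P₀ : Matrix (Fin m) (Fin q) ℝ) (Z : Matrix (Fin m ⊕ Fin r) (Fin nf) ℝ) :
    Matrix (Fin m ⊕ Fin r) (Fin q ⊕ Fin nf) ℝ :=
  fromCols (fromRows P₀ 0) Z

theorem toC_fromRows_zero_mulVec (X : Matrix (Fin m) (Fin p) ℝ) (a : Fin p → ℂ) :
    toC (fromRows X (0 : Matrix (Fin r) (Fin p) ℝ)) *ᵥ a = inlVec m r (toC X *ᵥ a) := by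
  ext (i | i) <;> simp [toC, inlVec, Matrix.mulVec, dotProduct]

theorem layerFrame_mulVec (b : Fin q ⊕ Fin nf → ℂ) :
    toC (layerFrame P₀ Z) *ᵥ b =
      inlVec m r (toC P₀ *ᵥ (b ∘ Sum.inl)) + toC Z *ᵥ (b ∘ Sum.inr) := by
  rw [layerFrame, toC_fromCols, Matrix.fromCols_mulVec, toC_fromRows_zero_mulVec]

/-- Equilibrium states and boundary layers are independent. -/
theorem IsFastFrame.injective_fromCols (hZ : IsFastFrame A Q Z) (h : IsNormalForm A Q S)
    (hF : IsSpectralFrame (A 0).toBlocks₁₁ P₁ P₀ lam) :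
    Function.Injective (toC (fromCols (fromRows P₁ 0) (layerFrame P₀ Z))).mulVec := by
  refine (injective_iff_map_eq_zero (Matrix.mulVecLin _)).2 fun z hz => ?_
  rw [Matrix.mulVecLin_apply, toC_fromCols, Matrix.fromCols_mulVec, toC_fromRows_zero_mulVec,
    layerFrame_mulVec, ← add_assoc, ← map_add] at hz
  set u := toC P₁ *ᵥ (z ∘ Sum.inl) + toC P₀ *ᵥ ((z ∘ Sum.inr) ∘ Sum.inl) with hu
  set y := (z ∘ Sum.inr) ∘ Sum.inr with hy
  have h1 : (toC (A 0) *ᵥ inlVec m r u) ∘ Sum.inl = 0 := by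
    have h2 := congrArg (fun x => (toC (A 0) *ᵥ x) ∘ Sum.inl) hz
    have h3 := hZ.flux y
    ext i
    have h4 := congrFun h2 i
    have h5 := congrFun h3 i
    simp only [Matrix.mulVec_add, Function.comp_apply, Pi.add_apply, Matrix.mulVec_zero,
      Pi.zero_apply] at h4 h5 ⊢
    rwa [h5, add_zero] at h4
  have h2 := hZ.hForm_add h u y
  rw [hz, hForm_zero, toC_toBlocks₁₁, ← hForm_inlVec, hForm, star_inlVec_dotProduct, h1,
    dotProduct_zero, Complex.zero_re, zero_add] at h2
  have hy0 : y = 0 := by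
    by_contra hne
    exact (hZ.pos y hne).ne h2
  rw [hy0, Matrix.mulVec_zero, add_zero] at hz
  have hu0 : u = 0 := inlVec_injective (hz.trans (map_zero _).symm)
  have h3 : Sum.elim (z ∘ Sum.inl) ((z ∘ Sum.inr) ∘ Sum.inl) = 0 := by
    refine injective_toC_of_gram hF.orth_left ?_
    rw [toC_fromCols, Matrix.fromCols_mulVec, Matrix.mulVec_zero]
    exact hu0
  ext (i | i | i)
  · exact congrFun h3 (Sum.inl i)
  · exact congrFun h3 (Sum.inr i)
  · exact congrFun hy0 i

/-- The reduced boundary condition. Its matrix `Bo` annihilates the boundary values of the states in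
the kernel of `A_11` and of the boundary layers; completed by rows dual to these values it becomes
an invertible matrix, so that `det (Bo B_u P₁ R)` is up to a constant factor the determinant of `B`
on the limit of the stable subspaces. -/
theorem IsNormalForm.exists_reduced_boundary (h : IsNormalForm A Q S)
    (hF : IsSpectralFrame (A 0).toBlocks₁₁ P₁ P₀ lam) {s n : ℕ} (hs : posEigCount (A 0) = s)
    (hn : posEigCount (A 0).toBlocks₁₁ = n) {B : Matrix (Fin s) (Fin m ⊕ Fin r) ℝ}
    (hB : GeneralizedKreissCondition A Q B) :
    ∃ Bo : Matrix (Fin n) (Fin s) ℝ, Bo.rank = n ∧ Bo * B.toCols₁ * P₀ = 0 ∧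
      UniformKreissCondition (fun j => (A j).toBlocks₁₁) P₁ P₀ lam (Bo * B.toCols₁) := by
  obtain ⟨c, hc, hB⟩ := hB
  obtain ⟨nf, Z, hZ⟩ := h.exists_isFastFrame
  have hlimit : ∀ {ξ : ℂ} (ω : Fin k → ℝ), 0 < ξ.re →
      ∃ R₀ : Matrix (Fin m ⊕ Fin r) (Fin s) ℂ, R₀ᴴ * R₀ = 1 ∧ c ≤ ‖(toC B * R₀).det‖ ∧
        n + (q + nf) = s ∧
        (∀ b, toC (layerFrame P₀ Z) *ᵥ b ∈ LinearMap.range R₀.mulVecLin) ∧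
        ∀ R : Matrix (Fin p) (Fin n) ℂ,
          IsRightStable (reducedMatrix (fun j => (A j).toBlocks₁₁) P₁ P₀ lam ξ ω) R →
          ∀ t, inlVec m r (toC P₁ *ᵥ (R *ᵥ t)) ∈ LinearMap.range R₀.mulVecLin := by
    intro ξ ω hξ
    obtain ⟨R₀, K, h1, h2, h3, h4, h5, h6, h7⟩ :=
      h.exists_limit_frame hs B hξ ω fun η hη R hR => hB η ω ξ hη hξ R hR
    have hdim : finrank ℂ (LinearMap.range R₀.mulVecLin) = posEigCount (A 0) := by
      rw [LinearMap.finrank_range_of_inj (f := R₀.mulVecLin)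
        (mulVec_injective_of_gram (by rw [h1]; simp)), finrank_fin_fun, hs]
    obtain ⟨h8, h9, h10, h11⟩ := hZ.mem_limit h hF hξ ω h6 h7 hdim h3 h4 h5
    refine ⟨R₀, h1, h2, by omega, fun b => ?_, fun R hR t => h11 R hR t⟩
    rw [layerFrame_mulVec]
    exact Submodule.add_mem _ (h9 _) (h10 _)
  have hG := hZ.injective_fromCols h hF
  obtain ⟨cW, hcW, hgram⟩ := exists_gramRoot_mul_le (κ := Fin n ⊕ (Fin q ⊕ Fin nf)) hG
  obtain ⟨Φ, hΦ⟩ : ∃ Φ, Φ = B * layerFrame P₀ Z := ⟨_, rfl⟩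
  obtain ⟨R₀, -, hdet, hcard, hlayer, -⟩ := hlimit (ξ := 1) 0 (by simp)
  have hΦinj : Function.Injective Φ.mulVec := by
    refine injective_of_toC ((injective_iff_map_eq_zero (toC Φ).mulVecLin).2 fun z hz => ?_)
    rw [Matrix.mulVecLin_apply, hΦ, toC_mul, ← Matrix.mulVec_mulVec] at hz
    obtain ⟨y, hy⟩ := hlayer z
    rw [Matrix.mulVecLin_apply] at hy
    have hinj : Function.Injective (toC B * R₀).mulVec := by
      rw [Matrix.mulVec_injective_iff_isUnit, Matrix.isUnit_iff_isUnit_det, isUnit_iff_ne_zero]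
      intro h0
      rw [h0, norm_zero] at hdet
      linarith
    have hy0 : y = 0 := hinj (by
      rw [← Matrix.mulVec_mulVec, hy, hz, Matrix.mulVec_zero])
    rw [hy0, Matrix.mulVec_zero] at hy
    have h1 : Sum.elim (0 : Fin p → ℂ) z = 0 := hG (by
      rw [toC_fromCols, Matrix.fromCols_mulVec, Sum.elim_comp_inl, Sum.elim_comp_inr, ← hy,
        Matrix.mulVec_zero, Matrix.mulVec_zero, add_zero])
    ext i
    exact congrFun h1 (Sum.inr i)
  obtain ⟨Y, Ψ, hY⟩ := exists_left_inverse_fromCols (n := n) hΦinj (by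
    rw [Fintype.card_sum, Fintype.card_fin, Fintype.card_fin, hcard])
  obtain ⟨Bo, Bc, rfl⟩ : ∃ Bo Bc, Y = fromRows Bo Bc :=
    ⟨Y.toRows₁, Y.toRows₂, (Matrix.fromRows_toRows Y).symm⟩
  have hY' := hY
  rw [Matrix.fromRows_mul_fromCols, ← Matrix.fromBlocks_one, Matrix.fromBlocks_inj] at hY'
  obtain ⟨hBΨ, hBΦ, -, hBcΦ⟩ := hY'
  have hcols : ∀ {l : ℕ} (X : Matrix (Fin m) (Fin l) ℝ),
      B * (fromRows X 0 : Matrix (Fin m ⊕ Fin r) (Fin l) ℝ) = B.toCols₁ * X := fun X => by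
    conv_lhs => rw [← Matrix.fromCols_toCols B, Matrix.fromCols_mul_fromRows]
    rw [Matrix.mul_zero, add_zero]
  obtain ⟨e⟩ : Nonempty (Fin s ≃ Fin n ⊕ (Fin q ⊕ Fin nf)) := Fintype.card_eq.1 (by
    rw [Fintype.card_sum, Fintype.card_sum, Fintype.card_fin, Fintype.card_fin, Fintype.card_fin,
      Fintype.card_fin, hcard])
  have hdY : 0 < ‖((toC (fromRows Bo Bc)).submatrix e id).det‖ := by
    rw [norm_pos_iff]
    intro h0
    have h1 := congrArg (fun X => (toC X).submatrix e e) hY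
    simp only [toC_mul, toC_one, Matrix.submatrix_one_equiv] at h1
    rw [Matrix.submatrix_mul _ _ e id e Function.bijective_id] at h1
    have h2 := congrArg Matrix.det h1
    rw [Matrix.det_mul, h0, zero_mul, Matrix.det_one] at h2
    exact zero_ne_one h2
  refine ⟨Bo, ?_, ?_, _, mul_pos (mul_pos hdY hc) hcW, fun ω ξ hξ R hR => ?_⟩
  · refine le_antisymm (Bo.rank_le_card_height.trans_eq (Fintype.card_fin n)) ?_
    have h1 := Matrix.rank_mul_le_left Bo Ψ
    rwa [hBΨ, Matrix.rank_one, Fintype.card_fin] at h1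
  · rw [Matrix.mul_assoc, ← hcols]
    have h1 : Φ = fromCols (B * (fromRows P₀ 0 : Matrix (Fin m ⊕ Fin r) (Fin q) ℝ)) (B * Z) := by
      rw [hΦ, layerFrame, Matrix.mul_fromCols]
    rw [h1, Matrix.mul_fromCols] at hBΦ
    have h2 := congrArg Matrix.toCols₁ hBΦ
    rwa [Matrix.toCols₁_fromCols] at h2
  · obtain ⟨R₀, hR₀, hdet, -, hlayer, hslow⟩ := hlimit ω hξ
    obtain ⟨D, hD⟩ : ∃ D : Matrix (Fin m ⊕ Fin r) (Fin n ⊕ (Fin q ⊕ Fin nf)) ℂ,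
        D = toC (fromCols (fromRows P₁ 0) (layerFrame P₀ Z)) * (fromBlocks R 0 0 1 :
          Matrix (Fin p ⊕ (Fin q ⊕ Fin nf)) (Fin n ⊕ (Fin q ⊕ Fin nf)) ℂ) := ⟨_, rfl⟩
    have hDW : ∀ t, D *ᵥ t ∈ LinearMap.range R₀.mulVecLin := fun t => by
      have h1 : D *ᵥ t = inlVec m r (toC P₁ *ᵥ (R *ᵥ (t ∘ Sum.inl))) +
          toC (layerFrame P₀ Z) *ᵥ (t ∘ Sum.inr) := by
        rw [hD, ← Matrix.mulVec_mulVec, Matrix.fromBlocks_mulVec, toC_fromCols,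
          Matrix.fromCols_mulVec, Sum.elim_comp_inl, Sum.elim_comp_inr, toC_fromRows_zero_mulVec]
        simp
      rw [h1]
      exact Submodule.add_mem _ (hslow R hR _) (hlayer _)
    obtain ⟨N, hN⟩ := exists_eq_mul_of_range hDW
    have hDe : D.submatrix id e = R₀ * N.submatrix id e := by
      rw [hN]; rfl
    have hlower : c * gramRoot D ≤ ‖(toC B * D.submatrix id e).det‖ := by
      rw [← gramRoot_submatrix_equiv D e, hDe, gramRoot_mul, gramRoot_of_orthonormal hR₀, one_mul,
        ← Matrix.mul_assoc, Matrix.det_mul, norm_mul]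
      exact mul_le_mul_of_nonneg_right hdet (norm_nonneg _)
    have hDR : cW * gramRoot R ≤ gramRoot D := by
      have := hgram (fromBlocks R 0 0 1)
      rwa [gramRoot_fromBlocks_one, ← hD] at this
    have hblock : toC (fromRows Bo Bc) * (toC B * D) =
        fromBlocks (toC (Bo * B.toCols₁) * toC P₁ * R) 0 (toC (Bc * B.toCols₁ * P₁) * R) 1 := by
      have h1 : fromRows Bo Bc * (B * fromCols (fromRows P₁ 0) (layerFrame P₀ Z)) =
          fromBlocks (Bo * B.toCols₁ * P₁) 0 (Bc * B.toCols₁ * P₁) 1 := by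
        rw [Matrix.mul_fromCols, ← hΦ, hcols, Matrix.fromRows_mul_fromCols, hBΦ, hBcΦ,
          Matrix.mul_assoc, Matrix.mul_assoc]
      rw [hD, ← Matrix.mul_assoc, ← Matrix.mul_assoc, Matrix.mul_assoc (toC (fromRows Bo Bc)),
        ← toC_mul, ← toC_mul, h1, toC_fromBlocks, Matrix.fromBlocks_multiply, toC_zero, toC_one,
        ← toC_mul]
      simp
    have hdetblock : ‖(toC (Bo * B.toCols₁) * toC P₁ * R).det‖ =
        ‖((toC (fromRows Bo Bc)).submatrix e id).det‖ * ‖(toC B * D.submatrix id e).det‖ := by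
      have h1 := congrArg (fun X => (X.submatrix e e).det) hblock
      simp only [Matrix.det_submatrix_equiv_self, Matrix.det_fromBlocks_zero₁₂, Matrix.det_one,
        mul_one] at h1
      rw [← h1, ← norm_mul, ← Matrix.det_mul, ← Matrix.det_submatrix_equiv_self e]
      rfl
    rw [hdetblock, mul_assoc, mul_assoc]
    refine mul_le_mul_of_nonneg_left (le_trans ?_ hlower) hdY.le
    exact mul_le_mul_of_nonneg_left hDR hc.le

end ReducedBoundary

end RelaxationIBVP

theorem theorem4p5 {k m r nplus : ℕ}
    (A : Fin (k + 1) → Matrix (Fin m ⊕ Fin r) (Fin m ⊕ Fin r) ℝ)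
    (Q P A₀ : Matrix (Fin m ⊕ Fin r) (Fin m ⊕ Fin r) ℝ) (S : Matrix (Fin r) (Fin r) ℝ)
    (B : Matrix (Fin nplus) (Fin m ⊕ Fin r) ℝ)
    (hA₁ : IsUnit (A 0).det)
    (hnplus : RelaxationIBVP.posEigCount (A 0) = nplus)
    (hB : B.rank = nplus)
    (hstab : RelaxationIBVP.StructuralStability A Q P S A₀)
    (hsymm : A₀ * Q = Qᵀ * A₀)
    (hGKC : RelaxationIBVP.GeneralizedKreissCondition A Q B)
    (hchar : (RelaxationIBVP.equilibriumBlock P (A 0)).det = 0) :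
    (∃ T, RelaxationIBVP.IsNormalizing Q A₀ T) ∧
    ∀ T, RelaxationIBVP.IsNormalizing Q A₀ T →
      ∀ (n₁plus p q : ℕ) (P₁ : Matrix (Fin m) (Fin p) ℝ) (P₀ : Matrix (Fin m) (Fin q) ℝ)
        (lam : Fin p → ℝ),
        RelaxationIBVP.posEigCount (RelaxationIBVP.equilibriumBlock T (A 0)) = n₁plus →
        RelaxationIBVP.IsSpectralFrame (RelaxationIBVP.equilibriumBlock T (A 0)) P₁ P₀ lam →
        (∀ (ξ : ℂ) (ω : Fin k → ℝ), 0 < ξ.re →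
          RelaxationIBVP.stableCount (RelaxationIBVP.reducedMatrix
            (fun j => RelaxationIBVP.equilibriumBlock T (A j)) P₁ P₀ lam ξ ω) = n₁plus) ∧
        ∃ Bo : Matrix (Fin n₁plus) (Fin nplus) ℝ, Bo.rank = n₁plus ∧
          Bo * RelaxationIBVP.equilibriumBoundary T B * P₀ = 0 ∧
          RelaxationIBVP.UniformKreissCondition
            (fun j => RelaxationIBVP.equilibriumBlock T (A j)) P₁ P₀ lam
            (Bo * RelaxationIBVP.equilibriumBoundary T B) := by
  refine ⟨hstab.exists_isNormalizing hsymm, ?_⟩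
  intro T hT n₁plus p q P₁ P₀ lam hn hF
  obtain ⟨S', hN⟩ := hstab.isNormalForm hA₁ hT
  refine ⟨fun ξ ω hξ => (hF.stableCount_reducedMatrix hN.toBlocks_symm hξ ω).trans hn, ?_⟩
  exact hN.exists_reduced_boundary hF ((RelaxationIBVP.posEigCount_conj (A 0) hT.1).trans hnplus) hn
    (hGKC.conj hT.1)

end
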